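/- Write $\mathbb{N}_+=\{1,2,\dots\}$ and $[n]=\{1,\dots,n\}$. Let $p=(p_1,p_2,\dots)$ be a probability distribution on $\mathbb{N}_+$ with $p_1>0$, and let $X,X_1,X_2,\dots$ be i.i.d. with distribution $p$. Put $\Pi_1:=X_1$ and, for $i\ge 2$, $\Pi_i:=\psi(X_i)$, where $\psi$ is the increasing bijection from $\mathbb{N}_+$ to $\mathbb{N}_+\setminus\{\Pi_1,\dots,\Pi_{i-1}\}$. This almost surely defines a permutation of $\mathbb{N}_+$; a random permutation $\Pi$ of $\mathbb{N}_+$ with this distribution is called $p$-shifted. A permutation $\pi$ of $\mathbb{N}_+$ (or of $\mathbb{Z}$) splits at $n$ if it maps $\{i\le n\}$ onto itself; for $\mathbb{N}_+$ and $n\ge1$ we also say that $[n]$ is a block, and $0$ is a trivial splitting time. If $\pi$ splits at $n$, its residual permutation is $\pi^n_i:=\pi_{n+i}-n$, $i\in\mathbb{N}_+$. Let $0=T_0<T_1<T_2<\cdots$ be the successive splitting times of $\Pi$ (with $T_k=\infty$ if there are fewer than $k$ positive ones), let $R_n:=1(T_k=n\text{ for some }k\ge 0)$, and let $Y_1:=T_1$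 be the length of the first component of $\Pi$. $\Pi$ is strictly regenerative if $(T_k)$ is a renewal process, that is, $(T_k)_{k\ge0}$ has the law of the partial sums of independent terms, the increments having a common law on $\{1,2,\dots,\infty\}$; and, for each $n>0$ with $\mathbb{P}(R_n=1)>0$, conditionally given $R_n=1$, the pair $(\Pi^n,(R_{n+k})_{k\ge1})$ is independent of $(R_0,\dots,R_n)$ and has a law which does not depend on $n$ and is that of a random permutation together with the renewal indicators of a renewal process with zero delay and the same increment law. Let $\mu:=\mathbb{E}(Y_1)\in[1,\infty]$. $\Pi$ is positive recurrent if $\mu<\infty$, null recurrent if $\mathbb{P}(Y_1<\infty)=1$ and $\mu=\infty$, and transient if $\mathbb{P}(Y_1<\infty)<1$. A stationary version of such a $\Pi$ is a random permutation $\Pi^*$ of $\mathbb{Z}$ whose displacements $(\Pi^*_z-z)_{z\in\mathbb{Z}}$ form a stationary process and such that, for each $z\in\mathbb{Z}$, $\Pi^*$ splits at $z$ with positive probability and, conditionally given this event, $(\Pi^*_{z+i}-z)_{i\ge1}$ is distributed as $(\Pi_i)_{i\ge1}$. Let $\Pi$ be a $p$-shifted permutation of $\mathbb{N}_+$. Then: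 (i) For every $n$ and every injection $(\pi_i,1\le i\le n):[n]\to\mathbb{N}_+$, with $p(k):=p_k$, $$\mathbb{P}(\Pi_i=\pi_i,\ 1\le i\le n)=\prod_{j=1}^n p\Bigl(\pi_j-\sum_{1\le i<j}1(\pi_i<\pi_j)\Bigr).$$ (ii) $u_n:=\mathbb{P}([n]\text{ is a block of }\Pi)=\prod_{j=1}^n\sum_{i=1}^j p_i$. (iii) $\Pi$ is strictly regenerative, with regeneration at every $n$ such that $[n]$ is a block of $\Pi$ and with renewal sequence $\mathbb{P}(R_n=1)=u_n$; moreover, given that $\Pi$ splits at $n$, the residual permutation $\Pi^n$ has the law of $\Pi$. (iv) Let $U(z):=1+\sum_{n\ge1}u_nz^n$ and $f_n:=\mathbb{P}(Y_1=n)$. For complex $|z|<1$ (with $z^\infty:=0$), $U(z)\ne0$ and $$\mathbb{E}z^{Y_1}=\sum_{n=1}^\infty f_nz^n=1-\frac1{U(z)},$$ and $\sum_{n\ge1}f_n=1-1/U(1)$, with $1/\infty:=0$. (v) If $m:=\sum_i i\,p_i<\infty$, then $\mu<\infty$, so $\Pi$ is positive recurrent, and $$u_\infty:=\lim_{n\to\infty}u_n=\mu^{-1}=\prod_{j=1}^\infty\bigl(1-\mathbb{P}(X>j)\bigr).$$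 Let $\nu_j$ be the expected number of cycles of $\Pi$ of length $j$ contained in the first component $[Y_1]$. Then $\mu=\sum_j j\nu_j$, and almost surely, for all $j\ge1$, the number $C_{n,j}$ of cycles of $\Pi$ of length $j$ wholly contained in $[n]$ satisfies $\lim_{n\to\infty}C_{n,j}/n=\nu_j/\mu$; the same holds for the number of cycles of length $j$ whose least element is in $[n]$. Moreover there is a stationary version $\Pi^*$ of $\Pi$ acting on $\mathbb{Z}$; it can be chosen so that $\mathbb{P}(\Pi^*\text{ splits at }z)=1/\mu$ for every $z\in\mathbb{Z}$ and so that, conditionally given a split at $z$, $(\Pi^*_{z+i}-z)_{i\ge1}$ is independent of the set of splitting times of $\Pi^*$ in $(-\infty,z]$. (vi) If $m=\infty$, then $\Pi$ is either null recurrent or transient, according to whether $U(1)=1+\sum_{n\ge1}u_n$ is infinite or finite, and there is no stationary version of $\Pi$ acting on $\mathbb{Z}$. -/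

import Mathlib

open MeasureTheory ProbabilityTheory Filter Topology
open scoped ENNReal

noncomputable section

namespace PShift

/-! ### Measurable structures -/

instance : MeasurableSpace ℕ+ := ⊤

instance : DiscreteMeasurableSpace ℕ+ := ⟨fun _ => trivial⟩

/-- The σ-algebra on permutations generated by the coordinates `σ ↦ σ i`. -/
instance permMeasurableSpace {α : Type*} [MeasurableSpace α] :
    MeasurableSpace (Equiv.Perm α) :=
  MeasurableSpace.comap (fun (σ : Equiv.Perm α) (i : α) => σ i) inferInstance

/-! ### The construction of `p`-shifted permutations -/

/-- The value at `k` of the increasing bijection `ψ : ℕ+ → ℕ+ \ F`,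
i.e. the `k`-th smallest positive integer outside the finite set `F`
(`Nat.nth` counts from `0`, and `m ↦ m + 1` identifies `ℕ` with `ℕ+`). -/
def nthFree (F : Finset ℕ+) (k : ℕ+) : ℕ+ :=
  (Nat.nth (fun m => m.succPNat ∉ F) k.natPred).succPNat

theorem setOf_free_infinite (F : Finset ℕ+) : {m : ℕ | m.succPNat ∉ F}.Infinite := by
  have h : ({m : ℕ | m.succPNat ∈ F}).Finite :=
    F.finite_toSet.preimage (Nat.succPNat_injective.injOn)
  exact h.infinite_compl

theorem nthFree_strictMono (F : Finset ℕ+) : StrictMono (nthFree F) := by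
  intro a b h
  refine Nat.succPNat_strictMono (Nat.nth_strictMono (setOf_free_infinite F) ?_)
  exact PNat.natPred_strictMono h

theorem range_nthFree (F : Finset ℕ+) : Set.range (nthFree F) = {m | m ∉ F} := by
  have h := Nat.range_nth_of_infinite (setOf_free_infinite F)
  ext m
  constructor
  · rintro ⟨k, rfl⟩
    exact Nat.nth_mem_of_infinite (setOf_free_infinite F) k.natPred
  · intro hm
    have h2 : m.natPred ∈ Set.range (Nat.nth (fun m => m.succPNat ∉ F)) := by
      rw [h]
      change m.natPred.succPNat ∉ F
      rw [PNat.succPNat_natPred]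
      exact hm
    obtain ⟨k, hk⟩ := h2
    refine ⟨k.succPNat, ?_⟩
    simp only [nthFree, Nat.natPred_succPNat, hk, PNat.succPNat_natPred]

/-- The sequence `π₁, π₂, …` built from `x₁, x₂, …`: `π i = ψ (x i)`, where `ψ` is the
increasing bijection from `ℕ+` to `ℕ+ \ {π 1, …, π (i - 1)}` (so `π 1 = x 1`). -/
def shiftMap (x : ℕ+ → ℕ+) (i : ℕ+) : ℕ+ :=
  nthFree ((Finset.Iio i).attach.image fun j => shiftMap x j.1) (x i)
termination_by i
decreasing_by exact (Finset.mem_Iio.mp j.2 : j.1 < i)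

theorem shiftMap_eq (x : ℕ+ → ℕ+) (i : ℕ+) :
    shiftMap x i = nthFree ((Finset.Iio i).image (shiftMap x)) (x i) := by
  rw [shiftMap]
  congr 1
  ext m
  simp

/-- The law of an i.i.d. sample `X₁, X₂, …` from `p`. -/
def sampleLaw (p : PMF ℕ+) : Measure (ℕ+ → ℕ+) :=
  Measure.infinitePi fun _ : ℕ+ => p.toMeasure

/-- `Perm` is a `p`-shifted random permutation of `ℕ+`: it has the distribution defined by
the construction `shiftMap` from an i.i.d. sample from `p`. -/
def IsPShifted {Ω : Type*} [MeasurableSpace Ω] (P : Measure Ω) (Perm : Ω → Equiv.Perm ℕ+)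
    (p : PMF ℕ+) : Prop :=
  Measurable Perm ∧
    P.map (fun ω (i : ℕ+) => Perm ω i) = (sampleLaw p).map shiftMap

/-- `p(k) = p_k`, with `p(0) = 0`. -/
def weight (p : PMF ℕ+) (k : ℕ) : ℝ≥0∞ := if h : 0 < k then p ⟨k, h⟩ else 0

/-! ### Splitting times, residual permutations -/

/-- `σ` splits at `n`, that is `σ` maps `[n] = {1, …, n}` onto itself; for `n ≥ 1` this says
that `[n]` is a block of `σ`, and `n = 0` is a trivial splitting time. -/
def SplitsAt (σ : Equiv.Perm ℕ+) (n : ℕ) : Prop :=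
  σ '' {i : ℕ+ | (i : ℕ) ≤ n} = {i : ℕ+ | (i : ℕ) ≤ n}

theorem SplitsAt.lt_iff {σ : Equiv.Perm ℕ+} {n : ℕ} (h : SplitsAt σ n) (i : ℕ+) :
    n < (σ i : ℕ) ↔ n < (i : ℕ) := by
  have h1 : σ i ∈ σ '' {i : ℕ+ | (i : ℕ) ≤ n} ↔ i ∈ {i : ℕ+ | (i : ℕ) ≤ n} :=
    σ.injective.mem_set_image
  rw [h] at h1
  simp only [Set.mem_ofPred_eq] at h1
  omega

/-- The shift `i ↦ n + i` from `ℕ+` to `ℕ+ \ [n]`. -/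
def shiftEquiv (n : ℕ) : ℕ+ ≃ {i : ℕ+ // n < (i : ℕ)} where
  toFun i := ⟨⟨n + i, Nat.add_pos_right n i.pos⟩, Nat.lt_add_of_pos_right i.pos⟩
  invFun j := ⟨(j.1 : ℕ) - n, Nat.sub_pos_of_lt j.2⟩
  left_inv i := by
    apply PNat.eq
    simp
  right_inv j := by
    apply Subtype.ext
    apply PNat.eq
    have := j.2
    simp only [PNat.mk_coe]
    omega

open Classical in
/-- The residual permutation `σⁿ i = σ (n + i) - n` of a permutation `σ` that splits at `n`:
the action of `σ` on `ℕ+ \ [n]` conjugated by the shift (the identity if `σ` does not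
split at `n`). -/
def residual (n : ℕ) (σ : Equiv.Perm ℕ+) : Equiv.Perm ℕ+ :=
  if h : SplitsAt σ n then (shiftEquiv n).symm.permCongr (σ.subtypePerm h.lt_iff) else 1

theorem residual_apply {n : ℕ} {σ : Equiv.Perm ℕ+} (h : SplitsAt σ n) (i : ℕ+) :
    (residual n σ i : ℕ) = (σ ⟨n + i, Nat.add_pos_right n i.pos⟩ : ℕ) - n := by
  rw [residual, dif_pos h]
  rfl

/-- The successive splitting times `0 = T₀ < T₁ < T₂ < …` of `σ`, with value `⊤` for `T_k` if
there are fewer than `k` positive splitting times. -/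
def splitTime (σ : Equiv.Perm ℕ+) : ℕ → ℕ∞
  | 0 => 0
  | k + 1 => sInf {t : ℕ∞ | ∃ n : ℕ, t = n ∧ splitTime σ k < n ∧ SplitsAt σ n}

/-! ### Regenerative permutations -/

/-- The law of the delayed renewal process `T_n = T₀ + Y₁ + ⋯ + Y_n`, with `T₀` of law `δ`,
the `Y_i` of law `ν` on `{1, 2, …, ∞}`, all independent. -/
def renewalLaw (δ : PMF ℕ) (ν : PMF ℕ∞) : Measure (ℕ → ℕ∞) :=
  (δ.toMeasure.prod (Measure.infinitePi fun _ : ℕ => ν.toMeasure)).map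
    fun q n => (q.1 : ℕ∞) + ∑ i ∈ Finset.range n, q.2 i

/-- The renewal indicators of `t₀, t₁, …`: `R_n` holds iff some `t_k` equals `n`. -/
def renewals (t : ℕ → ℕ∞) (n : ℕ) : Prop := ∃ k, t k = n

/-- `Perm` is regenerative with respect to the delayed renewal process `T`. Here `κ` is the
joint law of `Π⁰` and `(R⁰₁, R⁰₂, …)`, a permutation with renewal indicators with
zero delay. -/
def IsRegenerativeWrt {Ω : Type*} [MeasurableSpace Ω] (P : Measure Ω)
    (Perm : Ω → Equiv.Perm ℕ+) (T : Ω → ℕ → ℕ∞) : Prop :=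
  ∃ (δ : PMF ℕ) (ν : PMF ℕ∞), ν 0 = 0 ∧
    P.map T = renewalLaw δ ν ∧
    (∀ᵐ ω ∂P, ∀ n : ℕ, renewals (T ω) n → SplitsAt (Perm ω) n) ∧
    ∃ κ : Measure (Equiv.Perm ℕ+ × (ℕ → Prop)),
      κ.map Prod.snd
        = (renewalLaw (PMF.pure 0) ν).map (fun t k => renewals t (k + 1)) ∧
      ∀ n : ℕ, 0 < n → P {ω | renewals (T ω) n} ≠ 0 →
        (cond P {ω | renewals (T ω) n}).map
            (fun ω => (residual n (Perm ω), fun k : ℕ => renewals (T ω) (n + (k + 1)))) = κ ∧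
        IndepFun (fun ω (k : Fin (n + 1)) => renewals (T ω) k)
          (fun ω => (residual n (Perm ω), fun k : ℕ => renewals (T ω) (n + (k + 1))))
          (cond P {ω | renewals (T ω) n})

/-- `Perm` is strictly regenerative: regenerative with respect to its own splitting times. -/
def IsStrictlyRegenerative {Ω : Type*} [MeasurableSpace Ω] (P : Measure Ω)
    (Perm : Ω → Equiv.Perm ℕ+) : Prop :=
  IsRegenerativeWrt P Perm fun ω => splitTime (Perm ω)

/-- The length `Y₁` of the first component of `σ`, i.e. the first positive splitting time. -/
def firstLength (σ : Equiv.Perm ℕ+) : ℕ∞ := splitTime σ 1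

section Law

variable {Ω : Type*} [MeasurableSpace Ω] (P : Measure Ω) (Perm : Ω → Equiv.Perm ℕ+)

/-- `u_n = ℙ([n] is a block of Π)`. -/
def splitProb (n : ℕ) : ℝ≥0∞ := P {ω | SplitsAt (Perm ω) n}

/-- `f_n = ℙ(Y₁ = n)`. -/
def firstLengthProb (n : ℕ) : ℝ≥0∞ := P {ω | firstLength (Perm ω) = n}

/-- `μ = 𝔼 Y₁`, possibly `∞`. -/
def meanLength : ℝ≥0∞ := ∫⁻ ω, (firstLength (Perm ω)).toENNReal ∂P

/-- `U(z) = 1 + ∑_{n ≥ 1} u_n zⁿ` for complex `z`. -/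
def genU (z : ℂ) : ℂ := 1 + ∑' n : ℕ, ((splitProb P Perm (n + 1)).toReal : ℂ) * z ^ (n + 1)

/-- `U(1) = 1 + ∑_{n ≥ 1} u_n`, possibly `∞`. -/
def genUOne : ℝ≥0∞ := 1 + ∑' n : ℕ, splitProb P Perm (n + 1)

/-- Positive recurrence: `𝔼 Y₁ < ∞`. -/
def IsPositiveRecurrent : Prop := meanLength P Perm < ∞

/-- Null recurrence: `Y₁ < ∞` almost surely and `𝔼 Y₁ = ∞`. -/
def IsNullRecurrent : Prop := (∀ᵐ ω ∂P, firstLength (Perm ω) < ⊤) ∧ meanLength P Perm = ∞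

/-- Transience: `ℙ(Y₁ < ∞) < 1`. -/
def IsTransient : Prop := P {ω | firstLength (Perm ω) < ⊤} < 1

end Law

/-- `z ^ n` for `n ∈ {0, 1, 2, …, ∞}`, with `z ^ ∞ = 0` (used for `|z| < 1`). -/
def powTop (z : ℂ) (n : ℕ∞) : ℂ := if n = ⊤ then 0 else z ^ n.toNat

/-! ### Cycle counts -/

/-- The set of cycles (orbits) of a permutation. -/
def cycles (σ : Equiv.Perm ℕ+) : Set (Set ℕ+) := Set.range fun i => {k | σ.SameCycle i k}

/-- The number of cycles of `σ` of length `j` wholly contained in `[n]`. -/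
def cycleCount (σ : Equiv.Perm ℕ+) (n j : ℕ) : ℕ :=
  {c : Set ℕ+ | c ∈ cycles σ ∧ c.encard = j ∧ ∀ i ∈ c, (i : ℕ) ≤ n}.ncard

/-- The number of cycles of `σ` of length `j` whose least element is in `[n]`. -/
def cycleCountLeast (σ : Equiv.Perm ℕ+) (n j : ℕ) : ℕ :=
  {c : Set ℕ+ | c ∈ cycles σ ∧ c.encard = j ∧ ∃ i, IsLeast c i ∧ (i : ℕ) ≤ n}.ncard

/-- `ν_j`, the expected number of cycles of length `j` in a generic block of the strictly
regenerative permutation; the first block `[Y₁]` is taken. -/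
def meanCycles {Ω : Type*} [MeasurableSpace Ω] (P : Measure Ω) (Perm : Ω → Equiv.Perm ℕ+)
    (j : ℕ) : ℝ≥0∞ :=
  ∫⁻ ω, (cycleCount (Perm ω) (firstLength (Perm ω)).toNat j : ℝ≥0∞) ∂P

/-! ### Stationary permutations of `ℤ` -/

/-- `σ` splits at `z`, that is `σ` maps `(-∞, z]` onto itself. -/
def SplitsAtInt (σ : Equiv.Perm ℤ) (z : ℤ) : Prop := σ '' Set.Iic z = Set.Iic z

/-- A law `ρ` of a random permutation of `ℤ` is stationary if its process of displacements
`D_z = σ z - z` is a stationary process. -/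
def IsStationaryLaw (ρ : Measure (Equiv.Perm ℤ)) : Prop :=
  ∀ a : ℤ, ρ.map (fun σ (z : ℤ) => σ (a + z) - (a + z)) = ρ.map (fun σ (z : ℤ) => σ z - z)

/-- `ρ` is the law of a stationary version `Π*` on `ℤ` of the random permutation `Perm` of
`ℕ+` (strictly regenerative with zero delay): `Π*` is stationary, it splits at `z` with
positive probability, and given that it splits at `z`, the sequence
`(Π*_{z+1} - z, Π*_{z+2} - z, …)` is distributed as `(Π₁, Π₂, …)`. -/
structure IsStationaryVersion {Ω : Type*} [MeasurableSpace Ω] (P : Measure Ω)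
    (Perm : Ω → Equiv.Perm ℕ+) (ρ : Measure (Equiv.Perm ℤ)) : Prop where
  isProbabilityMeasure : IsProbabilityMeasure ρ
  stationary : IsStationaryLaw ρ
  splits_ne_zero : ∀ z : ℤ, ρ {σ | SplitsAtInt σ z} ≠ 0
  palm : ∀ z : ℤ,
    (cond ρ {σ | SplitsAtInt σ z}).map (fun σ (i : ℕ+) => σ (z + ((i : ℕ) : ℤ)) - z)
      = P.map (fun ω (i : ℕ+) => ((Perm ω i : ℕ) : ℤ))

/-- `ρ` regenerates at its splitting times: given a split at `z`, the permutation after `z` is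
independent of the set of splitting times up to `z`. -/
def IsRegenerativeInt (ρ : Measure (Equiv.Perm ℤ)) : Prop :=
  ∀ z : ℤ, ρ {σ | SplitsAtInt σ z} ≠ 0 →
    IndepFun (fun (σ : Equiv.Perm ℤ) (k : ℕ) => SplitsAtInt σ (z - k))
      (fun (σ : Equiv.Perm ℤ) (i : ℕ+) => σ (z + ((i : ℕ) : ℤ)) - z)
      (cond ρ {σ | SplitsAtInt σ z})

end PShift

end

/-!
The value at step `i` of the construction is the free integer of rank `x i`, and everything rests
on a reading of the events of interest in terms of the i.i.d. ranks.

*Splitting and regeneration.* The set `[n]` is a block iff `x i ≤ n + 1 - i` for all `i ≤ n`, a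
condition (`Fits`) on the ranks one at a time (`forall_shiftMap_le_iff`). This gives the product
formula for `u_n`, and since the construction then restarts on `ℕ+ \ [n]` with the remaining ranks
(`shiftMap_addNat`), the residual permutation is a copy of the whole permutation, independent of
the first `n` values (`permLaw_inter_residual`). The rest of the one-sided theory only uses this
property of a law on permutations, isolated as `Regenerates`. The law of the splitting times and
the law of the partial sums of i.i.d. component lengths solve the same fixed point equation, which
has one solution (`eq_of_map_delay_eq`); hence the splitting times form a renewal process.

*Renewal theory.* Decomposing at the first splitting time gives the equation between the generating
functions, and decomposing at the last splitting time before `n` gives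
`∑ u_{n - l} ℙ(Y₁ > l) = 1`. Because `u_n` is a decreasing product, it converges, and passing to the
limit in the last identity shows that the limit is `1 / μ`, without appeal to a general renewal
theorem (`Regenerates.tendsto_eq_inv`). The limit is also `∏ (1 - ℙ(X > j))`, which is positive iff
`∑ ℙ(X > j)` is finite, that is, iff `p` has a finite mean.

*Cycles.* Each cycle lies in one component, and the components are i.i.d. The strong law of large
numbers gives the asymptotics of the cycle counts along the ends of the components, and
monotonicity extends them to all `n` (`Regenerates.ae_tendsto_cycleCount`).

*The stationary version.* When `μ` is finite, a two-sided i.i.d. sequence of ranks has, with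
positive probability, a split at a given time, namely when the steps of the past stay below it. By
a zero-one law there are almost surely such times arbitrarily far to the left
(`ae_exists_fitsInt`), and the one-sided constructions started at these times are consistent
(`star_add`). They define a permutation of `ℤ` which is an equivariant function of the sequence,
and regenerates at its splitting times (`starLaw_inter`).

*No stationary version for an infinite mean.* Then `u_n` tends to `0`. A stationary version would
split at every time with the same probability `q > 0`, and at two times at distance `n` with
probability `q u_n`. The splits at sufficiently distant times are then almost disjoint events of
probability `q`, which is impossible for more than `1 / q` of them (`not_isStationaryVersion`).
-/

noncomputable section

namespace PShift

/-! ### The construction on a fixed sequence -/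

theorem nthFree_notMem (F : Finset ℕ+) (k : ℕ+) : nthFree F k ∉ F := by
  have h : nthFree F k ∈ Set.range (nthFree F) := ⟨k, rfl⟩
  rw [range_nthFree] at h
  exact h

/-- A free integer exceeds its rank by the number of occupied integers below it. -/
theorem add_card_filter_lt_nthFree (F : Finset ℕ+) (k : ℕ+) :
    (k : ℕ) + (F.filter (· < nthFree F k)).card = nthFree F k := by
  classical
  set a := Nat.nth (fun m => m.succPNat ∉ F) k.natPred with ha
  have h1 : Nat.count (fun m => m.succPNat ∉ F) a = k.natPred :=
    Nat.count_nth_of_infinite (setOf_free_infinite F) _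
  rw [Nat.count_eq_card_filter_range] at h1
  have h2 := Finset.card_filter_add_card_filter_not (s := Finset.range a)
    (fun m => m.succPNat ∉ F)
  have h3 : ((Finset.range a).filter (fun m => ¬ (m.succPNat ∉ F))).card
      = (F.filter (· < nthFree F k)).card := by
    refine Finset.card_bij (fun m _ => m.succPNat) ?_ ?_ ?_
    · intro m hm
      simp only [Finset.mem_filter, Finset.mem_range, not_not] at hm ⊢
      exact ⟨hm.2, Nat.succPNat_strictMono hm.1⟩
    · intro m _ m' _ h
      exact Nat.succPNat_injective h
    · intro f hf
      simp only [Finset.mem_filter] at hf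
      refine ⟨f.natPred, ?_, PNat.succPNat_natPred f⟩
      simp only [Finset.mem_filter, Finset.mem_range, not_not, PNat.succPNat_natPred]
      refine ⟨?_, hf.1⟩
      have := PNat.natPred_strictMono hf.2
      simpa [nthFree] using this
  rw [Finset.card_range, h1, h3] at h2
  have h4 : (nthFree F k : ℕ) = a + 1 := rfl
  have h5 := PNat.natPred_add_one k
  omega

/-- `nthFree F k = m` says that `m` is free and has rank `k` among the free integers. -/
theorem nthFree_eq_iff (F : Finset ℕ+) (k m : ℕ+) :
    nthFree F k = m ↔ m ∉ F ∧ (k : ℕ) + (F.filter (· < m)).card = m := by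
  constructor
  · rintro rfl
    exact ⟨nthFree_notMem F k, add_card_filter_lt_nthFree F k⟩
  · rintro ⟨h1, h2⟩
    have h3 : m ∈ Set.range (nthFree F) := by
      rw [range_nthFree]
      exact h1
    obtain ⟨k', rfl⟩ := h3
    have h4 := add_card_filter_lt_nthFree F k'
    have : k = k' := PNat.eq (by omega)
    rw [this]

/-- When all occupied integers are in `[n]`, the free integer of rank `k` is in `[n]` iff `[n]` has
at least `k` free elements. -/
theorem nthFree_le_iff {F : Finset ℕ+} {n : ℕ} (hF : ∀ f ∈ F, (f : ℕ) ≤ n) (k : ℕ+) :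
    (nthFree F k : ℕ) ≤ n ↔ (k : ℕ) + F.card ≤ n := by
  have h1 := add_card_filter_lt_nthFree F k
  have h2 := nthFree_notMem F k
  set m := nthFree F k
  have h3 := Finset.card_filter_add_card_filter_not (s := F) (· < m)
  constructor
  · intro h
    have h4 : (F.filter (fun f => ¬ f < m)).card ≤ (Finset.Ioc (m : ℕ) n).card := by
      refine Finset.card_le_card_of_injOn (fun f => (f : ℕ)) ?_ ?_
      · intro f hf
        simp only [Finset.coe_filter, Set.mem_ofPred_eq, not_lt] at hf
        simp only [Finset.coe_Ioc, Set.mem_Ioc]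
        have h5 : f ≠ m := fun h => h2 (h ▸ hf.1)
        exact ⟨lt_of_le_of_ne hf.2 fun h => h5 (PNat.eq h.symm), hF f hf.1⟩
      · intro a _ b _ h
        exact PNat.eq h
    rw [Nat.card_Ioc] at h4
    omega
  · intro h
    have := Finset.card_filter_le F (· < m)
    omega

theorem shiftMap_injective (x : ℕ+ → ℕ+) : Function.Injective (shiftMap x) := by
  have key : ∀ i j : ℕ+, i < j → shiftMap x i ≠ shiftMap x j := by
    intro i j h e
    have h1 := nthFree_notMem ((Finset.Iio j).image (shiftMap x)) (x j)
    rw [← shiftMap_eq, ← e] at h1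
    exact h1 (Finset.mem_image_of_mem _ (Finset.mem_Iio.2 h))
  intro i j e
  by_contra h
  rcases lt_or_gt_of_ne h with h | h
  · exact key i j h e
  · exact key j i h e.symm

theorem shiftMap_congr {x y : ℕ+ → ℕ+} {n : ℕ} (h : ∀ i : ℕ+, (i : ℕ) ≤ n → x i = y i) (i : ℕ+)
    (hi : (i : ℕ) ≤ n) : shiftMap x i = shiftMap y i := by
  induction i using PNat.strongInductionOn with
  | _ i ih =>
    rw [shiftMap_eq, shiftMap_eq, h i hi]
    congr 1
    refine Finset.image_congr fun j hj => ?_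
    simp only [Finset.coe_Iio, Set.mem_Iio] at hj
    have : (j : ℕ) < i := hj
    exact ih j hj (by omega)

theorem card_image_shiftMap (x : ℕ+ → ℕ+) (i : ℕ+) :
    ((Finset.Iio i).image (shiftMap x)).card + 1 = i := by
  have h : Finset.Iio i = Finset.Ico 1 i := by
    ext j
    simp
  rw [Finset.card_image_of_injective _ (shiftMap_injective x), h, PNat.card_Ico]
  have := i.pos
  simp only [PNat.one_coe]
  omega

/-- The prefix of length `n` of `x` never leaves `[n]`: the rank `x i` is at most `n + 1 - i`, the
number of elements of `[n]` still free at step `i`. -/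
def Fits (x : ℕ+ → ℕ+) (n : ℕ) : Prop := ∀ i : ℕ+, (i : ℕ) ≤ n → (x i : ℕ) + i ≤ n + 1

/-- The event that `[n]` is a block is `Fits x n`, a condition on each of the ranks separately: by
induction, when the first `i - 1` values are in `[n]`, exactly `n + 1 - i` elements of `[n]` are
free at step `i`. -/
theorem forall_shiftMap_le_iff (x : ℕ+ → ℕ+) (n : ℕ) :
    (∀ i : ℕ+, (i : ℕ) ≤ n → (shiftMap x i : ℕ) ≤ n) ↔ Fits x n := by
  have step : ∀ i : ℕ+, (i : ℕ) ≤ n → (∀ j < i, (shiftMap x j : ℕ) ≤ n) →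
      ((shiftMap x i : ℕ) ≤ n ↔ (x i : ℕ) + i ≤ n + 1) := by
    intro i _ hj
    have hF : ∀ f ∈ (Finset.Iio i).image (shiftMap x), (f : ℕ) ≤ n := by
      intro f hf
      obtain ⟨j, h1, rfl⟩ := Finset.mem_image.1 hf
      exact hj j (Finset.mem_Iio.1 h1)
    rw [shiftMap_eq, nthFree_le_iff hF]
    have := card_image_shiftMap x i
    omega
  constructor
  · intro h i hi
    refine (step i hi fun j hj => h j ?_).1 (h i hi)
    have : (j : ℕ) < i := hj
    omega
  · intro h i
    induction i using PNat.strongInductionOn with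
    | _ i ih =>
      intro hi
      refine (step i hi fun j hj => ih j hj ?_).2 (h i hi)
      have : (j : ℕ) < i := hj
      omega

/-- The shift `i ↦ n + i` on the positive integers. -/
def addNat (n : ℕ) (i : ℕ+) : ℕ+ := ⟨n + i, Nat.add_pos_right n i.pos⟩

@[simp] theorem coe_addNat (n : ℕ) (i : ℕ+) : (addNat n i : ℕ) = n + i := rfl

theorem addNat_injective (n : ℕ) : Function.Injective (addNat n) := fun a b h => by
  have := congrArg PNat.val h
  simp only [addNat, PNat.mk_coe] at this
  exact PNat.eq (by omega)

theorem exists_addNat {n : ℕ} {i : ℕ+} (h : n < (i : ℕ)) : ∃ k, i = addNat n k :=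
  ⟨⟨(i : ℕ) - n, by omega⟩, PNat.eq (Nat.add_sub_cancel' h.le).symm⟩

/-- The sequence `x` without its first `n` terms. -/
def tail (n : ℕ) (x : ℕ+ → ℕ+) : ℕ+ → ℕ+ := fun i => x (addNat n i)

theorem finite_setOf_le (n : ℕ) : {i : ℕ+ | (i : ℕ) ≤ n}.Finite :=
  (Set.finite_Iic n).preimage (f := fun i : ℕ+ => (i : ℕ)) PNat.coe_injective.injOn

theorem image_shiftMap_of_fits {x : ℕ+ → ℕ+} {n : ℕ} (h : Fits x n) :
    shiftMap x '' {i : ℕ+ | (i : ℕ) ≤ n} = {i : ℕ+ | (i : ℕ) ≤ n} := by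
  refine Set.eq_of_subset_of_ncard_le ?_ ?_ (finite_setOf_le n)
  · rintro _ ⟨i, hi, rfl⟩
    exact (forall_shiftMap_le_iff x n).2 h i hi
  · rw [Set.ncard_image_of_injective _ (shiftMap_injective x)]

/-- After `[n]` has been filled, the construction starts afresh on `ℕ+ \ [n]` with the remaining
ranks. -/
theorem shiftMap_addNat {x : ℕ+ → ℕ+} {n : ℕ} (h : Fits x n) (i : ℕ+) :
    shiftMap x (addNat n i) = addNat n (shiftMap (tail n x) i) := by
  have himg := image_shiftMap_of_fits h
  -- at step `n + i` the occupied integers are those of `[n]` and the translates of the ones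
  -- occupied at step `i` of the construction driven by the tail
  induction i using PNat.strongInductionOn with
  | _ i ih =>
    rw [shiftMap_eq x, nthFree_eq_iff]
    have h1 : ∀ f, f ∈ (Finset.Iio (addNat n i)).image (shiftMap x) ↔
        (f : ℕ) ≤ n ∨ ∃ g ∈ (Finset.Iio i).image (shiftMap (tail n x)), f = addNat n g := by
      intro f
      simp only [Finset.mem_image, Finset.mem_Iio]
      constructor
      · rintro ⟨j, hj, rfl⟩
        rcases le_or_gt (j : ℕ) n with h2 | h2
        · exact Or.inl ((forall_shiftMap_le_iff x n).2 h j h2)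
        · obtain ⟨l, rfl⟩ := exists_addNat h2
          have hl : l < i := by
            have : (addNat n l : ℕ) < addNat n i := hj
            simp only [coe_addNat] at this
            exact PNat.coe_lt_coe _ _ |>.1 (by omega)
          exact Or.inr ⟨_, ⟨l, hl, rfl⟩, ih l hl⟩
      · rintro (h2 | ⟨_, ⟨l, hl, rfl⟩, rfl⟩)
        · have : f ∈ shiftMap x '' {i : ℕ+ | (i : ℕ) ≤ n} := by
            rw [himg]
            exact h2
          obtain ⟨j, hj, rfl⟩ := this
          refine ⟨j, ?_, rfl⟩
          refine (PNat.coe_lt_coe _ _).1 ?_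
          have : (j : ℕ) ≤ n := hj
          have := i.pos
          simp only [coe_addNat]
          omega
        · refine ⟨addNat n l, ?_, ih l hl⟩
          have : (l : ℕ) < i := hl
          refine (PNat.coe_lt_coe _ _).1 ?_
          simp only [coe_addNat]
          omega
    have h2 := shiftMap_eq (tail n x) i
    rw [eq_comm, nthFree_eq_iff] at h2
    set m := shiftMap (tail n x) i with hm
    set F := (Finset.Iio i).image (shiftMap (tail n x)) with hF
    constructor
    · rw [h1]
      rintro (h3 | ⟨g, hg, h3⟩)
      · have := m.pos
        simp only [coe_addNat] at h3
        omega
      · exact h2.1 (addNat_injective n h3 ▸ hg)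
    · have h3 : ((Finset.Iio (addNat n i)).image (shiftMap x)).filter (· < addNat n m)
          = (Finset.univ.image fun k : Fin n => (k : ℕ).succPNat) ∪
            (F.filter (· < m)).image (addNat n) := by
        ext f
        rw [Finset.mem_filter, h1]
        simp only [Finset.mem_union, Finset.mem_image, Finset.mem_univ, true_and,
          Finset.mem_filter]
        constructor
        · rintro ⟨h3 | ⟨g, hg, rfl⟩, h4⟩
          · refine Or.inl ⟨⟨f.natPred, ?_⟩, PNat.succPNat_natPred f⟩
            have := PNat.natPred_add_one f
            omega
          · refine Or.inr ⟨g, ⟨hg, ?_⟩, rfl⟩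
            have : (addNat n g : ℕ) < addNat n m := h4
            simp only [coe_addNat] at this
            exact (PNat.coe_lt_coe _ _).1 (by omega)
        · rintro (⟨k, rfl⟩ | ⟨g, ⟨hg, h4⟩, rfl⟩)
          · refine ⟨Or.inl ?_, (PNat.coe_lt_coe _ _).1 ?_⟩
            · simp only [Nat.succPNat_coe]
              exact k.2
            · have := m.pos
              have := k.2
              simp only [Nat.succPNat_coe, coe_addNat]
              omega
          · refine ⟨Or.inr ⟨g, hg, rfl⟩, (PNat.coe_lt_coe _ _).1 ?_⟩
            have : (g : ℕ) < m := h4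
            simp only [coe_addNat]
            omega
      rw [h3, Finset.card_union_of_disjoint, Finset.card_image_of_injective,
        Finset.card_image_of_injective _ (addNat_injective n), Finset.card_univ, Fintype.card_fin]
      · have := h2.2
        simp only [tail] at this
        simp only [coe_addNat]
        omega
      · intro a b hab
        exact Fin.ext (Nat.succPNat_injective hab)
      · rw [Finset.disjoint_left]
        rintro f hf hf'
        simp only [Finset.mem_image, Finset.mem_univ, true_and] at hf hf'
        obtain ⟨k, rfl⟩ := hf
        obtain ⟨g, _, h4⟩ := hf'
        have h5 := congrArg PNat.val h4
        have h6 : (addNat n g : ℕ) = n + g := rfl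
        have h7 : ((k : ℕ).succPNat : ℕ) = k + 1 := rfl
        have := g.pos
        have := k.2
        omega

/-! ### Product measures -/

section Product

variable {ι κ α β E : Type*} [MeasurableSpace E] (μ : Measure E) [IsProbabilityMeasure μ]

/-- Reading an i.i.d. family at distinct indices gives an i.i.d. family. -/
theorem infinitePi_map_comp_injective {c : ι → κ} (hc : Function.Injective c) :
    (Measure.infinitePi fun _ : κ => μ).map (fun x i => x (c i))
      = Measure.infinitePi fun _ : ι => μ := by
  classical
  refine Measure.eq_infinitePi _ fun s t ht => ?_
  have hm : Measurable fun (x : κ → E) (i : ι) => x (c i) := by fun_prop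
  rw [Measure.map_apply hm (MeasurableSet.pi s.countable_toSet fun i _ => ht i)]
  have h1 : (fun (x : κ → E) (i : ι) => x (c i)) ⁻¹' Set.pi s t
      = Set.pi (s.map ⟨c, hc⟩) (Function.extend c t fun _ => Set.univ) := by
    ext x
    simp [Set.mem_pi, hc.extend_apply]
  rw [h1, Measure.infinitePi_pi, Finset.prod_map]
  · exact Finset.prod_congr rfl fun i _ => by simp [hc.extend_apply]
  · simp only [Finset.mem_map, Function.Embedding.coeFn_mk, forall_exists_index, and_imp]
    rintro _ i hi rfl
    rw [hc.extend_apply]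
    exact ht i

theorem prod_infinitePi_map_sumElim :
    ((Measure.infinitePi fun _ : α => μ).prod (Measure.infinitePi fun _ : β => μ)).map
      (fun q (i : α ⊕ β) => Sum.elim q.1 q.2 i) = Measure.infinitePi fun _ : α ⊕ β => μ := by
  classical
  refine Measure.eq_infinitePi _ fun s t ht => ?_
  have hm : Measurable fun (q : (α → E) × (β → E)) (i : α ⊕ β) => Sum.elim q.1 q.2 i := by
    refine measurable_pi_lambda _ fun i => ?_
    cases i <;> simp only [Sum.elim_inl, Sum.elim_inr] <;> fun_prop
  rw [Measure.map_apply hm (MeasurableSet.pi s.countable_toSet fun i _ => ht i)]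
  have h1 : (fun (q : (α → E) × (β → E)) (i : α ⊕ β) => Sum.elim q.1 q.2 i) ⁻¹' Set.pi s t
      = (Set.pi s.toLeft fun a => t (Sum.inl a)) ×ˢ (Set.pi s.toRight fun b => t (Sum.inr b)) := by
    ext q
    simp [Set.mem_pi]
  rw [h1, Measure.prod_prod, Measure.infinitePi_pi, Measure.infinitePi_pi]
  · conv_rhs => rw [← Finset.toLeft_disjSum_toRight (u := s)]
    rw [Finset.prod_disjSum]
  · exact fun i _ => ht _
  · exact fun i _ => ht _

/-- Filling the places of a sequence, without repetition, from two independent i.i.d. families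
gives an i.i.d. sequence. -/
theorem prod_infinitePi_map_glue {c : ι → α ⊕ β} (hc : Function.Injective c) :
    ((Measure.infinitePi fun _ : α => μ).prod (Measure.infinitePi fun _ : β => μ)).map
      (fun q i => Sum.elim q.1 q.2 (c i)) = Measure.infinitePi fun _ : ι => μ := by
  rw [← infinitePi_map_comp_injective μ hc, ← prod_infinitePi_map_sumElim, Measure.map_map]
  · rfl
  · fun_prop
  · refine measurable_pi_lambda _ fun i => ?_
    cases i <;> simp only [Sum.elim_inl, Sum.elim_inr] <;> fun_prop

/-- For an i.i.d. sequence, an event which does not depend on the coordinates in the range of `d`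
is independent of the sequence of these coordinates. A null set of exceptional sequences is
disregarded in the dependence. -/
theorem infinitePi_inter_preimage {d : β → ι} (hd : Function.Injective d) {good : (ι → E) → Prop}
    (hg : ∀ᵐ x ∂(Measure.infinitePi fun _ : ι => μ), good x)
    {A : Set (ι → E)} {B : Set (β → E)} (hA : MeasurableSet A) (hB : MeasurableSet B)
    (hdet : ∀ x y, good x → good y → (∀ i ∉ Set.range d, x i = y i) → (x ∈ A ↔ y ∈ A)) :
    (Measure.infinitePi fun _ : ι => μ) (A ∩ {x | (fun j => x (d j)) ∈ B})
      = (Measure.infinitePi fun _ : ι => μ) A * (Measure.infinitePi fun _ : β => μ) B := by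
  classical
  -- resample the coordinates in the range of `d` from an independent family: this changes neither
  -- the law nor the event `A`
  set c : ι → ι ⊕ β := fun i => if h : i ∈ Set.range d then Sum.inr h.choose else Sum.inl i with hc
  have c1 : ∀ j, c (d j) = Sum.inr j := by
    intro j
    have h : d j ∈ Set.range d := ⟨j, rfl⟩
    simp only [hc, dif_pos h]
    exact congrArg _ (hd h.choose_spec)
  have c2 : ∀ i ∉ Set.range d, c i = Sum.inl i := fun i h => by simp only [hc, dif_neg h]
  have hci : Function.Injective c := by
    intro i i' h
    by_cases h1 : i ∈ Set.range d <;> by_cases h2 : i' ∈ Set.range d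
    · obtain ⟨j, rfl⟩ := h1
      obtain ⟨j', rfl⟩ := h2
      rw [c1, c1] at h
      rw [Sum.inr_injective h]
    · obtain ⟨j, rfl⟩ := h1
      rw [c1, c2 _ h2] at h
      cases h
    · obtain ⟨j, rfl⟩ := h2
      rw [c1, c2 _ h1] at h
      cases h
    · rw [c2 _ h1, c2 _ h2] at h
      exact Sum.inl_injective h
  have hglue := prod_infinitePi_map_glue (α := ι) (β := β) μ hci
  set glue : (ι → E) × (β → E) → ι → E := fun q i => Sum.elim q.1 q.2 (c i) with hgl
  have hgm : Measurable glue := by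
    refine measurable_pi_lambda _ fun i => ?_
    simp only [hgl]
    cases c i <;> simp only [Sum.elim_inl, Sum.elim_inr] <;> fun_prop
  have hm : MeasurableSet (A ∩ {x : ι → E | (fun j => x (d j)) ∈ B}) :=
    hA.inter ((by fun_prop : Measurable fun (x : ι → E) j => x (d j)) hB)
  have hg1 : ∀ᵐ q ∂((Measure.infinitePi fun _ : ι => μ).prod (Measure.infinitePi fun _ : β => μ)),
      good (glue q) := by
    rw [← hglue] at hg
    exact ae_of_ae_map hgm.aemeasurable hg
  have hg2 : ∀ᵐ q ∂((Measure.infinitePi fun _ : ι => μ).prod (Measure.infinitePi fun _ : β => μ)),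
      good q.1 := Measure.quasiMeasurePreserving_fst.ae hg
  conv_lhs => rw [← hglue]
  rw [Measure.map_apply hgm hm, ← Measure.prod_prod]
  refine measure_congr ?_
  filter_upwards [hg1, hg2] with q h1 h2
  refine propext ?_
  change (glue q ∈ A ∧ (fun j => glue q (d j)) ∈ B) ↔ (q.1 ∈ A ∧ q.2 ∈ B)
  have e1 : (fun j => glue q (d j)) = q.2 := by
    funext j
    simp [hgl, c1]
  rw [e1, hdet (glue q) q.1 h1 h2]
  intro i hi
  simp [hgl, c2 i hi]

end Product

/-! ### Measurability for random permutations -/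

open Classical in
/-- The permutation with underlying map `f`, the identity if `f` is not bijective. -/
def permOf {α : Type*} (f : α → α) : Equiv.Perm α :=
  if h : Function.Bijective f then Equiv.ofBijective f h else 1

theorem permOf_apply {α : Type*} {f : α → α} (h : Function.Bijective f) (i : α) : permOf f i = f i := by
  rw [permOf, dif_pos h, Equiv.ofBijective_apply]

section Measurability

variable {X ι E F : Type*} [MeasurableSpace X] [MeasurableSpace E] [MeasurableSpace F]

/-- A map determined by finitely many coordinates, each with countably many values, is measurable
for any σ-algebra on its codomain. -/
theorem measurable_of_determined [Countable E] [MeasurableSingletonClass E] {e : X → ι → E}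
    (he : Measurable e) (s : Finset ι) {f : X → F}
    (h : ∀ x y, (∀ i ∈ s, e x i = e y i) → f x = f y) : Measurable f := by
  intro B _
  have h1 : f ⁻¹' B = (fun x (i : s) => e x i) ⁻¹' ((fun x (i : s) => e x i) '' (f ⁻¹' B)) := by
    ext x
    constructor
    · exact fun hx => ⟨x, hx, rfl⟩
    · rintro ⟨y, hy, hxy⟩
      have : f y = f x := h y x fun i hi => congrFun hxy ⟨i, hi⟩
      change f x ∈ B
      rw [← this]
      exact hy
  rw [h1]
  have h2 : Measurable fun x (i : s) => e x i := by fun_prop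
  exact h2 (Set.to_countable _).measurableSet

variable {α : Type*} [MeasurableSpace α]

theorem measurable_perm_iff {f : X → Equiv.Perm α} :
    Measurable f ↔ ∀ i, Measurable fun x => f x i := by
  rw [permMeasurableSpace, measurable_comap_iff, measurable_pi_iff]
  rfl

theorem measurable_perm_apply (i : α) : Measurable fun σ : Equiv.Perm α => σ i :=
  measurable_perm_iff.1 measurable_id i

theorem measurable_perm_coe : Measurable fun (σ : Equiv.Perm α) (i : α) => σ i :=
  measurable_pi_lambda _ measurable_perm_apply

variable [Countable α] [MeasurableSingletonClass α]

theorem measurableSet_bijective : MeasurableSet {f : α → α | Function.Bijective f} := by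
  have h : {f : α → α | Function.Bijective f}
      = {f | ∀ i j, f i = f j → i = j} ∩ {f | ∀ m, ∃ i, f i = m} := rfl
  rw [h]
  refine MeasurableSet.inter ?_ ?_
  · simp only [Set.ofPred_forall]
    refine MeasurableSet.iInter fun i => MeasurableSet.iInter fun j => ?_
    by_cases hij : i = j
    · simp [hij]
    · have : {f : α → α | f i = f j → i = j} = {f : α → α | f i = f j}ᶜ := by
        ext f
        simp [hij]
      rw [this]
      exact (measurableSet_eq_fun (measurable_pi_apply i) (measurable_pi_apply j)).compl
  · simp only [Set.ofPred_forall, Set.ofPred_exists]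
    exact MeasurableSet.iInter fun m => MeasurableSet.iUnion fun i =>
      (measurable_pi_apply (X := fun _ : α => α) i) (measurableSet_singleton m)

theorem measurable_permOf : Measurable (permOf : (α → α) → Equiv.Perm α) := by
  classical
  rw [measurable_perm_iff]
  intro i
  have h : (fun f : α → α => permOf f i)
      = {f : α → α | Function.Bijective f}.piecewise (fun f => f i) fun _ => i := by
    funext f
    by_cases hf : Function.Bijective f
    · rw [permOf_apply hf, Set.piecewise_eq_of_mem]
      exact hf
    · rw [Set.piecewise_eq_of_notMem _ _ _ (by exact hf), permOf, dif_neg hf, Equiv.Perm.one_apply]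
  rw [h]
  exact (measurable_pi_apply i).piecewise measurableSet_bijective measurable_const

end Measurability

/-- The finite set `[n]`. -/
def box (n : ℕ) : Finset ℕ+ := (finite_setOf_le n).toFinset

@[simp] theorem mem_box {n : ℕ} {i : ℕ+} : i ∈ box n ↔ (i : ℕ) ≤ n := by simp [box]

theorem prod_box {M : Type*} [CommMonoid M] (n : ℕ) (f : ℕ+ → M) :
    ∏ i ∈ box n, f i = ∏ j ∈ Finset.range n, f j.succPNat := by
  refine (Finset.prod_bij (fun j _ => j.succPNat) ?_ ?_ ?_ fun _ _ => rfl).symm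
  · intro j hj
    simp only [mem_box, Nat.succPNat_coe]
    exact Finset.mem_range.1 hj
  · exact fun _ _ _ _ h => Nat.succPNat_injective h
  · intro i hi
    refine ⟨i.natPred, ?_, PNat.succPNat_natPred i⟩
    have := PNat.natPred_add_one i
    simp only [mem_box] at hi
    simp only [Finset.mem_range]
    omega

theorem splitsAt_iff_forall_le {σ : Equiv.Perm ℕ+} {n : ℕ} :
    SplitsAt σ n ↔ ∀ i : ℕ+, (i : ℕ) ≤ n → (σ i : ℕ) ≤ n := by
  constructor
  · intro h i hi
    have := h.lt_iff i
    omega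
  · intro h
    refine Set.eq_of_subset_of_ncard_le ?_ ?_ (finite_setOf_le n)
    · rintro _ ⟨i, hi, rfl⟩
      exact h i hi
    · rw [Set.ncard_image_of_injective _ σ.injective]

theorem splitsAt_congr {σ τ : Equiv.Perm ℕ+} {n : ℕ} (h : ∀ i : ℕ+, (i : ℕ) ≤ n → σ i = τ i) :
    SplitsAt σ n ↔ SplitsAt τ n := by
  rw [splitsAt_iff_forall_le, splitsAt_iff_forall_le]
  exact forall_congr' fun i => forall_congr' fun hi => by rw [h i hi]

theorem splitsAt_zero (σ : Equiv.Perm ℕ+) : SplitsAt σ 0 :=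
  splitsAt_iff_forall_le.2 fun i hi => absurd i.pos (by omega)

/-- A functional of a permutation which only depends on the first `n` values is measurable. -/
theorem measurable_of_determined_perm {F : Type*} [MeasurableSpace F] (n : ℕ)
    {f : Equiv.Perm ℕ+ → F} (h : ∀ σ τ, (∀ i : ℕ+, (i : ℕ) ≤ n → σ i = τ i) → f σ = f τ) :
    Measurable f :=
  measurable_of_determined measurable_perm_coe (box n) fun σ τ hst =>
    h σ τ fun i hi => hst i (mem_box.2 hi)

theorem measurableSet_of_determined_perm (n : ℕ)
    {D : Set (Equiv.Perm ℕ+)} (h : ∀ σ τ : Equiv.Perm ℕ+,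
      (∀ i : ℕ+, (i : ℕ) ≤ n → σ i = τ i) → (σ ∈ D ↔ τ ∈ D)) : MeasurableSet D :=
  measurableSet_setOfPred.2 <| measurable_of_determined_perm n (f := fun σ => σ ∈ D) fun σ τ hst =>
    propext (h σ τ hst)

theorem measurableSet_splitsAt (n : ℕ) : MeasurableSet {σ : Equiv.Perm ℕ+ | SplitsAt σ n} :=
  measurableSet_of_determined_perm n fun _ _ h => splitsAt_congr h

theorem residual_addNat {σ : Equiv.Perm ℕ+} {n : ℕ} (h : SplitsAt σ n) (i : ℕ+) :
    addNat n (residual n σ i) = σ (addNat n i) := by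
  refine PNat.eq ?_
  have h1 := residual_apply h i
  have h2 := (h.lt_iff (addNat n i)).2 (by simp)
  rw [coe_addNat, h1]
  change n + ((σ (addNat n i) : ℕ) - n) = _
  omega

theorem measurable_residual (n : ℕ) : Measurable (residual n) := by
  rw [measurable_perm_iff]
  intro i
  refine measurable_of_determined_perm (n + i) fun σ τ h => ?_
  have h1 : SplitsAt σ n ↔ SplitsAt τ n := splitsAt_congr fun j hj => h j (by omega)
  by_cases hs : SplitsAt σ n
  · refine addNat_injective n ?_
    rw [residual_addNat hs, residual_addNat (h1.1 hs)]
    exact h _ (by simp)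
  · rw [residual, residual, dif_neg hs, dif_neg (fun h => hs (h1.2 h))]

theorem measurable_shiftMap : Measurable shiftMap := by
  refine measurable_pi_lambda _ fun i => ?_
  exact measurable_of_determined (e := fun x : ℕ+ → ℕ+ => x) measurable_id (box i) fun x y h =>
    shiftMap_congr (n := i) (fun j hj => h j (mem_box.2 hj)) i le_rfl

theorem measurable_tail (n : ℕ) : Measurable (tail n) := by
  unfold tail
  fun_prop

/-! ### The law of a `p`-shifted permutation -/

instance (p : PMF ℕ+) : IsProbabilityMeasure (sampleLaw p) := by
  unfold sampleLaw
  infer_instance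

theorem sampleLaw_box (p : PMF ℕ+) (n : ℕ) (t : ℕ+ → Set ℕ+) :
    sampleLaw p {x | ∀ i : ℕ+, (i : ℕ) ≤ n → x i ∈ t i} = ∏ i ∈ box n, p.toMeasure (t i) := by
  rw [sampleLaw, ← Measure.infinitePi_pi (fun _ : ℕ+ => p.toMeasure) (s := box n) (t := t)
    fun i _ => MeasurableSet.of_discrete]
  congr 1
  ext x
  simp [Set.mem_pi]

theorem sampleLaw_map_tail (p : PMF ℕ+) (n : ℕ) : (sampleLaw p).map (tail n) = sampleLaw p :=
  infinitePi_map_comp_injective p.toMeasure (addNat_injective n)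

theorem toMeasure_setOf_le (p : PMF ℕ+) (j : ℕ) :
    p.toMeasure {k : ℕ+ | (k : ℕ) ≤ j} = ∑ i ∈ Finset.Icc 1 j, weight p i := by
  have h : {k : ℕ+ | (k : ℕ) ≤ j} = (box j : Set ℕ+) := by
    ext k
    simp
  rw [h, PMF.toMeasure_apply_finset]
  refine Finset.sum_bij (fun i _ => (i : ℕ)) ?_ ?_ ?_ ?_
  · intro i hi
    exact Finset.mem_Icc.2 ⟨i.pos, mem_box.1 hi⟩
  · exact fun a _ b _ h => PNat.eq h
  · intro i hi
    rw [Finset.mem_Icc] at hi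
    exact ⟨⟨i, hi.1⟩, mem_box.2 hi.2, rfl⟩
  · intro i _
    rw [weight, dif_pos i.pos]
    rfl

theorem weight_coe (p : PMF ℕ+) (k : ℕ+) : weight p k = p k := by
  rw [weight, dif_pos k.pos]
  rfl

theorem toMeasure_setOf_add_eq (p : PMF ℕ+) (c m : ℕ) :
    p.toMeasure {k : ℕ+ | (k : ℕ) + c = m} = weight p (m - c) := by
  by_cases h : 0 < m - c
  · obtain ⟨l, hl⟩ : ∃ l : ℕ+, (l : ℕ) = m - c := ⟨⟨m - c, h⟩, rfl⟩
    rw [← hl, weight_coe]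
    have : {k : ℕ+ | (k : ℕ) + c = m} = {l} := by
      ext k
      simp only [Set.mem_ofPred_eq, Set.mem_singleton_iff]
      rw [← PNat.coe_inj]
      omega
    rw [this, PMF.toMeasure_apply_singleton _ _ (measurableSet_singleton _)]
  · rw [weight, dif_neg h]
    have : {k : ℕ+ | (k : ℕ) + c = m} = ∅ := by
      ext k
      have := k.pos
      simp only [Set.mem_ofPred_eq, Set.mem_empty_iff_false, iff_false]
      omega
    rw [this, measure_empty]

theorem prod_Icc_one {M : Type*} [CommMonoid M] (f : ℕ → M) (n : ℕ) :
    ∏ j ∈ Finset.Icc 1 n, f j = ∏ j ∈ Finset.range n, f (j + 1) := by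
  induction n with
  | zero => simp
  | succ n ih => rw [Finset.prod_Icc_succ_top (by omega), Finset.prod_range_succ, ih]

/-- The factor for `j` comes from the step at which `[n]` has `j` free elements. -/
theorem sampleLaw_setOf_fits (p : PMF ℕ+) (n : ℕ) :
    sampleLaw p {x | Fits x n} = ∏ j ∈ Finset.Icc 1 n, ∑ i ∈ Finset.Icc 1 j, weight p i := by
  have h := sampleLaw_box p n fun i => {k | (k : ℕ) + i ≤ n + 1}
  rw [prod_box] at h
  change sampleLaw p {x | Fits x n} = _ at h
  rw [h, ← Finset.prod_range_reflect, prod_Icc_one]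
  refine Finset.prod_congr rfl fun j hj => ?_
  rw [Finset.mem_range] at hj
  rw [← toMeasure_setOf_le]
  congr 1
  ext k
  simp only [Nat.succPNat_coe, Set.mem_ofPred_eq]
  omega

/-- Each time the rank is `1` the least free integer is taken, so that every integer is taken
if this happens infinitely often. -/
theorem shiftMap_bijective {x : ℕ+ → ℕ+} (h : {i | x i = 1}.Infinite) :
    Function.Bijective (shiftMap x) := by
  refine ⟨shiftMap_injective x, fun m => ?_⟩
  by_contra hm
  push Not at hm
  have h1 : Set.MapsTo (shiftMap x) {i | x i = 1} {i : ℕ+ | (i : ℕ) ≤ m} := by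
    intro i hi
    have h2 : m ∈ Set.range (nthFree ((Finset.Iio i).image (shiftMap x))) := by
      rw [range_nthFree]
      intro h3
      obtain ⟨j, _, h4⟩ := Finset.mem_image.1 h3
      exact hm j h4
    obtain ⟨k, hk⟩ := h2
    have h3 : shiftMap x i ≤ m := by
      rw [shiftMap_eq, show x i = 1 from hi, ← hk]
      exact (nthFree_strictMono _).monotone one_le
    exact h3
  exact Set.infinite_of_injOn_mapsTo (shiftMap_injective x).injOn h1 h (finite_setOf_le m)

/-- As `p 1 > 0`, almost surely the rank `1` occurs infinitely often. -/
theorem ae_shiftMap_bijective (p : PMF ℕ+) (hp : 0 < p 1) :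
    ∀ᵐ x ∂(sampleLaw p), Function.Bijective (shiftMap x) := by
  have hq : p.toMeasure {1}ᶜ < 1 := by
    rw [prob_compl_eq_one_sub (measurableSet_singleton _),
      PMF.toMeasure_apply_singleton _ _ (measurableSet_singleton _)]
    exact ENNReal.sub_lt_self ENNReal.one_ne_top one_ne_zero hp.ne'
  have h0 : ∀ n : ℕ, ∀ᵐ x ∂(sampleLaw p), ∃ i : ℕ+, n < (i : ℕ) ∧ x i = 1 := by
    intro n
    rw [ae_iff]
    refine le_antisymm ?_ zero_le
    refine ge_of_tendsto' (ENNReal.tendsto_pow_atTop_nhds_zero_of_lt_one hq) fun k => ?_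
    have h1 : {x : ℕ+ → ℕ+ | ¬ ∃ i : ℕ+, n < (i : ℕ) ∧ x i = 1}
        ⊆ tail n ⁻¹' {x | ∀ i : ℕ+, (i : ℕ) ≤ k → x i ∈ ({1}ᶜ : Set ℕ+)} := by
      intro x hx i _ hi
      refine hx ⟨addNat n i, ?_, hi⟩
      simp
    refine (measure_mono h1).trans ?_
    refine (le_of_eq ?_).trans (le_of_eq (?_ : ∏ i ∈ box k, p.toMeasure {1}ᶜ = _))
    · rw [← sampleLaw_box, ← Measure.map_apply (measurable_tail n), sampleLaw_map_tail]
      have : {x : ℕ+ → ℕ+ | ∀ i : ℕ+, (i : ℕ) ≤ k → x i ∈ ({1}ᶜ : Set ℕ+)}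
          = ⋂ i ∈ box k, (fun x : ℕ+ → ℕ+ => x i) ⁻¹' {1}ᶜ := by
        ext x
        simp
      rw [this]
      exact Finset.measurableSet_biInter _ fun i _ => measurable_pi_apply i MeasurableSet.of_discrete
    · rw [prod_box, Finset.prod_const, Finset.card_range]
  filter_upwards [ae_all_iff.2 h0] with x hx
  refine shiftMap_bijective (Set.infinite_of_forall_exists_gt fun i => ?_)
  obtain ⟨j, h1, h2⟩ := hx i
  exact ⟨j, h2, h1⟩

/-- The law of the `p`-shifted permutation, as a measure on permutations. -/
def permLaw (p : PMF ℕ+) : Measure (Equiv.Perm ℕ+) :=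
  (sampleLaw p).map fun x => permOf (shiftMap x)

theorem measurable_permOf_shiftMap :
    Measurable fun x : ℕ+ → ℕ+ => permOf (shiftMap x) :=
  measurable_permOf.comp measurable_shiftMap

instance (p : PMF ℕ+) : IsProbabilityMeasure (permLaw p) :=
  Measure.isProbabilityMeasure_map measurable_permOf_shiftMap.aemeasurable

theorem permLaw_apply (p : PMF ℕ+) {S : Set (Equiv.Perm ℕ+)} (hS : MeasurableSet S) :
    permLaw p S = sampleLaw p {x | permOf (shiftMap x) ∈ S} :=
  Measure.map_apply measurable_permOf_shiftMap hS

/-- The distribution of a `p`-shifted permutation, prescribed on sequences by `IsPShifted`, determines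
its law on permutations, because the σ-algebra on permutations is generated by the coordinates. -/
theorem IsPShifted.map_eq {p : PMF ℕ+} (hp : 0 < p 1) {Ω : Type*} [MeasurableSpace Ω]
    {P : Measure Ω} {Perm : Ω → Equiv.Perm ℕ+} (h : IsPShifted P Perm p) :
    P.map Perm = permLaw p := by
  ext S hS
  have hS' := hS
  obtain ⟨B, hB, rfl⟩ := hS
  rw [Measure.map_apply h.1 hS', permLaw_apply p hS']
  have h1 : P.map (fun ω (i : ℕ+) => Perm ω i) B = (sampleLaw p).map shiftMap B := by rw [h.2]
  rw [Measure.map_apply (f := fun ω (i : ℕ+) => Perm ω i) (measurable_perm_coe.comp h.1) hB,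
    Measure.map_apply measurable_shiftMap hB] at h1
  refine h1.trans (measure_congr ?_)
  filter_upwards [ae_shiftMap_bijective p hp] with x hx
  refine propext ?_
  change shiftMap x ∈ B ↔ (fun i => permOf (shiftMap x) i) ∈ B
  rw [funext (permOf_apply hx)]

theorem splitsAt_permOf_iff {x : ℕ+ → ℕ+} (hx : Function.Bijective (shiftMap x)) (n : ℕ) :
    SplitsAt (permOf (shiftMap x)) n ↔ Fits x n := by
  rw [splitsAt_iff_forall_le, ← forall_shiftMap_le_iff]
  simp only [permOf_apply hx]

theorem bijective_shiftMap_tail {x : ℕ+ → ℕ+} (hx : Function.Bijective (shiftMap x)) {n : ℕ}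
    (h : Fits x n) : Function.Bijective (shiftMap (tail n x)) := by
  refine ⟨shiftMap_injective _, fun m => ?_⟩
  obtain ⟨i, hi⟩ := hx.2 (addNat n m)
  rcases le_or_gt (i : ℕ) n with h1 | h1
  · have h2 := (forall_shiftMap_le_iff x n).2 h i h1
    rw [hi, coe_addNat] at h2
    have := m.pos
    omega
  · obtain ⟨k, rfl⟩ := exists_addNat h1
    rw [shiftMap_addNat h] at hi
    exact ⟨k, addNat_injective n hi⟩

theorem residual_permOf {x : ℕ+ → ℕ+} (hx : Function.Bijective (shiftMap x)) {n : ℕ}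
    (h : Fits x n) : residual n (permOf (shiftMap x)) = permOf (shiftMap (tail n x)) := by
  refine Equiv.ext fun i => ?_
  refine addNat_injective n ?_
  rw [residual_addNat ((splitsAt_permOf_iff hx n).2 h), permOf_apply hx,
    permOf_apply (bijective_shiftMap_tail hx h), shiftMap_addNat h]

theorem permLaw_splitsAt (p : PMF ℕ+) (hp : 0 < p 1) (n : ℕ) :
    permLaw p {σ | SplitsAt σ n} = ∏ j ∈ Finset.Icc 1 n, ∑ i ∈ Finset.Icc 1 j, weight p i := by
  rw [permLaw_apply p (measurableSet_splitsAt n), ← sampleLaw_setOf_fits]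
  refine measure_congr ?_
  filter_upwards [ae_shiftMap_bijective p hp] with x hx
  exact propext (splitsAt_permOf_iff hx n)

/-- A prescribed injective beginning `π` amounts to prescribed ranks. -/
theorem shiftMap_eq_on_iff (x π : ℕ+ → ℕ+) (n : ℕ) (hπ : Set.InjOn π {i | (i : ℕ) ≤ n}) :
    (∀ i : ℕ+, (i : ℕ) ≤ n → shiftMap x i = π i) ↔
      ∀ i : ℕ+, (i : ℕ) ≤ n →
        (x i : ℕ) + ((Finset.Iio i).filter fun j => π j < π i).card = π i := by
  have step : ∀ i : ℕ+, (i : ℕ) ≤ n → (∀ j < i, shiftMap x j = π j) →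
      (shiftMap x i = π i ↔
        (x i : ℕ) + ((Finset.Iio i).filter fun j => π j < π i).card = π i) := by
    intro i hi h
    have hlt : ∀ j : ℕ+, j < i → (j : ℕ) ≤ n := fun j hj => by
      have : (j : ℕ) < i := hj
      omega
    have h1 : (Finset.Iio i).image (shiftMap x) = (Finset.Iio i).image π :=
      Finset.image_congr fun j hj => h j (by simpa using hj)
    have h2 : ((Finset.Iio i).image π).filter (· < π i)
        = ((Finset.Iio i).filter fun j => π j < π i).image π := by
      rw [Finset.filter_image]
    have h3 : π i ∉ (Finset.Iio i).image π := by
      intro h3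
      obtain ⟨j, hj, h4⟩ := Finset.mem_image.1 h3
      rw [Finset.mem_Iio] at hj
      exact hj.ne (hπ (hlt j hj) hi h4)
    rw [shiftMap_eq, nthFree_eq_iff, h1, h2, Finset.card_image_of_injOn]
    · exact and_iff_right h3
    · intro a ha b hb
      simp only [Finset.coe_filter, Finset.mem_Iio, Set.mem_ofPred_eq] at ha hb
      exact hπ (hlt a ha.1) (hlt b hb.1)
  constructor
  · intro h i hi
    refine (step i hi fun j hj => h j ?_).1 (h i hi)
    have : (j : ℕ) < i := hj
    omega
  · intro h i
    induction i using PNat.strongInductionOn with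
    | _ i ih =>
      intro hi
      refine (step i hi fun j hj => ih j hj ?_).2 (h i hi)
      have : (j : ℕ) < i := hj
      omega

theorem permLaw_eq_on (p : PMF ℕ+) (hp : 0 < p 1) (n : ℕ) (π : ℕ+ → ℕ+)
    (hπ : Set.InjOn π {i | (i : ℕ) ≤ n}) :
    permLaw p {σ | ∀ i : ℕ+, (i : ℕ) ≤ n → σ i = π i} =
      ∏ j : Fin n, weight p
        ((π (j : ℕ).succPNat : ℕ) -
          ((Finset.Iio (j : ℕ).succPNat).filter fun i => π i < π (j : ℕ).succPNat).card) := by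
  have hm : MeasurableSet {σ : Equiv.Perm ℕ+ | ∀ i : ℕ+, (i : ℕ) ≤ n → σ i = π i} :=
    measurableSet_of_determined_perm n fun σ τ h =>
      forall_congr' fun i => forall_congr' fun hi => by rw [h i hi]
  rw [permLaw_apply p hm]
  have h := sampleLaw_box p n fun i =>
    {k | (k : ℕ) + ((Finset.Iio i).filter fun j => π j < π i).card = π i}
  simp only [toMeasure_setOf_add_eq] at h
  rw [prod_box, ← Fin.prod_univ_eq_prod_range (fun j : ℕ => weight p ((π j.succPNat : ℕ) -
    ((Finset.Iio j.succPNat).filter fun i => π i < π j.succPNat).card)) n] at h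
  rw [← h]
  refine measure_congr ?_
  filter_upwards [ae_shiftMap_bijective p hp] with x hx
  refine propext ?_
  change (∀ i : ℕ+, (i : ℕ) ≤ n → permOf (shiftMap x) i = π i) ↔ _
  simp only [permOf_apply hx]
  exact shiftMap_eq_on_iff x π n hπ

/-- The regeneration property: given a split at `n`, the residual permutation is a copy
of the whole permutation, independent of the first `n` values. -/
theorem permLaw_inter_residual (p : PMF ℕ+) (hp : 0 < p 1) (n : ℕ) {D B : Set (Equiv.Perm ℕ+)}
    (hD : ∀ σ τ : Equiv.Perm ℕ+, (∀ i : ℕ+, (i : ℕ) ≤ n → σ i = τ i) → (σ ∈ D ↔ τ ∈ D))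
    (hB : MeasurableSet B) :
    permLaw p ({σ | SplitsAt σ n} ∩ D ∩ residual n ⁻¹' B)
      = permLaw p ({σ | SplitsAt σ n} ∩ D) * permLaw p B := by
  have hD' := measurableSet_of_determined_perm n hD
  have hSD := (measurableSet_splitsAt n).inter hD'
  rw [permLaw_apply p (hSD.inter (measurable_residual n hB)), permLaw_apply p hSD,
    permLaw_apply p hB]
  have h := infinitePi_inter_preimage p.toMeasure (addNat_injective n)
    (ae_shiftMap_bijective p hp)
    (A := {x | permOf (shiftMap x) ∈ {σ | SplitsAt σ n} ∩ D})
    (B := {x | permOf (shiftMap x) ∈ B})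
    (measurable_permOf_shiftMap hSD) (measurable_permOf_shiftMap hB) ?_
  · rw [sampleLaw, ← h]
    refine measure_congr ?_
    filter_upwards [ae_shiftMap_bijective p hp] with x hx
    refine propext (and_congr_right fun h1 => ?_)
    have h2 : Fits x n := (splitsAt_permOf_iff hx n).1 h1.1
    change residual n (permOf (shiftMap x)) ∈ B ↔ permOf (shiftMap (tail n x)) ∈ B
    rw [residual_permOf hx h2]
  · intro x y hx hy hxy
    have h1 : ∀ i : ℕ+, (i : ℕ) ≤ n → permOf (shiftMap x) i = permOf (shiftMap y) i := by
      intro i hi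
      rw [permOf_apply hx, permOf_apply hy]
      refine shiftMap_congr (fun j hj => hxy j ?_) i hi
      rintro ⟨k, rfl⟩
      have := k.pos
      simp only [coe_addNat] at hj
      omega
    exact and_congr (splitsAt_congr h1) (hD _ _ h1)

/-! ### Splitting times -/

theorem splitsAt_add_iff {σ : Equiv.Perm ℕ+} {n : ℕ} (h : SplitsAt σ n) (k : ℕ) :
    SplitsAt σ (n + k) ↔ SplitsAt (residual n σ) k := by
  rw [splitsAt_iff_forall_le, splitsAt_iff_forall_le]
  constructor
  · intro h1 i hi
    have h2 := h1 (addNat n i) (by simp only [coe_addNat]; omega)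
    rw [← residual_addNat h, coe_addNat] at h2
    omega
  · intro h1 i hi
    rcases le_or_gt (i : ℕ) n with h2 | h2
    · have := splitsAt_iff_forall_le.1 h i h2
      omega
    · obtain ⟨l, rfl⟩ := exists_addNat h2
      rw [coe_addNat] at hi
      have := h1 l (by omega)
      rw [← residual_addNat h, coe_addNat]
      omega

/-- The first splitting time after `t`. -/
def nextSplit (σ : Equiv.Perm ℕ+) (t : ℕ∞) : ℕ∞ :=
  sInf {s : ℕ∞ | ∃ n : ℕ, s = n ∧ t < n ∧ SplitsAt σ n}

theorem splitTime_succ (σ : Equiv.Perm ℕ+) (k : ℕ) :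
    splitTime σ (k + 1) = nextSplit σ (splitTime σ k) := by
  rw [splitTime, nextSplit]

theorem nextSplit_eq_coe_iff (σ : Equiv.Perm ℕ+) (t : ℕ∞) (n : ℕ) :
    nextSplit σ t = n ↔ t < n ∧ SplitsAt σ n ∧ ∀ m < n, t < m → ¬ SplitsAt σ m := by
  constructor
  · intro h
    have hne : {s : ℕ∞ | ∃ n : ℕ, s = n ∧ t < n ∧ SplitsAt σ n}.Nonempty := by
      by_contra h1
      rw [Set.not_nonempty_iff_eq_empty] at h1
      rw [nextSplit, h1, sInf_empty] at h
      exact ENat.top_ne_natCast n h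
    obtain ⟨m, hm, h2, h3⟩ := csInf_mem hne
    rw [← nextSplit, h, Nat.cast_inj] at hm
    subst hm
    refine ⟨h2, h3, fun m hm h4 h5 => ?_⟩
    have h6 : nextSplit σ t ≤ m := sInf_le ⟨m, rfl, h4, h5⟩
    rw [h, Nat.cast_le] at h6
    omega
  · rintro ⟨h1, h2, h3⟩
    refine le_antisymm (sInf_le ⟨n, rfl, h1, h2⟩) (le_sInf ?_)
    rintro _ ⟨m, rfl, h4, h5⟩
    rw [Nat.cast_le]
    by_contra h6
    exact h3 m (by omega) h4 h5

theorem nextSplit_top (σ : Equiv.Perm ℕ+) : nextSplit σ ⊤ = ⊤ := by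
  simp [nextSplit]

theorem lt_nextSplit_iff (σ : Equiv.Perm ℕ+) (t : ℕ∞) (n : ℕ) :
    n < nextSplit σ t ↔ ∀ m ≤ n, t < m → ¬ SplitsAt σ m := by
  constructor
  · intro h m hm h1 h2
    have h3 : nextSplit σ t ≤ m := sInf_le ⟨m, rfl, h1, h2⟩
    have h4 := h.trans_le h3
    rw [Nat.cast_lt] at h4
    omega
  · intro h
    by_contra h1
    rw [not_lt] at h1
    obtain ⟨m, hm⟩ := ENat.ne_top_iff_exists.1 (ne_top_of_le_ne_top (ENat.natCast_ne_top n) h1)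
    have h2 := (nextSplit_eq_coe_iff σ t m).1 hm.symm
    rw [← hm, Nat.cast_le] at h1
    exact h m h1 h2.1 h2.2.1

/-- The splitting times after a splitting time `a` are those of the residual permutation, shifted
by `a`. -/
theorem nextSplit_add {σ : Equiv.Perm ℕ+} {a : ℕ} (h : SplitsAt σ a) (t : ℕ∞) :
    nextSplit σ (a + t) = a + nextSplit (residual a σ) t := by
  induction t with
  | top => rw [add_top, nextSplit_top, nextSplit_top, add_top]
  | coe t =>
    have key : ∀ n : ℕ, nextSplit (residual a σ) t = n → nextSplit σ (a + t) = a + n := by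
      intro n hn
      rw [nextSplit_eq_coe_iff] at hn
      have h1 := (nextSplit_eq_coe_iff σ (a + t) (a + n)).2 ?_
      · rw [h1, Nat.cast_add]
      · obtain ⟨h2, h3, h4⟩ := hn
        norm_cast at h2 h4 ⊢
        refine ⟨by omega, (splitsAt_add_iff h n).2 h3, fun m hm h5 h6 => ?_⟩
        obtain ⟨l, rfl⟩ : ∃ l, m = a + l := ⟨m - a, by omega⟩
        exact h4 l (by omega) (by omega) ((splitsAt_add_iff h l).1 h6)
    rcases eq_or_ne (nextSplit (residual a σ) t) ⊤ with h1 | h1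
    · rw [h1, add_top]
      refine ENat.eq_top_iff_forall_gt.2 fun n => ?_
      rw [lt_nextSplit_iff]
      intro m hm h2 h3
      norm_cast at h2
      obtain ⟨l, rfl⟩ : ∃ l, m = a + l := ⟨m - a, by omega⟩
      have h4 : ((l : ℕ) : ℕ∞) < nextSplit (residual a σ) t := by
        rw [h1]
        exact ENat.natCast_lt_top l
      exact (lt_nextSplit_iff _ _ _).1 h4 l le_rfl (by norm_cast; omega)
        ((splitsAt_add_iff h l).1 h3)
    · obtain ⟨n, hn⟩ := ENat.ne_top_iff_exists.1 h1
      rw [← hn]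
      exact key n hn.symm

theorem splitTime_zero (σ : Equiv.Perm ℕ+) : splitTime σ 0 = 0 := by rw [splitTime]

theorem firstLength_eq_nextSplit (σ : Equiv.Perm ℕ+) : firstLength σ = nextSplit σ 0 := by
  rw [firstLength, splitTime_succ, splitTime_zero]

theorem firstLength_eq_coe_iff (σ : Equiv.Perm ℕ+) (n : ℕ) :
    firstLength σ = n ↔ SplitsAt σ n ∧ 0 < n ∧ ∀ m < n, 0 < m → ¬ SplitsAt σ m := by
  rw [firstLength_eq_nextSplit, nextSplit_eq_coe_iff]
  simp only [Nat.cast_pos]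
  tauto

theorem lt_firstLength_iff (σ : Equiv.Perm ℕ+) (n : ℕ) :
    n < firstLength σ ↔ ∀ m ≤ n, 0 < m → ¬ SplitsAt σ m := by
  rw [firstLength_eq_nextSplit, lt_nextSplit_iff]
  simp only [Nat.cast_pos]

theorem splitTime_succ_eq_add {σ : Equiv.Perm ℕ+} {a : ℕ} (h : firstLength σ = a) (k : ℕ) :
    splitTime σ (k + 1) = a + splitTime (residual a σ) k := by
  have hs := ((firstLength_eq_coe_iff σ a).1 h).1
  induction k with
  | zero => rw [splitTime_zero, add_zero, ← h, firstLength]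
  | succ k ih => rw [splitTime_succ, ih, nextSplit_add hs, ← splitTime_succ]

theorem splitTime_succ_eq_top {σ : Equiv.Perm ℕ+} (h : firstLength σ = ⊤) (k : ℕ) :
    splitTime σ (k + 1) = ⊤ := by
  induction k with
  | zero => exact h
  | succ k ih => rw [splitTime_succ, ih, nextSplit_top]

theorem renewals_splitTime_iff (σ : Equiv.Perm ℕ+) (n : ℕ) :
    renewals (splitTime σ) n ↔ SplitsAt σ n := by
  classical
  constructor
  · rintro ⟨k, hk⟩
    cases k with
    | zero =>
      rw [splitTime_zero] at hk
      have : n = 0 := by exact_mod_cast hk.symm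
      rw [this]
      exact splitsAt_zero σ
    | succ k =>
      rw [splitTime_succ, nextSplit_eq_coe_iff] at hk
      exact hk.2.1
  · induction n using Nat.strong_induction_on with
    | _ n ih =>
      intro h
      rcases Nat.eq_zero_or_pos n with rfl | hn
      · exact ⟨0, by rw [splitTime_zero, Nat.cast_zero]⟩
      -- the last splitting time before `n`
      · set m := Nat.findGreatest (SplitsAt σ) (n - 1) with hm
        have h1 : m ≤ n - 1 := Nat.findGreatest_le _
        have h2 : SplitsAt σ m := Nat.findGreatest_spec (Nat.zero_le _) (splitsAt_zero σ)
        obtain ⟨k, hk⟩ := ih m (by omega) h2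
        refine ⟨k + 1, ?_⟩
        rw [splitTime_succ, hk, nextSplit_eq_coe_iff]
        refine ⟨by norm_cast; omega, h, fun l hl h3 => ?_⟩
        norm_cast at h3
        exact Nat.findGreatest_is_greatest h3 (by omega)

theorem measurable_enat {X : Type*} [MeasurableSpace X] {f : X → ℕ∞}
    (h : ∀ n : ℕ, MeasurableSet {x | f x = n}) : Measurable f := by
  refine measurable_to_countable' fun a => ?_
  induction a with
  | coe n => exact h n
  | top =>
    have : f ⁻¹' {⊤} = (⋃ n : ℕ, {x | f x = n})ᶜ := by
      ext x
      simp only [Set.mem_preimage, Set.mem_singleton_iff, Set.mem_compl_iff, Set.mem_iUnion,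
        Set.mem_ofPred_eq, not_exists]
      rw [ENat.eq_top_iff_forall_ne]
      exact forall_congr' fun _ => ne_comm
    rw [this]
    exact (MeasurableSet.iUnion h).compl

theorem measurable_splitTime (k : ℕ) : Measurable fun σ => splitTime σ k := by
  induction k with
  | zero =>
    simp only [splitTime_zero]
    exact measurable_const
  | succ k ih =>
    refine measurable_enat fun n => ?_
    have : {σ : Equiv.Perm ℕ+ | splitTime σ (k + 1) = n}
        = {σ | splitTime σ k < n} ∩ ({σ | SplitsAt σ n} ∩
          ⋂ m ∈ Finset.range n, ({σ | splitTime σ k < m} ∩ {σ | SplitsAt σ m})ᶜ) := by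
      ext σ
      simp only [splitTime_succ, nextSplit_eq_coe_iff, Set.mem_inter_iff, Set.mem_ofPred_eq,
        Set.mem_iInter, Finset.mem_range, Set.mem_compl_iff, not_and]
    rw [this]
    exact (ih (MeasurableSet.of_discrete (s := Set.Iio (n : ℕ∞)))).inter
      ((measurableSet_splitsAt n).inter (Finset.measurableSet_biInter _ fun m _ =>
        ((ih (MeasurableSet.of_discrete (s := Set.Iio (m : ℕ∞)))).inter
          (measurableSet_splitsAt m)).compl))

theorem measurable_splitTimes : Measurable splitTime :=
  measurable_pi_lambda _ measurable_splitTime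

theorem measurable_firstLength : Measurable firstLength := measurable_splitTime 1

theorem measurableSet_firstLength_eq (a : ℕ∞) :
    MeasurableSet {σ : Equiv.Perm ℕ+ | firstLength σ = a} :=
  measurable_firstLength (measurableSet_singleton a)

theorem measurableSet_lt_firstLength (n : ℕ) :
    MeasurableSet {σ : Equiv.Perm ℕ+ | n < firstLength σ} :=
  measurable_firstLength (MeasurableSet.of_discrete (s := Set.Ioi (n : ℕ∞)))

/-! ### Regeneration at the splitting times -/

/-- The event `D` only depends on the first `n` values of the permutation. -/
def IsPrefixEvent (n : ℕ) (D : Set (Equiv.Perm ℕ+)) : Prop :=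
  ∀ σ τ : Equiv.Perm ℕ+, (∀ i : ℕ+, (i : ℕ) ≤ n → σ i = τ i) → (σ ∈ D ↔ τ ∈ D)

theorem IsPrefixEvent.inter {n : ℕ} {D D' : Set (Equiv.Perm ℕ+)} (h : IsPrefixEvent n D)
    (h' : IsPrefixEvent n D') : IsPrefixEvent n (D ∩ D') :=
  fun σ τ hst => and_congr (h σ τ hst) (h' σ τ hst)

theorem isPrefixEvent_univ (n : ℕ) : IsPrefixEvent n Set.univ := fun _ _ _ => Iff.rfl

theorem isPrefixEvent_firstLength_eq (n : ℕ) : IsPrefixEvent n {σ | firstLength σ = n} := by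
  intro σ τ hst
  simp only [Set.mem_ofPred_eq, firstLength_eq_coe_iff]
  rw [splitsAt_congr hst]
  refine and_congr_right fun _ => and_congr_right fun _ => forall_congr' fun m =>
    forall_congr' fun hm => ?_
  rw [splitsAt_congr fun i hi => hst i (by omega)]

/-- The law `L` of a random permutation regenerates at its splitting times: given a split at `n`,
the residual permutation has law `L` and is independent of the first `n` values. -/
def Regenerates (L : Measure (Equiv.Perm ℕ+)) : Prop :=
  ∀ (n : ℕ) (D B : Set (Equiv.Perm ℕ+)), IsPrefixEvent n D → MeasurableSet B →
    L ({σ | SplitsAt σ n} ∩ D ∩ residual n ⁻¹' B) = L ({σ | SplitsAt σ n} ∩ D) * L B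

theorem regenerates_permLaw (p : PMF ℕ+) (hp : 0 < p 1) : Regenerates (permLaw p) :=
  fun n _ _ hD hB => permLaw_inter_residual p hp n hD hB

/-- Regeneration at the first positive splitting time. -/
theorem Regenerates.firstLength {L : Measure (Equiv.Perm ℕ+)} (hL : Regenerates L) (n : ℕ)
    {D B : Set (Equiv.Perm ℕ+)} (hD : IsPrefixEvent n D) (hB : MeasurableSet B) :
    L ({σ | firstLength σ = n} ∩ D ∩ residual n ⁻¹' B) = L ({σ | firstLength σ = n} ∩ D) * L B := by
  have h := hL n _ B ((isPrefixEvent_firstLength_eq n).inter hD) hB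
  have h1 : {σ : Equiv.Perm ℕ+ | SplitsAt σ n} ∩ ({σ | PShift.firstLength σ = n} ∩ D)
      = {σ | PShift.firstLength σ = n} ∩ D := by
    refine Set.inter_eq_right.2 fun σ hσ => ?_
    exact ((firstLength_eq_coe_iff σ n).1 hσ.1).1
  rwa [h1] at h

theorem measure_eq_tsum_firstLength (L : Measure (Equiv.Perm ℕ+)) {S : Set (Equiv.Perm ℕ+)}
    (hS : MeasurableSet S) : L S = ∑' a : ℕ∞, L ({σ | firstLength σ = a} ∩ S) := by
  rw [← measure_iUnion]
  · congr 1
    ext σ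
    simp
  · intro a b hab
    refine Set.disjoint_left.2 fun σ h1 h2 => hab ?_
    exact h1.1.symm.trans h2.1
  · exact fun a => (measurableSet_firstLength_eq a).inter hS

/-- The sequence `0, a + t₀, a + t₁, …`: the renewal times after a first step of length `a`. -/
def delay (q : ℕ∞ × (ℕ → ℕ∞)) : ℕ → ℕ∞
  | 0 => 0
  | n + 1 => q.1 + q.2 n

theorem measurable_delay : Measurable delay := by
  refine measurable_pi_lambda _ fun n => ?_
  cases n with
  | zero => exact measurable_const
  | succ n =>
    have h : Measurable fun q : ℕ∞ × ℕ∞ => q.1 + q.2 := measurable_of_countable _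
    exact h.comp (by fun_prop : Measurable fun q : ℕ∞ × (ℕ → ℕ∞) => (q.1, q.2 n))

/-- The law of the splitting times is a fixed point: an independent first step followed by a copy of
the whole sequence. When the first component is infinite the copy is irrelevant, as `delay` then
returns `0, ∞, ∞, …`. -/
theorem Regenerates.map_splitTime_eq {L : Measure (Equiv.Perm ℕ+)} [IsProbabilityMeasure L]
    (hL : Regenerates L) :
    ((L.map PShift.firstLength).prod (L.map splitTime)).map delay = L.map splitTime := by
  have : IsProbabilityMeasure (L.map PShift.firstLength) :=
    Measure.isProbabilityMeasure_map measurable_firstLength.aemeasurable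
  have : IsProbabilityMeasure (L.map splitTime) :=
    Measure.isProbabilityMeasure_map measurable_splitTimes.aemeasurable
  ext B hB
  rw [Measure.map_apply measurable_delay hB, Measure.prod_apply (measurable_delay hB),
    lintegral_countable', Measure.map_apply measurable_splitTimes hB,
    measure_eq_tsum_firstLength L (measurable_splitTimes hB)]
  refine tsum_congr fun a => ?_
  have hda : Measurable fun t => delay (a, t) := measurable_delay.comp measurable_prodMk_left
  rw [Measure.map_apply measurable_splitTimes (measurable_prodMk_left (measurable_delay hB)),
    Measure.map_apply measurable_firstLength (measurableSet_singleton a), mul_comm]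
  change L {σ | PShift.firstLength σ = a} * L {σ | delay (a, splitTime σ) ∈ B} = _
  induction a with
  | coe k =>
    have h := hL.firstLength k (isPrefixEvent_univ k)
      (B := {σ | delay (k, splitTime σ) ∈ B}) (measurable_splitTimes (hda hB))
    rw [Set.inter_univ] at h
    rw [← h]
    congr 1
    ext σ
    refine and_congr_right fun h1 => ?_
    have h2 : splitTime σ = delay (k, splitTime (residual k σ)) := by
      funext n
      cases n with
      | zero => exact splitTime_zero σ
      | succ n => exact splitTime_succ_eq_add h1 n
    change delay (k, splitTime (residual k σ)) ∈ B ↔ splitTime σ ∈ B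
    rw [h2]
  | top =>
    have h1 : ∀ t, delay (⊤, t) = delay (⊤, fun _ => 0) := by
      intro t
      funext n
      cases n with
      | zero => rfl
      | succ n => simp [delay]
    have h2 : {σ : Equiv.Perm ℕ+ | PShift.firstLength σ = ⊤} ∩ splitTime ⁻¹' B
        = {σ | PShift.firstLength σ = ⊤} ∩ {σ | delay (⊤, splitTime σ) ∈ B} := by
      ext σ
      refine and_congr_right fun h3 => ?_
      have h4 : splitTime σ = delay (⊤, splitTime σ) := by
        funext n
        cases n with
        | zero => exact splitTime_zero σ
        | succ n =>
          rw [splitTime_succ_eq_top h3]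
          simp [delay]
      change splitTime σ ∈ B ↔ delay (⊤, splitTime σ) ∈ B
      rw [← h4]
    rw [h2]
    simp only [h1]
    by_cases h3 : delay (⊤, fun _ => 0) ∈ B
    · simp [h3]
    · simp [h3]

/-- The partial sums `0, y₀, y₀ + y₁, …`. -/
def partialSums (y : ℕ → ℕ∞) (n : ℕ) : ℕ∞ := ∑ i ∈ Finset.range n, y i

theorem measurable_partialSums : Measurable partialSums := by
  refine measurable_pi_lambda _ fun n => ?_
  exact measurable_of_determined (e := fun y : ℕ → ℕ∞ => y) measurable_id (Finset.range n)
    fun x y h => Finset.sum_congr rfl h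

/-- The law of the partial sums of i.i.d. steps is a fixed point of the same equation. -/
theorem infinitePi_map_partialSums_eq (ν : Measure ℕ∞) [IsProbabilityMeasure ν] :
    (ν.prod ((Measure.infinitePi fun _ : ℕ => ν).map partialSums)).map delay
      = (Measure.infinitePi fun _ : ℕ => ν).map partialSums := by
  set Q := Measure.infinitePi fun _ : ℕ => ν with hQ
  set c : ℕ → ℕ ⊕ ℕ := fun n => Nat.casesOn n (Sum.inl 0) Sum.inr with hc
  have hci : Function.Injective c := by
    intro m n h
    cases m <;> cases n <;> simp_all [c]
  have h1 := prod_infinitePi_map_glue (α := ℕ) (β := ℕ) ν hci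
  have h2 : ν = Q.map fun y => y 0 := (Measure.infinitePi_map_eval (fun _ : ℕ => ν) 0).symm
  have hgm : Measurable fun (q : (ℕ → ℕ∞) × (ℕ → ℕ∞)) i => Sum.elim q.1 q.2 (c i) := by
    refine measurable_pi_lambda _ fun i => ?_
    cases c i <;> simp only [Sum.elim_inl, Sum.elim_inr] <;> fun_prop
  conv_lhs => rw [h2]
  rw [Measure.map_prod_map _ _ (measurable_pi_apply 0) measurable_partialSums,
    Measure.map_map measurable_delay ((measurable_pi_apply 0).prodMap measurable_partialSums)]
  conv_rhs => rw [hQ, ← h1]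
  rw [Measure.map_map measurable_partialSums hgm]
  congr 1
  funext q n
  cases n with
  | zero => simp [delay, partialSums]
  | succ n =>
    simp only [Function.comp_apply, Prod.map, delay, partialSums, Finset.sum_range_succ']
    exact add_comm _ _

/-- The law of a renewal sequence is determined by the law of its first step. -/
theorem eq_of_map_delay_eq {ν : Measure ℕ∞} [IsProbabilityMeasure ν]
    {τ τ' : Measure (ℕ → ℕ∞)} [IsProbabilityMeasure τ] [IsProbabilityMeasure τ']
    (h : (ν.prod τ).map delay = τ) (h' : (ν.prod τ').map delay = τ') : τ = τ' := by
  -- `trunc n` freezes a sequence after time `n`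
  set trunc : ℕ → (ℕ → ℕ∞) → ℕ → ℕ∞ := fun n t k => t (min k n) with htrunc
  have hm : ∀ n, Measurable (trunc n) := fun n => by fun_prop
  have h0 : ∀ q, trunc 0 (delay q) = fun _ => 0 := by
    intro q
    funext k
    simp [htrunc, delay]
  have h1 : ∀ n, trunc (n + 1) ∘ delay = delay ∘ Prod.map id (trunc n) := by
    intro n
    funext q k
    cases k with
    | zero => simp [htrunc, delay]
    | succ k => simp [htrunc, delay, Nat.succ_min_succ]
  -- one more application of the equation determines one more coordinate
  have key : ∀ n, τ.map (trunc n) = τ'.map (trunc n) := by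
    intro n
    induction n with
    | zero =>
      have h2 : trunc 0 ∘ delay = fun _ _ => 0 := funext h0
      rw [← h, ← h', Measure.map_map (hm 0) measurable_delay,
        Measure.map_map (hm 0) measurable_delay, h2, Measure.map_const, Measure.map_const]
      simp
    | succ n ih =>
      have h2 : ∀ ρ : Measure (ℕ → ℕ∞), IsProbabilityMeasure ρ → (ν.prod ρ).map delay = ρ →
          ρ.map (trunc (n + 1)) = (ν.prod (ρ.map (trunc n))).map delay := by
        intro ρ _ hρ
        conv_lhs => rw [← hρ]
        rw [Measure.map_map (hm _) measurable_delay, h1,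
          ← Measure.map_map measurable_delay (measurable_id.prodMap (hm n)),
          ← Measure.map_prod_map _ _ measurable_id (hm n), Measure.map_id]
      rw [h2 τ inferInstance h, h2 τ' inferInstance h', ih]
  have h2 : ∀ (I : Finset ℕ) (ρ : Measure (ℕ → ℕ∞)),
      ρ.map I.restrict = (ρ.map (trunc (I.sup id))).map I.restrict := by
    intro I ρ
    rw [Measure.map_map (Finset.measurable_restrict I) (hm _)]
    congr 1
    funext t i
    simp only [htrunc, Function.comp_apply, Finset.restrict]
    have h3 : (i : ℕ) ≤ I.sup id := Finset.le_sup (f := id) i.2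
    rw [min_eq_left h3]
  refine IsProjectiveLimit.unique (P := fun I => τ.map I.restrict) (fun I => rfl) fun I => ?_
  change τ'.map I.restrict = τ.map I.restrict
  rw [h2 I τ, h2 I τ', key]

/-- The law of the lengths of the components. -/
def lengthLaw (L : Measure (Equiv.Perm ℕ+)) [IsProbabilityMeasure L] : PMF ℕ∞ :=
  have : IsProbabilityMeasure (L.map firstLength) :=
    Measure.isProbabilityMeasure_map measurable_firstLength.aemeasurable
  (L.map firstLength).toPMF

theorem toMeasure_lengthLaw (L : Measure (Equiv.Perm ℕ+)) [IsProbabilityMeasure L] :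
    (lengthLaw L).toMeasure = L.map firstLength := by
  have : IsProbabilityMeasure (L.map firstLength) :=
    Measure.isProbabilityMeasure_map measurable_firstLength.aemeasurable
  exact Measure.toPMF_toMeasure _

theorem lengthLaw_zero (L : Measure (Equiv.Perm ℕ+)) [IsProbabilityMeasure L] :
    lengthLaw L 0 = 0 := by
  rw [← PMF.toMeasure_apply_singleton _ _ (measurableSet_singleton _), toMeasure_lengthLaw,
    Measure.map_apply measurable_firstLength (measurableSet_singleton _)]
  have : firstLength ⁻¹' {0} = ∅ := by
    ext σ
    have := firstLength_eq_coe_iff σ 0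
    rw [Nat.cast_zero] at this
    simp [this]
  rw [this, measure_empty]

/-- The splitting times form a renewal process: both laws solve the same fixed point equation. -/
theorem Regenerates.map_splitTime {L : Measure (Equiv.Perm ℕ+)} [IsProbabilityMeasure L]
    (hL : Regenerates L) : L.map splitTime = renewalLaw (PMF.pure 0) (lengthLaw L) := by
  have : IsProbabilityMeasure (L.map PShift.firstLength) :=
    Measure.isProbabilityMeasure_map measurable_firstLength.aemeasurable
  have : IsProbabilityMeasure (L.map splitTime) :=
    Measure.isProbabilityMeasure_map measurable_splitTimes.aemeasurable
  have : IsProbabilityMeasure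
      ((Measure.infinitePi fun _ : ℕ => L.map PShift.firstLength).map partialSums) :=
    Measure.isProbabilityMeasure_map measurable_partialSums.aemeasurable
  have h1 := eq_of_map_delay_eq hL.map_splitTime_eq
    (infinitePi_map_partialSums_eq (L.map PShift.firstLength))
  rw [h1, renewalLaw]
  simp only [toMeasure_lengthLaw]
  rw [PMF.toMeasure_pure, Measure.dirac_prod, Measure.map_map _ measurable_prodMk_left]
  · congr 1
    funext y n
    simp [partialSums]
  · have h2 : Measurable fun q : ℕ∞ × ℕ∞ => q.1 + q.2 := measurable_of_countable _
    refine measurable_pi_lambda _ fun n => ?_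
    exact h2.comp (((measurable_of_countable fun k : ℕ => (k : ℕ∞)).comp measurable_fst).prodMk
      ((measurable_pi_apply n).comp (measurable_partialSums.comp measurable_snd)))

theorem map_cond_preimage {Ω : Type*} [MeasurableSpace Ω] {P : Measure Ω}
    {Perm : Ω → Equiv.Perm ℕ+} (hP : Measurable Perm) {S : Set (Equiv.Perm ℕ+)}
    (hS : MeasurableSet S) : (cond P (Perm ⁻¹' S)).map Perm = cond (P.map Perm) S := by
  ext B hB
  rw [Measure.map_apply hP hB, cond_apply (hP hS), cond_apply hS, Measure.map_apply hP hS,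
    Measure.map_apply hP (hS.inter hB), Set.preimage_inter]

theorem Regenerates.cond_inter {L : Measure (Equiv.Perm ℕ+)} [IsProbabilityMeasure L]
    (hL : Regenerates L) {n : ℕ} {D B : Set (Equiv.Perm ℕ+)} (hD : IsPrefixEvent n D)
    (hB : MeasurableSet B) :
    cond L {σ | SplitsAt σ n} (D ∩ residual n ⁻¹' B) = cond L {σ | SplitsAt σ n} D * L B := by
  rw [cond_apply (measurableSet_splitsAt n), cond_apply (measurableSet_splitsAt n),
    ← Set.inter_assoc, hL n D B hD hB, mul_assoc]

theorem Regenerates.map_residual_cond {L : Measure (Equiv.Perm ℕ+)} [IsProbabilityMeasure L]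
    (hL : Regenerates L) {n : ℕ} (h : L {σ | SplitsAt σ n} ≠ 0) :
    (cond L {σ | SplitsAt σ n}).map (residual n) = L := by
  have := cond_isProbabilityMeasure h
  ext B hB
  have h1 := hL.cond_inter (isPrefixEvent_univ n) hB
  rw [Set.univ_inter, measure_univ, one_mul] at h1
  rw [Measure.map_apply (measurable_residual n) hB, h1]

/-- A permutation together with the indicators of its positive splitting times. -/
def withSplits (σ : Equiv.Perm ℕ+) : Equiv.Perm ℕ+ × (ℕ → Prop) :=
  (σ, fun k => SplitsAt σ (k + 1))

theorem measurable_splits : Measurable fun (σ : Equiv.Perm ℕ+) (k : ℕ) => SplitsAt σ k :=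
  measurable_pi_lambda _ fun k => measurableSet_setOfPred.1 (measurableSet_splitsAt k)

theorem measurable_withSplits : Measurable withSplits :=
  measurable_id.prodMk (measurable_pi_lambda _ fun k =>
    (measurable_pi_apply (k + 1)).comp measurable_splits)

theorem measurable_renewals : Measurable fun (t : ℕ → ℕ∞) (k : ℕ) => renewals t k := by
  refine measurable_pi_lambda _ fun n => measurableSet_setOfPred.1 ?_
  have : {t : ℕ → ℕ∞ | renewals t n} = ⋃ k, {t : ℕ → ℕ∞ | t k = n} := by
    ext t
    simp [renewals]
  rw [this]
  exact MeasurableSet.iUnion fun k =>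
    (measurable_pi_apply (X := fun _ : ℕ => ℕ∞) k) (measurableSet_singleton (n : ℕ∞))

/-- The law `κ` required in the definition of a regenerative permutation is that of the permutation
with its own splitting indicators. -/
theorem Regenerates.isStrictlyRegenerative {L : Measure (Equiv.Perm ℕ+)} [IsProbabilityMeasure L]
    (hL : Regenerates L) {Ω : Type*} [MeasurableSpace Ω] {P : Measure Ω} [IsProbabilityMeasure P]
    {Perm : Ω → Equiv.Perm ℕ+} (hm : Measurable Perm) (hP : P.map Perm = L) :
    IsStrictlyRegenerative P Perm := by
  refine ⟨PMF.pure 0, lengthLaw L, lengthLaw_zero L, ?_, ?_, L.map withSplits, ?_, ?_⟩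
  · rw [← hL.map_splitTime, ← hP, Measure.map_map measurable_splitTimes hm]
    rfl
  · exact Eventually.of_forall fun ω n h => (renewals_splitTime_iff _ n).1 h
  · rw [← hL.map_splitTime, Measure.map_map measurable_snd measurable_withSplits,
      Measure.map_map _ measurable_splitTimes]
    · congr 1
      funext σ k
      exact propext (renewals_splitTime_iff σ (k + 1)).symm
    · exact measurable_pi_lambda _ fun k => (measurable_pi_apply (k + 1)).comp measurable_renewals
  · intro n _ hn
    simp only [renewals_splitTime_iff] at hn ⊢
    have hS : {ω | SplitsAt (Perm ω) n} = Perm ⁻¹' {σ | SplitsAt σ n} := rfl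
    have hn' : L {σ | SplitsAt σ n} ≠ 0 := by
      rwa [← hP, Measure.map_apply hm (measurableSet_splitsAt n)]
    have := cond_isProbabilityMeasure hn'
    have hc := map_cond_preimage (P := P) hm (measurableSet_splitsAt n)
    rw [hP] at hc
    rw [hS]
    have hsnd : Measurable fun σ : Equiv.Perm ℕ+ =>
        (residual n σ, fun k : ℕ => SplitsAt σ (n + (k + 1))) :=
      (measurable_residual n).prodMk (measurable_pi_lambda _ fun k =>
        (measurable_pi_apply (n + (k + 1))).comp measurable_splits)
    have hfst : Measurable fun (σ : Equiv.Perm ℕ+) (k : Fin (n + 1)) => SplitsAt σ k :=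
      measurable_pi_lambda _ fun k => (measurable_pi_apply (k : ℕ)).comp measurable_splits
    have hae : ∀ᵐ σ ∂(cond L {σ | SplitsAt σ n}),
        (residual n σ, fun k : ℕ => SplitsAt σ (n + (k + 1))) = withSplits (residual n σ) := by
      filter_upwards [ae_cond_mem (measurableSet_splitsAt n)] with σ hσ
      simp only [withSplits]
      congr 1
      funext k
      exact propext (splitsAt_add_iff hσ (k + 1))
    have hmap : (cond L {σ | SplitsAt σ n}).map
        (fun σ => (residual n σ, fun k : ℕ => SplitsAt σ (n + (k + 1)))) = L.map withSplits := by
      rw [Measure.map_congr hae]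
      change (cond L {σ | SplitsAt σ n}).map (withSplits ∘ residual n) = _
      rw [← Measure.map_map measurable_withSplits (measurable_residual n),
        hL.map_residual_cond hn']
    have hmapP : (cond P (Perm ⁻¹' {σ | SplitsAt σ n})).map
        (fun ω => (residual n (Perm ω), fun k : ℕ => SplitsAt (Perm ω) (n + (k + 1))))
          = L.map withSplits := by
      rw [← hmap, ← hc, Measure.map_map hsnd hm]
      rfl
    refine ⟨hmapP, ?_⟩
    rw [indepFun_iff_measure_inter_preimage_eq_mul]
    intro s t hs ht
    have e1 : ∀ X : Set (Equiv.Perm ℕ+), MeasurableSet X →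
        cond P (Perm ⁻¹' {σ | SplitsAt σ n}) (Perm ⁻¹' X) = cond L {σ | SplitsAt σ n} X := by
      intro X hX
      rw [← hc, Measure.map_apply hm hX]
    have hD : IsPrefixEvent n ((fun (σ : Equiv.Perm ℕ+) (k : Fin (n + 1)) => SplitsAt σ k) ⁻¹' s) := by
      intro σ τ hst
      have : (fun k : Fin (n + 1) => SplitsAt σ k) = fun k : Fin (n + 1) => SplitsAt τ k := by
        funext k
        have := k.2
        exact propext (splitsAt_congr fun i hi => hst i (by omega))
      simp only [Set.mem_preimage, this]
    have e2 := hL.cond_inter hD (measurable_withSplits ht)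
    refine (e1 _ ((hfst hs).inter (hsnd ht))).trans ?_
    refine Eq.trans ?_ (congrArg₂ (· * ·) (e1 _ (hfst hs)) (e1 _ (hsnd ht))).symm
    have e3 : cond L {σ | SplitsAt σ n} ((fun σ : Equiv.Perm ℕ+ =>
        (residual n σ, fun k : ℕ => SplitsAt σ (n + (k + 1)))) ⁻¹' t) = L (withSplits ⁻¹' t) := by
      rw [← Measure.map_apply hsnd ht, hmap, Measure.map_apply measurable_withSplits ht]
    rw [e3, ← e2]
    refine measure_congr ?_
    filter_upwards [hae] with σ hσ
    refine propext (and_congr_right fun _ => ?_)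
    change (residual n σ, fun k : ℕ => SplitsAt σ (n + (k + 1))) ∈ t ↔ _
    rw [hσ]
    rfl

/-! ### Renewal equations -/

section Renewal

open Finset.HasAntidiagonal (antidiagonal mem_antidiagonal)

variable {L : Measure (Equiv.Perm ℕ+)}

/-- The renewal equation: decomposition at the first positive splitting time. -/
theorem Regenerates.splitsAt_eq_sum (hL : Regenerates L) {n : ℕ} (hn : 0 < n) :
    L {σ | SplitsAt σ n} = ∑ q ∈ antidiagonal n,
      L {σ | PShift.firstLength σ = q.1} * L {σ | SplitsAt σ q.2} := by
  have h : ∀ q ∈ antidiagonal n,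
      L {σ | PShift.firstLength σ = q.1} * L {σ | SplitsAt σ q.2}
        = L ({σ | PShift.firstLength σ = q.1} ∩ {σ | SplitsAt σ n}) := by
    intro q hq
    rw [mem_antidiagonal] at hq
    have h1 := hL.firstLength q.1 (isPrefixEvent_univ _) (measurableSet_splitsAt q.2)
    rw [Set.inter_univ] at h1
    rw [← h1]
    congr 1
    ext σ
    refine and_congr_right fun h2 => ?_
    have h3 := splitsAt_add_iff ((firstLength_eq_coe_iff σ q.1).1 h2).1 q.2
    rw [hq] at h3
    exact h3.symm
  rw [Finset.sum_congr rfl h, ← measure_biUnion_finset]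
  · congr 1
    ext σ
    simp only [Set.mem_iUnion, Set.mem_inter_iff, Set.mem_ofPred_eq, exists_and_right,
      exists_prop, mem_antidiagonal]
    refine ⟨fun h1 => ?_, fun h1 => h1.2⟩
    have h2 : PShift.firstLength σ ≤ n := by
      by_contra h3
      rw [not_le, lt_firstLength_iff] at h3
      exact h3 n le_rfl hn h1
    obtain ⟨k, hk⟩ := ENat.ne_top_iff_exists.1 (ne_top_of_le_ne_top (ENat.natCast_ne_top n) h2)
    rw [← hk, Nat.cast_le] at h2
    exact ⟨⟨(k, n - k), by simp only; omega, hk.symm⟩, h1⟩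
  · intro q hq q' hq' hne
    refine Set.disjoint_left.2 fun σ h1 h2 => hne ?_
    have h3 := h1.1.symm.trans h2.1
    rw [Nat.cast_inj] at h3
    simp only [Finset.mem_coe, mem_antidiagonal] at hq hq'
    exact Prod.ext h3 (by omega)
  · exact fun q _ => (measurableSet_firstLength_eq _).inter (measurableSet_splitsAt n)

variable [IsProbabilityMeasure L]

/-- Decomposition at the last splitting time in `[0, n]`. -/
theorem Regenerates.sum_splitsAt_mul (hL : Regenerates L) (n : ℕ) :
    ∑ q ∈ antidiagonal n,
      L {σ | SplitsAt σ q.1} * L {σ | (q.2 : ℕ∞) < PShift.firstLength σ} = 1 := by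
  classical
  have h : ∀ q ∈ antidiagonal n,
      L {σ | SplitsAt σ q.1} * L {σ | (q.2 : ℕ∞) < PShift.firstLength σ}
        = L ({σ | SplitsAt σ q.1} ∩ residual q.1 ⁻¹' {σ | (q.2 : ℕ∞) < PShift.firstLength σ}) := by
    intro q _
    have h1 := hL q.1 _ _ (isPrefixEvent_univ _) (measurableSet_lt_firstLength q.2)
    rw [Set.inter_univ] at h1
    exact h1.symm
  have hmem : ∀ (q : ℕ × ℕ) (σ : Equiv.Perm ℕ+), q.1 + q.2 = n →
      (σ ∈ {σ | SplitsAt σ q.1} ∩ residual q.1 ⁻¹' {σ | (q.2 : ℕ∞) < PShift.firstLength σ} ↔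
        SplitsAt σ q.1 ∧ ∀ m ≤ n, q.1 < m → ¬ SplitsAt σ m) := by
    intro q σ hq
    refine and_congr_right fun h1 => ?_
    change (q.2 : ℕ∞) < PShift.firstLength (residual q.1 σ) ↔ _
    rw [lt_firstLength_iff]
    constructor
    · intro h2 m hm hlt h3
      obtain ⟨l, rfl⟩ : ∃ l, m = q.1 + l := ⟨m - q.1, by omega⟩
      exact h2 l (by omega) (by omega) ((splitsAt_add_iff h1 l).1 h3)
    · intro h2 m hm hlt h3
      exact h2 (q.1 + m) (by omega) (by omega) ((splitsAt_add_iff h1 m).2 h3)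
  rw [Finset.sum_congr rfl h, ← measure_biUnion_finset]
  · rw [← measure_univ (μ := L)]
    congr 1
    refine Set.eq_univ_of_forall fun σ => ?_
    simp only [Set.mem_iUnion]
    set m := Nat.findGreatest (SplitsAt σ) n with hm
    have h1 : m ≤ n := Nat.findGreatest_le _
    refine ⟨(m, n - m), mem_antidiagonal.2 (by simp only; omega), ?_⟩
    rw [hmem _ _ (by simp only; omega)]
    exact ⟨Nat.findGreatest_spec (Nat.zero_le _) (splitsAt_zero σ),
      fun l hl h2 => Nat.findGreatest_is_greatest h2 hl⟩
  · intro q hq q' hq' hne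
    simp only [Finset.mem_coe, mem_antidiagonal] at hq hq'
    refine Set.disjoint_left.2 fun σ h1 h2 => hne ?_
    rw [hmem _ _ hq] at h1
    rw [hmem _ _ hq'] at h2
    have h3 : q.1 = q'.1 := by
      by_contra h4
      rcases lt_or_gt_of_ne h4 with h4 | h4
      · exact h1.2 _ (by omega) h4 h2.1
      · exact h2.2 _ (by omega) h4 h1.1
    exact Prod.ext h3 (by omega)
  · exact fun q _ => (measurableSet_splitsAt _).inter
      (measurable_residual _ (measurableSet_lt_firstLength _))

theorem measure_splitsAt_zero : L {σ | SplitsAt σ 0} = 1 := by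
  have : {σ : Equiv.Perm ℕ+ | SplitsAt σ 0} = Set.univ := Set.eq_univ_of_forall splitsAt_zero
  rw [this, measure_univ]

/-- `firstLength` is a positive splitting time, so its value `0` is never taken. -/
theorem measure_firstLength_zero (L : Measure (Equiv.Perm ℕ+)) :
    L {σ | firstLength σ = (0 : ℕ)} = 0 := by
  have : {σ : Equiv.Perm ℕ+ | firstLength σ = (0 : ℕ)} = ∅ := by
    ext σ
    simp only [Set.mem_ofPred_eq, firstLength_eq_coe_iff, Set.mem_empty_iff_false, iff_false]
    omega
  rw [this, measure_empty]

theorem measure_firstLength_lt_top (L : Measure (Equiv.Perm ℕ+)) :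
    L {σ | firstLength σ < ⊤} = ∑' n : ℕ, L {σ | firstLength σ = n} := by
  rw [← measure_iUnion]
  · congr 1
    ext σ
    simp only [Set.mem_ofPred_eq, Set.mem_iUnion, lt_top_iff_ne_top, ENat.ne_top_iff_exists]
    exact exists_congr fun n => eq_comm
  · intro a b hab
    refine Set.disjoint_left.2 fun σ h1 h2 => hab ?_
    have h3 := h1.symm.trans h2
    exact_mod_cast h3
  · exact fun n => measurableSet_firstLength_eq n

theorem tsum_firstLength_succ (L : Measure (Equiv.Perm ℕ+)) [IsProbabilityMeasure L] :
    ∑' n : ℕ, L {σ | firstLength σ = ((n + 1 : ℕ) : ℕ∞)} = L {σ | firstLength σ < ⊤} := by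
  rw [measure_firstLength_lt_top, tsum_eq_zero_add' (f := fun n : ℕ =>
    L {σ | firstLength σ = n}) ENNReal.summable, measure_firstLength_zero, zero_add]

theorem tsum_antidiagonal_mul (f g : ℕ → ℝ≥0∞) :
    ∑' n, ∑ q ∈ antidiagonal n, f q.1 * g q.2 = (∑' n, f n) * ∑' n, g n := by
  rw [← ENNReal.tsum_mul_right]
  simp_rw [← ENNReal.tsum_mul_left]
  rw [← ENNReal.tsum_prod (f := fun a b => f a * g b),
    ← Finset.HasAntidiagonal.sigmaAntidiagonalEquivProd.tsum_eq, ENNReal.tsum_sigma']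
  exact tsum_congr fun n => (Finset.tsum_subtype (antidiagonal n) fun q : ℕ × ℕ =>
    f q.1 * g q.2).symm

/-- The value at `1` of the generating function of the length of the first component. -/
theorem Regenerates.tsum_firstLength (hL : Regenerates L) :
    L {σ | PShift.firstLength σ < ⊤} = 1 - (∑' n : ℕ, L {σ | SplitsAt σ n})⁻¹ := by
  set U := ∑' n : ℕ, L {σ | SplitsAt σ n} with hU
  set F := L {σ | PShift.firstLength σ < ⊤} with hF
  have hF1 : F ≤ 1 := prob_le_one
  have hU0 : U ≠ 0 := by
    have h : L {σ | SplitsAt σ 0} ≤ U := ENNReal.le_tsum 0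
    rw [measure_splitsAt_zero] at h
    exact (one_pos.trans_le h).ne'
  by_cases hUt : U = ∞
  · -- if `U` is infinite, decompose at the last splitting time in `[0, n]`
    have h1 : U * (1 - F) ≤ 1 := by
      rw [hU, ← ENNReal.tsum_mul_right]
      refine ENNReal.tsum_le_of_sum_range_le fun n => ?_
      have h2 : L {σ | PShift.firstLength σ < ⊤}ᶜ = 1 - F :=
        prob_compl_eq_one_sub (measurable_firstLength (MeasurableSet.of_discrete (s := Set.Iio ⊤)))
      rcases n with _ | n
      · simp
      refine le_trans ?_ (hL.sum_splitsAt_mul n).le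
      rw [Finset.Nat.sum_antidiagonal_eq_sum_range_succ_mk]
      refine Finset.sum_le_sum fun k _ => ?_
      gcongr
      rw [← h2]
      refine measure_mono fun σ hσ => ?_
      simp only [Set.mem_compl_iff, Set.mem_ofPred_eq, not_lt, top_le_iff] at hσ ⊢
      rw [hσ]
      exact ENat.natCast_lt_top _
    rw [hUt] at h1 ⊢
    by_contra h2
    have h3 : 1 - F ≠ 0 := by
      intro h3
      rw [tsub_eq_zero_iff_le] at h3
      exact h2 (by simp [le_antisymm hF1 h3])
    rw [ENNReal.top_mul h3] at h1
    simp at h1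
  · have h1 : U = 1 + F * U := by
      conv_lhs => rw [hU, tsum_eq_zero_add' ENNReal.summable, measure_splitsAt_zero]
      congr 1
      rw [hF, measure_firstLength_lt_top, ← tsum_antidiagonal_mul,
        tsum_eq_zero_add' (f := fun n => ∑ q ∈ antidiagonal n,
          L {σ | PShift.firstLength σ = q.1} * L {σ | SplitsAt σ q.2}) ENNReal.summable]
      simp only [Finset.Nat.antidiagonal_zero, Finset.sum_singleton]
      rw [measure_firstLength_zero, zero_mul, zero_add]
      exact tsum_congr fun n => hL.splitsAt_eq_sum n.succ_pos
    have h2 : 1 = U⁻¹ + F := by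
      have h3 := congrArg (· * U⁻¹) h1
      simp only [add_mul, mul_assoc, one_mul, ENNReal.mul_inv_cancel hU0 hUt, mul_one] at h3
      exact h3
    exact ENNReal.eq_sub_of_add_eq (ENNReal.inv_ne_top.2 hU0) (by rw [h2, add_comm])

theorem summable_prob_mul_pow {a : ℕ → ℝ≥0∞} (ha : ∀ n, a n ≤ 1) {z : ℂ} (hz : ‖z‖ < 1) :
    Summable fun n => ‖((a n).toReal : ℂ) * z ^ n‖ := by
  refine Summable.of_nonneg_of_le (fun n => norm_nonneg _) (fun n => ?_)
    (summable_geometric_of_lt_one (norm_nonneg z) hz)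
  rw [norm_mul, norm_pow, Complex.norm_real, Real.norm_of_nonneg ENNReal.toReal_nonneg]
  refine mul_le_of_le_one_left (by positivity) ?_
  exact ENNReal.toReal_le_of_le_ofReal zero_le_one (by simpa using ha n)

/-- The renewal equation for generating functions. -/
theorem Regenerates.tsum_mul_one_sub (hL : Regenerates L) {z : ℂ} (hz : ‖z‖ < 1) :
    (∑' n : ℕ, ((L {σ | SplitsAt σ n}).toReal : ℂ) * z ^ n) *
      (1 - ∑' n : ℕ, ((L {σ | PShift.firstLength σ = n}).toReal : ℂ) * z ^ n) = 1 := by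
  have hu := summable_prob_mul_pow (a := fun n => L {σ | SplitsAt σ n}) (fun _ => prob_le_one) hz
  have hf := summable_prob_mul_pow (a := fun n : ℕ => L {σ | PShift.firstLength σ = n})
    (fun _ => prob_le_one) hz
  have h1 := tsum_mul_tsum_eq_tsum_sum_antidiagonal_of_summable_norm hf hu
  have h2 := (summable_norm_sum_mul_antidiagonal_of_summable_norm hf hu).of_norm
  have h3 : ∀ n : ℕ, ∑ q ∈ antidiagonal (n + 1),
      ((L {σ | PShift.firstLength σ = q.1}).toReal : ℂ) * z ^ q.1 *
        (((L {σ | SplitsAt σ q.2}).toReal : ℂ) * z ^ q.2)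
      = ((L {σ | SplitsAt σ (n + 1)}).toReal : ℂ) * z ^ (n + 1) := by
    intro n
    rw [hL.splitsAt_eq_sum n.succ_pos, ENNReal.toReal_sum (fun q _ =>
      ENNReal.mul_ne_top (measure_ne_top _ _) (measure_ne_top _ _)), Complex.ofReal_sum,
      Finset.sum_mul]
    refine Finset.sum_congr rfl fun q hq => ?_
    have h4 : n + 1 = q.1 + q.2 := (mem_antidiagonal.1 hq).symm
    rw [h4, ENNReal.toReal_mul, Complex.ofReal_mul, pow_add]
    ring
  rw [h2.tsum_eq_zero_add] at h1
  simp only [h3] at h1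
  have h4 := hu.of_norm.tsum_eq_zero_add
  simp only [Finset.Nat.antidiagonal_zero, Finset.sum_singleton, measure_firstLength_zero,
    ENNReal.toReal_zero, Complex.ofReal_zero, zero_mul, zero_add] at h1
  rw [measure_splitsAt_zero] at h4
  simp only [ENNReal.toReal_one, Complex.ofReal_one, pow_zero, mul_one] at h4
  rw [← h1] at h4
  linear_combination h4

theorem integral_powTop_firstLength (L : Measure (Equiv.Perm ℕ+)) [IsProbabilityMeasure L] {z : ℂ}
    (hz : ‖z‖ < 1) : ∫ σ, powTop z (firstLength σ) ∂L
      = ∑' n : ℕ, ((L {σ | firstLength σ = n}).toReal : ℂ) * z ^ n := by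
  have hb : ∀ a, ‖powTop z a‖ ≤ 1 := by
    intro a
    rw [powTop]
    split_ifs
    · simp
    · rw [norm_pow]
      exact pow_le_one₀ (norm_nonneg z) hz.le
  have hm : Measurable (powTop z) := measurable_of_countable _
  have : IsProbabilityMeasure (L.map firstLength) :=
    Measure.isProbabilityMeasure_map measurable_firstLength.aemeasurable
  rw [← integral_map measurable_firstLength.aemeasurable hm.aestronglyMeasurable,
    integral_countable (Integrable.of_bound hm.aestronglyMeasurable 1 (Eventually.of_forall hb)),
    ← (Nat.cast_injective (R := ℕ∞)).tsum_eq]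
  · refine tsum_congr fun n => ?_
    rw [measureReal_def, Measure.map_apply measurable_firstLength (measurableSet_singleton _)]
    simp [powTop, Set.preimage]
  · intro a ha
    induction a with
    | coe n => exact ⟨n, rfl⟩
    | top => simp [powTop] at ha

end Renewal

/-! ### The limit of the splitting probabilities -/

section Limit

open Finset.HasAntidiagonal (antidiagonal mem_antidiagonal)

variable {L : Measure (Equiv.Perm ℕ+)} [IsProbabilityMeasure L]

theorem toENNReal_eq_tsum (a : ℕ∞) :
    a.toENNReal = ∑' n : ℕ, {b : ℕ∞ | (n : ℕ∞) < b}.indicator (fun _ => (1 : ℝ≥0∞)) a := by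
  induction a with
  | top => simp
  | coe k =>
    rw [tsum_eq_sum (s := Finset.range k)]
    · rw [Finset.sum_congr rfl (g := fun _ => 1)]
      · simp
      · intro n hn
        rw [Set.indicator_of_mem]
        simpa using hn
    · intro n hn
      rw [Set.indicator_of_notMem]
      simpa using hn

/-- The mean length of the first component is the sum of the tails. -/
theorem lintegral_firstLength (L : Measure (Equiv.Perm ℕ+)) :
    ∫⁻ σ, (firstLength σ).toENNReal ∂L = ∑' n : ℕ, L {σ | (n : ℕ∞) < firstLength σ} := by
  simp_rw [toENNReal_eq_tsum]
  rw [lintegral_tsum]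
  · refine tsum_congr fun n => ?_
    rw [← lintegral_indicator_one (measurableSet_lt_firstLength n)]
    rfl
  · intro n
    have h : Measurable ({b : ℕ∞ | (n : ℕ∞) < b}.indicator fun _ => (1 : ℝ≥0∞)) :=
      measurable_of_countable _
    exact (h.comp measurable_firstLength).aemeasurable

/-- The renewal theorem, when the splitting probabilities are known to converge: the limit may be
taken in the identity `∑ u_{n - l} ℙ(Y₁ > l) = 1`, in which the sum over `l` of the tails
`ℙ(Y₁ > l)` is the mean. -/
theorem Regenerates.tendsto_eq_inv (hL : Regenerates L) {c : ℝ≥0∞}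
    (hc : Tendsto (fun n => L {σ | SplitsAt σ n}) atTop (𝓝 c)) :
    c = (∫⁻ σ, (PShift.firstLength σ).toENNReal ∂L)⁻¹ := by
  rw [lintegral_firstLength]
  set r : ℕ → ℝ≥0∞ := fun n => L {σ | (n : ℕ∞) < PShift.firstLength σ} with hr
  set u : ℕ → ℝ≥0∞ := fun n => L {σ | SplitsAt σ n} with hu
  have hr1 : ∀ n, r n ≤ 1 := fun n => prob_le_one
  have hu1 : ∀ n, u n ≤ 1 := fun n => prob_le_one
  have hsum : ∀ n, ∑ l ∈ Finset.range (n + 1), u (n - l) * r l = 1 := by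
    intro n
    rw [← hL.sum_splitsAt_mul n, ← Finset.Nat.sum_antidiagonal_swap,
      Finset.Nat.sum_antidiagonal_eq_sum_range_succ_mk]
    rfl
  have hlim : ∀ N : ℕ, Tendsto (fun n => ∑ l ∈ Finset.range N, u (n - l) * r l) atTop
      (𝓝 (∑ l ∈ Finset.range N, c * r l)) := by
    intro N
    refine tendsto_finsetSum _ fun l _ => ?_
    refine ENNReal.Tendsto.mul_const ?_ (Or.inr (ne_top_of_le_ne_top ENNReal.one_ne_top (hr1 l)))
    exact hc.comp (tendsto_sub_atTop_nat l)
  have hle : c * ∑' l, r l ≤ 1 := by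
    rw [← ENNReal.tsum_mul_left]
    refine ENNReal.tsum_le_of_sum_range_le fun N => ?_
    refine le_of_tendsto (hlim N) ?_
    filter_upwards [eventually_ge_atTop N] with n hn
    rw [← hsum n]
    exact Finset.sum_le_sum_of_subset (Finset.range_mono (by omega))
  have hr0 : (∑' l, r l) ≠ 0 := by
    have h1 : r 0 ≤ ∑' l, r l := ENNReal.le_tsum 0
    have h2 := hsum 0
    simp only [zero_add, Finset.sum_range_one] at h2
    have h3 : u 0 = 1 := measure_splitsAt_zero
    rw [h3, one_mul] at h2
    rw [h2] at h1
    exact (one_pos.trans_le h1).ne'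
  by_cases ht : (∑' l, r l) = ∞
  · rw [ht] at hle ⊢
    rw [ENNReal.inv_top]
    by_contra h
    rw [ENNReal.mul_top h] at hle
    simp at hle
  · have hge : 1 ≤ c * ∑' l, r l := by
      have h1 : ∀ N, 1 ≤ c * (∑' l, r l) + ∑' l, r (l + N) := by
        intro N
        have h2 : 1 ≤ ∑ l ∈ Finset.range N, c * r l + ∑' l, r (l + N) := by
          refine ge_of_tendsto ((hlim N).add_const _) ?_
          filter_upwards [eventually_ge_atTop N] with n hn
          rw [← hsum n, ← Finset.sum_range_add_sum_Ico _ (by omega : N ≤ n + 1)]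
          gcongr
          rw [Finset.sum_Ico_eq_sum_range]
          refine le_trans ?_ (ENNReal.sum_le_tsum (Finset.range (n + 1 - N)))
          refine Finset.sum_le_sum fun l _ => ?_
          rw [add_comm N l]
          exact mul_le_of_le_one_left zero_le (hu1 _)
        refine h2.trans ?_
        gcongr
        rw [← ENNReal.tsum_mul_left]
        exact ENNReal.sum_le_tsum _
      have h3 := (ENNReal.tendsto_sum_nat_add r ht).const_add (c * ∑' l, r l)
      rw [add_zero] at h3
      exact ge_of_tendsto' h3 h1
    exact ENNReal.eq_inv_of_mul_eq_one_left (le_antisymm hle hge)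

/-! ### Infinite products -/

/-- The Weierstrass product inequality. -/
theorem one_sub_sum_le_prod {ι : Type*} (s : Finset ι) (a : ι → ℝ≥0∞) :
    1 - ∑ i ∈ s, a i ≤ ∏ i ∈ s, (1 - a i) := by
  classical
  induction s using Finset.induction_on with
  | empty => simp
  | insert i s hi ih =>
    rw [Finset.sum_insert hi, Finset.prod_insert hi]
    calc 1 - (a i + ∑ j ∈ s, a j) = (1 - ∑ j ∈ s, a j) - a i := by rw [tsub_add_eq_tsub_tsub_swap]
      _ ≤ (1 - ∑ j ∈ s, a j) - a i * (1 - ∑ j ∈ s, a j) :=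
        tsub_le_tsub_left (mul_le_of_le_one_right zero_le tsub_le_self) _
      _ = (1 - a i) * (1 - ∑ j ∈ s, a j) := by
        rw [ENNReal.sub_mul, one_mul]
        exact fun _ _ => ne_top_of_le_ne_top ENNReal.one_ne_top tsub_le_self
      _ ≤ _ := by gcongr

theorem prod_mul_one_add_sum_le {ι : Type*} (s : Finset ι) (a : ι → ℝ≥0∞) (ha : ∀ i, a i ≤ 1) :
    (∏ i ∈ s, (1 - a i)) * (1 + ∑ i ∈ s, a i) ≤ 1 := by
  classical
  induction s using Finset.induction_on with
  | empty => simp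
  | insert i s hi ih =>
    rw [Finset.sum_insert hi, Finset.prod_insert hi]
    refine le_trans ?_ ih
    rw [mul_comm (1 - a i), mul_assoc]
    gcongr
    calc (1 - a i) * (1 + (a i + ∑ j ∈ s, a j))
        = (1 - a i) * (1 + ∑ j ∈ s, a j) + (1 - a i) * a i := by ring
      _ ≤ (1 - a i) * (1 + ∑ j ∈ s, a j) + a i * (1 + ∑ j ∈ s, a j) := by
        refine add_le_add le_rfl ?_
        refine (mul_le_of_le_one_left (zero_le (a := a i)) tsub_le_self).trans ?_
        exact le_mul_of_one_le_right zero_le le_self_add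
      _ = 1 + ∑ j ∈ s, a j := by
        rw [← add_mul, tsub_add_cancel_of_le (ha i), one_mul]

theorem one_sub_toMeasure_Ioi (p : PMF ℕ+) (j : ℕ+) :
    1 - p.toMeasure (Set.Ioi j) = ∑ i ∈ Finset.Icc 1 (j : ℕ), weight p i := by
  rw [← toMeasure_setOf_le, ← prob_compl_eq_one_sub MeasurableSet.of_discrete]
  congr 1
  ext k
  simp

theorem prod_sum_weight (p : PMF ℕ+) (n : ℕ) :
    ∏ j ∈ Finset.Icc 1 n, ∑ i ∈ Finset.Icc 1 j, weight p i
      = ∏ j ∈ box n, (1 - p.toMeasure (Set.Ioi j)) := by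
  rw [prod_box, prod_Icc_one]
  refine Finset.prod_congr rfl fun j _ => ?_
  rw [one_sub_toMeasure_Ioi, Nat.succPNat_coe]

/-- The mean of `p` as a sum of tails, the term `ℙ(X > 0) = 1` being set apart. -/
theorem tsum_mul_eq_tsum_toMeasure_Ioi (p : PMF ℕ+) :
    ∑' i : ℕ+, ((i : ℕ) : ℝ≥0∞) * p i = 1 + ∑' j : ℕ+, p.toMeasure (Set.Ioi j) := by
  have h1 : ∀ j : ℕ+, p.toMeasure (Set.Ioi j) = ∑' i : ℕ+, if j < i then p i else 0 := by
    intro j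
    rw [PMF.toMeasure_apply _ MeasurableSet.of_discrete]
    refine tsum_congr fun i => ?_
    simp [Set.indicator_apply]
  simp_rw [h1]
  rw [ENNReal.tsum_comm, ← p.tsum_coe, ← ENNReal.tsum_add]
  refine tsum_congr fun i => ?_
  have h2 : ∀ j : ℕ+, (if j < i then p i else 0) = if j ∈ Finset.Iio i then p i else 0 := by
    intro j
    simp
  simp_rw [h2]
  have h3 : ∑' j : ℕ+, (if j ∈ Finset.Iio i then p i else 0) = ∑ j ∈ Finset.Iio i, p i := by
    rw [tsum_eq_sum (s := Finset.Iio i)]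
    · exact Finset.sum_congr rfl fun j hj => if_pos hj
    · exact fun j hj => if_neg hj
  have h4 : (Finset.Iio i).card + 1 = i := by
    have h := card_image_shiftMap (fun _ => 1) i
    rwa [Finset.card_image_of_injective _ (shiftMap_injective _)] at h
  rw [h3, Finset.sum_const, nsmul_eq_mul]
  conv_lhs => rw [← h4]
  push_cast
  ring

/-- Products of factors in `[0, 1]` decrease, so that they converge unconditionally. -/
theorem hasProd_one_sub (a : ℕ+ → ℝ≥0∞) :
    HasProd (fun j => 1 - a j) (⨅ n, ∏ j ∈ box n, (1 - a j)) := by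
  have h1 : Antitone fun s : Finset ℕ+ => ∏ j ∈ s, (1 - a j) := fun s t hst =>
    Finset.prod_le_prod_of_subset_of_le_one' hst fun j _ _ => tsub_le_self
  have h2 : ⨅ n, ∏ j ∈ box n, (1 - a j) = ⨅ s : Finset ℕ+, ∏ j ∈ s, (1 - a j) := by
    refine le_antisymm (le_iInf fun s => ?_) (le_iInf fun n => iInf_le _ _)
    obtain ⟨n, hn⟩ : ∃ n, s ⊆ box n :=
      ⟨s.sup fun i => (i : ℕ), fun i hi => mem_box.2 (Finset.le_sup (f := fun i : ℕ+ => (i : ℕ)) hi)⟩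
    exact (iInf_le _ n).trans (h1 hn)
  rw [h2]
  exact tendsto_atTop_iInf h1

theorem antitone_prod_box (a : ℕ+ → ℝ≥0∞) : Antitone fun n => ∏ j ∈ box n, (1 - a j) :=
  fun _ _ h => Finset.prod_le_prod_of_subset_of_le_one'
    (fun _ hi => mem_box.2 ((mem_box.1 hi).trans h)) fun _ _ _ => tsub_le_self

theorem iInf_prod_ne_zero {a : ℕ+ → ℝ≥0∞} (ha : ∀ j, a j < 1) (hs : ∑' j, a j ≠ ∞) :
    ⨅ n, ∏ j ∈ box n, (1 - a j) ≠ 0 := by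
  classical
  have h1 := (ENNReal.tendsto_tsum_compl_atTop_zero hs).eventually
    (gt_mem_nhds (by norm_num : (0 : ℝ≥0∞) < 2⁻¹))
  obtain ⟨s, hs'⟩ := h1.exists
  have h2 : ∀ n, (∏ j ∈ s, (1 - a j)) * (2⁻¹) ≤ ∏ j ∈ box n, (1 - a j) := by
    intro n
    calc (∏ j ∈ s, (1 - a j)) * (2⁻¹)
        ≤ (∏ j ∈ s, (1 - a j)) * ∏ j ∈ box n \ s, (1 - a j) := by
          gcongr
          refine le_trans ?_ (one_sub_sum_le_prod _ _)
          have h3 : ∑ j ∈ box n \ s, a j ≤ 2⁻¹ := by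
            refine le_trans ?_ hs'.le
            rw [show (∑' b : {x // x ∉ s}, a b) = ∑' x, {x | x ∉ s}.indicator a x from
              tsum_subtype {x | x ∉ s} a]
            refine le_trans (le_of_eq ?_) (ENNReal.sum_le_tsum (box n \ s))
            refine Finset.sum_congr rfl fun j hj => ?_
            rw [Set.indicator_of_mem]
            exact (Finset.mem_sdiff.1 hj).2
          calc (2⁻¹ : ℝ≥0∞) = 1 - 2⁻¹ := ENNReal.one_sub_inv_two.symm
            _ ≤ _ := tsub_le_tsub_left h3 1
      _ = ∏ j ∈ s ∪ (box n \ s), (1 - a j) := by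
          rw [Finset.prod_union Finset.disjoint_sdiff]
      _ ≤ ∏ j ∈ box n, (1 - a j) :=
          Finset.prod_le_prod_of_subset_of_le_one' (by simp)
            fun j _ _ => tsub_le_self
  have h3 := le_iInf h2
  refine (lt_of_lt_of_le ?_ h3).ne'
  refine ENNReal.mul_pos ?_ (by norm_num)
  rw [Finset.prod_ne_zero_iff]
  exact fun j _ => (tsub_pos_of_lt (ha j)).ne'

theorem iInf_prod_eq_zero {a : ℕ+ → ℝ≥0∞} (ha : ∀ j, a j ≤ 1) (hs : ∑' j, a j = ∞) :
    ⨅ n, ∏ j ∈ box n, (1 - a j) = 0 := by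
  have h1 : (⨅ n, ∏ j ∈ box n, (1 - a j)) * ∑' j, a j ≤ 1 := by
    rw [← ENNReal.tsum_mul_left]
    refine ENNReal.summable.tsum_le_of_sum_le fun s => ?_
    obtain ⟨n, hn⟩ : ∃ n, s ⊆ box n :=
      ⟨s.sup fun i => (i : ℕ), fun i hi => mem_box.2 (Finset.le_sup (f := fun i : ℕ+ => (i : ℕ)) hi)⟩
    rw [← Finset.mul_sum]
    refine le_trans ?_ (prod_mul_one_add_sum_le (box n) a ha)
    gcongr
    · exact iInf_le _ n
    · exact (Finset.sum_le_sum_of_subset hn).trans le_add_self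
  by_contra h
  rw [hs, ENNReal.mul_top h] at h1
  simp at h1

/-! ### The mean of `p` and the mean length of the first component -/

theorem tendsto_permLaw_splitsAt (p : PMF ℕ+) (hp : 0 < p 1) :
    Tendsto (fun n => permLaw p {σ | SplitsAt σ n}) atTop
      (𝓝 (⨅ n, ∏ j ∈ box n, (1 - p.toMeasure (Set.Ioi j)))) := by
  simp_rw [permLaw_splitsAt p hp, prod_sum_weight]
  exact tendsto_atTop_iInf (antitone_prod_box _)

/-- The inverse mean of the first component as an infinite product. No finiteness is assumed: both
sides are `0` if the mean is infinite. -/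
theorem iInf_prod_eq_inv_mean (p : PMF ℕ+) (hp : 0 < p 1) :
    ⨅ n, ∏ j ∈ box n, (1 - p.toMeasure (Set.Ioi j))
      = (∫⁻ σ, (firstLength σ).toENNReal ∂(permLaw p))⁻¹ :=
  (regenerates_permLaw p hp).tendsto_eq_inv (tendsto_permLaw_splitsAt p hp)

theorem toMeasure_Ioi_lt_one (p : PMF ℕ+) (hp : 0 < p 1) (j : ℕ+) :
    p.toMeasure (Set.Ioi j) < 1 := by
  have h1 : p.toMeasure (Set.Ioi j) ≤ p.toMeasure {1}ᶜ := by
    refine measure_mono fun k hk => ?_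
    have h2 : (1 : ℕ+) < k := lt_of_le_of_lt one_le hk
    exact h2.ne'
  refine h1.trans_lt ?_
  rw [prob_compl_eq_one_sub (measurableSet_singleton _),
    PMF.toMeasure_apply_singleton _ _ (measurableSet_singleton _)]
  exact ENNReal.sub_lt_self ENNReal.one_ne_top one_ne_zero hp.ne'

/-- The product in `iInf_prod_eq_inv_mean` is positive iff the tails of `p` are summable, all factors
being positive as `p 1 > 0`. -/
theorem mean_firstLength_lt_top_iff (p : PMF ℕ+) (hp : 0 < p 1) :
    ∫⁻ σ, (firstLength σ).toENNReal ∂(permLaw p) < ∞ ↔ ∑' i : ℕ+, ((i : ℕ) : ℝ≥0∞) * p i < ∞ := by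
  rw [tsum_mul_eq_tsum_toMeasure_Ioi]
  constructor
  · intro h
    by_contra h1
    have h2 : ∑' j : ℕ+, p.toMeasure (Set.Ioi j) = ∞ := by
      simpa using h1
    have h3 := iInf_prod_eq_zero (fun j => (toMeasure_Ioi_lt_one p hp j).le) h2
    rw [iInf_prod_eq_inv_mean p hp, ENNReal.inv_eq_zero] at h3
    exact h.ne h3
  · intro h
    have h1 : ∑' j : ℕ+, p.toMeasure (Set.Ioi j) ≠ ∞ :=
      ne_top_of_le_ne_top h.ne le_add_self
    have h2 := iInf_prod_ne_zero (toMeasure_Ioi_lt_one p hp) h1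
    rw [iInf_prod_eq_inv_mean p hp] at h2
    exact lt_top_iff_ne_top.2 (ENNReal.inv_ne_zero.1 h2)

end Limit

/-! ### Cycles and blocks -/

section Cycles

/-- The cycle of `i`. -/
def orbit (σ : Equiv.Perm ℕ+) (i : ℕ+) : Set ℕ+ := {k | σ.SameCycle i k}

theorem self_mem_orbit (σ : Equiv.Perm ℕ+) (i : ℕ+) : i ∈ orbit σ i := Equiv.Perm.SameCycle.rfl

theorem orbit_eq_of_mem {σ : Equiv.Perm ℕ+} {i k : ℕ+} (h : k ∈ orbit σ i) :
    orbit σ k = orbit σ i := by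
  have h' : σ.SameCycle i k := h
  ext l
  exact ⟨fun h1 => h'.trans h1, fun h1 => h'.symm.trans h1⟩

/-- A cycle contained in `[n]` is determined by the first `n` values of the permutation. -/
theorem orbit_congr {σ τ : Equiv.Perm ℕ+} {n : ℕ} (h : ∀ i : ℕ+, (i : ℕ) ≤ n → σ i = τ i) {i : ℕ+}
    (hi : ∀ k ∈ orbit σ i, (k : ℕ) ≤ n) : orbit σ i = orbit τ i := by
  have key : ∀ m : ℤ, (σ ^ m) i = (τ ^ m) i := by
    intro m
    induction m using Int.induction_on with
    | zero => simp
    | succ m ih =>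
      rw [add_comm, zpow_one_add, zpow_one_add, Equiv.Perm.mul_apply, Equiv.Perm.mul_apply, ← ih]
      exact h _ (hi _ ⟨m, rfl⟩)
    | pred m ih =>
      rw [sub_eq_add_neg, add_comm, zpow_add, zpow_add, zpow_neg_one, zpow_neg_one,
        Equiv.Perm.mul_apply, Equiv.Perm.mul_apply, ← ih, eq_comm, Equiv.Perm.inv_eq_iff_eq]
      have h1 : σ⁻¹ ((σ ^ (-(m : ℤ))) i) ∈ orbit σ i := by
        refine ⟨-1 + -(m : ℤ), ?_⟩
        rw [zpow_add, zpow_neg_one, Equiv.Perm.mul_apply]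
      rw [← h _ (hi _ h1), Equiv.Perm.coe_inv, Equiv.apply_symm_apply]
  ext k
  exact exists_congr fun m => by rw [key m]

/-- The cycles of length `j` contained in `[n]`. -/
def blockCycles (σ : Equiv.Perm ℕ+) (n j : ℕ) : Set (Set ℕ+) :=
  {c : Set ℕ+ | c ∈ cycles σ ∧ c.encard = j ∧ ∀ i ∈ c, (i : ℕ) ≤ n}

/-- The cycles of length `j` whose least element is in `[n]`. -/
def leastCycles (σ : Equiv.Perm ℕ+) (n j : ℕ) : Set (Set ℕ+) :=
  {c : Set ℕ+ | c ∈ cycles σ ∧ c.encard = j ∧ ∃ i, IsLeast c i ∧ (i : ℕ) ≤ n}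

theorem cycleCount_eq (σ : Equiv.Perm ℕ+) (n j : ℕ) : cycleCount σ n j = (blockCycles σ n j).ncard :=
  rfl

theorem cycleCountLeast_eq (σ : Equiv.Perm ℕ+) (n j : ℕ) :
    cycleCountLeast σ n j = (leastCycles σ n j).ncard := rfl

theorem blockCycles_congr {σ τ : Equiv.Perm ℕ+} {n : ℕ}
    (h : ∀ i : ℕ+, (i : ℕ) ≤ n → σ i = τ i) (j : ℕ) : blockCycles σ n j = blockCycles τ n j := by
  have key : ∀ σ τ : Equiv.Perm ℕ+, (∀ i : ℕ+, (i : ℕ) ≤ n → σ i = τ i) →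
      blockCycles σ n j ⊆ blockCycles τ n j := by
    rintro σ τ h _ ⟨⟨i, rfl⟩, h1, h2⟩
    exact ⟨⟨i, (orbit_congr h h2).symm⟩, h1, h2⟩
  exact Set.Subset.antisymm (key σ τ h) (key τ σ fun i hi => (h i hi).symm)

theorem cycleCount_congr {σ τ : Equiv.Perm ℕ+} {n : ℕ}
    (h : ∀ i : ℕ+, (i : ℕ) ≤ n → σ i = τ i) (j : ℕ) : cycleCount σ n j = cycleCount τ n j := by
  rw [cycleCount_eq, cycleCount_eq, blockCycles_congr h]

theorem measurable_cycleCount (n j : ℕ) : Measurable fun σ => cycleCount σ n j :=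
  measurable_of_determined_perm n fun _ _ h => cycleCount_congr h j

theorem leastCycles_subset (σ : Equiv.Perm ℕ+) (n j : ℕ) :
    leastCycles σ n j ⊆ orbit σ '' {i | (i : ℕ) ≤ n} := by
  rintro _ ⟨⟨i, rfl⟩, _, k, hk, hkn⟩
  exact ⟨k, hkn, orbit_eq_of_mem hk.1⟩

theorem leastCycles_finite (σ : Equiv.Perm ℕ+) (n j : ℕ) : (leastCycles σ n j).Finite :=
  ((finite_setOf_le n).image _).subset (leastCycles_subset σ n j)

theorem blockCycles_subset_leastCycles (σ : Equiv.Perm ℕ+) (n j : ℕ) :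
    blockCycles σ n j ⊆ leastCycles σ n j := by
  rintro _ ⟨⟨i, rfl⟩, h1, h2⟩
  have hne : (orbit σ i).Nonempty := ⟨i, self_mem_orbit σ i⟩
  have hl : IsLeast (orbit σ i) (WellFounded.min wellFounded_lt (orbit σ i) hne) :=
    ⟨WellFounded.min_mem _ _ _, fun k hk => not_lt.1 (WellFounded.not_lt_min _ _ hk)⟩
  exact ⟨⟨i, rfl⟩, h1, _, hl, h2 _ hl.1⟩

theorem blockCycles_finite (σ : Equiv.Perm ℕ+) (n j : ℕ) : (blockCycles σ n j).Finite :=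
  (leastCycles_finite σ n j).subset (blockCycles_subset_leastCycles σ n j)

theorem monotone_cycleCount (σ : Equiv.Perm ℕ+) (j : ℕ) : Monotone fun n => cycleCount σ n j :=
  fun _ m h => Set.ncard_le_ncard (fun _ hc => ⟨hc.1, hc.2.1, fun i hi => (hc.2.2 i hi).trans h⟩)
    (blockCycles_finite σ m j)

theorem monotone_cycleCountLeast (σ : Equiv.Perm ℕ+) (j : ℕ) :
    Monotone fun n => cycleCountLeast σ n j :=
  fun _ m h => Set.ncard_le_ncard
    (fun _ hc => ⟨hc.1, hc.2.1, hc.2.2.imp fun _ hi => ⟨hi.1, hi.2.trans h⟩⟩)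
    (leastCycles_finite σ m j)

theorem SplitsAt.zpow_lt_iff {σ : Equiv.Perm ℕ+} {n : ℕ} (h : SplitsAt σ n) (m : ℤ) (i : ℕ+) :
    n < ((σ ^ m) i : ℕ) ↔ n < (i : ℕ) := by
  induction m using Int.induction_on with
  | zero => simp
  | succ m ih => rw [add_comm, zpow_one_add, Equiv.Perm.mul_apply, h.lt_iff, ih]
  | pred m ih =>
    rw [← ih, ← h.lt_iff, sub_eq_add_neg, add_comm, zpow_add, zpow_neg_one, Equiv.Perm.mul_apply,
      Equiv.Perm.coe_inv, Equiv.apply_symm_apply]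

theorem SplitsAt.le_iff_of_mem_orbit {σ : Equiv.Perm ℕ+} {n : ℕ} (h : SplitsAt σ n) {i k : ℕ+}
    (hk : k ∈ orbit σ i) : (k : ℕ) ≤ n ↔ (i : ℕ) ≤ n := by
  obtain ⟨m, rfl⟩ := hk
  have := h.zpow_lt_iff m i
  omega

theorem leastCycles_eq_of_splitsAt {σ : Equiv.Perm ℕ+} {n : ℕ} (h : SplitsAt σ n) (j : ℕ) :
    leastCycles σ n j = blockCycles σ n j := by
  refine Set.Subset.antisymm ?_ (blockCycles_subset_leastCycles σ n j)
  rintro _ ⟨⟨i, rfl⟩, h1, k, hk, hkn⟩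
  refine ⟨⟨i, rfl⟩, h1, fun l hl => ?_⟩
  rw [h.le_iff_of_mem_orbit hl, ← h.le_iff_of_mem_orbit hk.1]
  exact hkn

theorem cycleCountLeast_eq_of_splitsAt {σ : Equiv.Perm ℕ+} {n : ℕ} (h : SplitsAt σ n) (j : ℕ) :
    cycleCountLeast σ n j = cycleCount σ n j := by
  rw [cycleCount_eq, cycleCountLeast_eq, leastCycles_eq_of_splitsAt h]

/-- The cycles of `σ` outside a block `[n]` are the translates of those of the residual permutation. -/
theorem orbit_addNat {σ : Equiv.Perm ℕ+} {n : ℕ} (h : SplitsAt σ n) (i : ℕ+) :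
    orbit σ (addNat n i) = addNat n '' orbit (residual n σ) i := by
  have key : ∀ m : ℤ, (σ ^ m) (addNat n i) = addNat n (((residual n σ) ^ m) i) := by
    intro m
    induction m using Int.induction_on with
    | zero => simp
    | succ m ih =>
      rw [add_comm, zpow_one_add, zpow_one_add, Equiv.Perm.mul_apply, Equiv.Perm.mul_apply, ih,
        residual_addNat h]
    | pred m ih =>
      rw [sub_eq_add_neg, add_comm, zpow_add, zpow_add, zpow_neg_one, zpow_neg_one,
        Equiv.Perm.mul_apply, Equiv.Perm.mul_apply, ih, Equiv.Perm.inv_eq_iff_eq,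
        ← residual_addNat h, Equiv.Perm.coe_inv, Equiv.apply_symm_apply]
  ext k
  constructor
  · rintro ⟨m, rfl⟩
    exact ⟨_, ⟨m, rfl⟩, (key m).symm⟩
  · rintro ⟨_, ⟨m, rfl⟩, rfl⟩
    exact ⟨m, key m⟩

/-- The cycle counts of successive blocks add up. -/
theorem cycleCount_add {σ : Equiv.Perm ℕ+} {n : ℕ} (h : SplitsAt σ n) (k j : ℕ) :
    cycleCount σ (n + k) j = cycleCount σ n j + cycleCount (residual n σ) k j := by
  have hinj : Function.Injective (Set.image (addNat n)) :=
    Set.image_injective.2 (addNat_injective n)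
  have h1 : blockCycles σ (n + k) j
      = blockCycles σ n j ∪ Set.image (addNat n) '' blockCycles (residual n σ) k j := by
    ext c
    constructor
    · rintro ⟨⟨i, rfl⟩, h1, h2⟩
      rcases le_or_gt (i : ℕ) n with h3 | h3
      · exact Or.inl ⟨⟨i, rfl⟩, h1, fun l hl => (h.le_iff_of_mem_orbit hl).2 h3⟩
      · obtain ⟨l, rfl⟩ := exists_addNat h3
        change (orbit σ (addNat n l)).encard = j at h1
        change ∀ i ∈ orbit σ (addNat n l), _ at h2
        rw [orbit_addNat h] at h1 h2
        rw [(addNat_injective n).encard_image] at h1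
        refine Or.inr ⟨orbit (residual n σ) l, ⟨⟨l, rfl⟩, h1, fun q hq => ?_⟩,
          (orbit_addNat h l).symm⟩
        have h4 := h2 _ ⟨q, hq, rfl⟩
        rw [coe_addNat] at h4
        omega
    · rintro (⟨h1, h2, h3⟩ | ⟨_, ⟨⟨i, rfl⟩, h1, h2⟩, rfl⟩)
      · exact ⟨h1, h2, fun i hi => (h3 i hi).trans (by omega)⟩
      · refine ⟨⟨addNat n i, orbit_addNat h i⟩, ?_, ?_⟩
        · rw [(addNat_injective n).encard_image]
          exact h1
        · rintro _ ⟨q, hq, rfl⟩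
          have := h2 q hq
          rw [coe_addNat]
          omega
  have h2 : Disjoint (blockCycles σ n j)
      (Set.image (addNat n) '' blockCycles (residual n σ) k j) := by
    refine Set.disjoint_left.2 ?_
    rintro _ ⟨_, _, h2⟩ ⟨_, ⟨⟨i, rfl⟩, _, _⟩, rfl⟩
    have h3 := h2 _ ⟨i, self_mem_orbit _ i, rfl⟩
    have := i.pos
    rw [coe_addNat] at h3
    omega
  rw [cycleCount_eq, h1, Set.ncard_union_eq h2 (blockCycles_finite σ n j)
    ((blockCycles_finite _ k j).image _), Set.ncard_image_of_injective _ hinj]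
  rfl

theorem card_box (n : ℕ) : (box n).card = n := by
  have h2 : (box n).image (fun i : ℕ+ => (i : ℕ)) = Finset.Icc 1 n := by
    ext m
    simp only [Finset.mem_image, mem_box, Finset.mem_Icc]
    constructor
    · rintro ⟨i, hi, rfl⟩
      exact ⟨i.pos, hi⟩
    · rintro ⟨h1, h2⟩
      exact ⟨⟨m, h1⟩, h2, rfl⟩
  rw [← Finset.card_image_of_injective (f := fun i : ℕ+ => (i : ℕ)) _ PNat.coe_injective, h2]
  simp

/-- The cycles contained in a block `[n]` partition it. -/
theorem sum_mul_cycleCount {σ : Equiv.Perm ℕ+} {n : ℕ} (h : SplitsAt σ n) :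
    ∑ j ∈ Finset.range (n + 1), j * cycleCount σ n j = n := by
  classical
  have hsub : ∀ i : ℕ+, (i : ℕ) ≤ n → orbit σ i ⊆ {k : ℕ+ | (k : ℕ) ≤ n} :=
    fun i hi k hk => (h.le_iff_of_mem_orbit hk).2 hi
  have hmaps : ∀ i ∈ box n, (orbit σ i).ncard ∈ Finset.range (n + 1) := by
    intro i hi
    rw [mem_box] at hi
    have h1 := Set.ncard_le_ncard (hsub i hi) (finite_setOf_le n)
    have h2 : {k : ℕ+ | (k : ℕ) ≤ n}.ncard = n := by
      rw [Set.ncard_eq_toFinset_card _ (finite_setOf_le n)]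
      exact card_box n
    rw [Finset.mem_range]
    omega
  conv_rhs => rw [← card_box n, Finset.card_eq_sum_card_fiberwise hmaps]
  refine Finset.sum_congr rfl fun j _ => ?_
  have h3 : blockCycles σ n j = ((box n).filter fun i => (orbit σ i).ncard = j).image (orbit σ) := by
    ext c
    simp only [Finset.coe_image, Finset.coe_filter, mem_box, Set.mem_image, Set.mem_ofPred_eq]
    constructor
    · rintro ⟨⟨i, rfl⟩, h1, h2⟩
      refine ⟨i, ⟨h2 i (self_mem_orbit σ i), ?_⟩, rfl⟩
      rw [Set.ncard, show (orbit σ i).encard = j from h1, ENat.toNat_natCast]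
    · rintro ⟨i, ⟨h1, h2⟩, rfl⟩
      refine ⟨⟨i, rfl⟩, ?_, hsub i h1⟩
      rw [← h2, ((finite_setOf_le n).subset (hsub i h1)).cast_ncard_eq]
  have h4 : ∀ c ∈ ((box n).filter fun i => (orbit σ i).ncard = j).image (orbit σ),
      (((box n).filter fun i => (orbit σ i).ncard = j).filter fun i => orbit σ i = c).card = j := by
    intro c hc
    obtain ⟨i, hi, rfl⟩ := Finset.mem_image.1 hc
    rw [Finset.mem_filter, mem_box] at hi
    rw [← hi.2, ← Set.ncard_coe_finset]
    congr 1
    ext k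
    simp only [Finset.coe_filter, Finset.mem_filter, mem_box, Set.mem_ofPred_eq]
    constructor
    · rintro ⟨_, h5⟩
      rw [← h5]
      exact self_mem_orbit σ k
    · intro hk
      have h5 := orbit_eq_of_mem hk
      exact ⟨⟨hsub i hi.1 hk, by rw [h5]⟩, h5⟩
  rw [Finset.card_eq_sum_card_image (orbit σ), Finset.sum_congr rfl h4, Finset.sum_const,
    smul_eq_mul, cycleCount_eq, h3, Set.ncard_coe_finset, mul_comm]

theorem mul_cycleCount_le {σ : Equiv.Perm ℕ+} {n : ℕ} (h : SplitsAt σ n) (j : ℕ) :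
    j * cycleCount σ n j ≤ n := by
  rcases le_or_gt j n with hj | hj
  · conv_rhs => rw [← sum_mul_cycleCount h]
    exact Finset.single_le_sum (f := fun j => j * cycleCount σ n j) (fun _ _ => Nat.zero_le _)
      (Finset.mem_range.2 (by omega))
  · have h1 : blockCycles σ n j = ∅ := by
      ext c
      simp only [Set.mem_empty_iff_false, iff_false]
      rintro ⟨_, h1, h2⟩
      have h3 := Set.encard_le_encard (show c ⊆ (box n : Set ℕ+) from fun i hi => by
        simpa using h2 i hi)
      rw [h1, Set.encard_coe_eq_coe_finsetCard, card_box, Nat.cast_le] at h3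
      omega
    rw [cycleCount_eq, h1, Set.ncard_empty]
    omega

theorem tsum_mul_cycleCount {σ : Equiv.Perm ℕ+} {n : ℕ} (h : SplitsAt σ n) :
    ∑' j : ℕ, (j : ℝ≥0∞) * (cycleCount σ n j : ℝ≥0∞) = n := by
  rw [tsum_eq_sum (s := Finset.range (n + 1))]
  · have h1 := sum_mul_cycleCount h
    exact_mod_cast h1
  · intro j hj
    rw [Finset.mem_range] at hj
    have h1 := mul_cycleCount_le h j
    have h2 : cycleCount σ n j = 0 := by
      by_contra h3
      have : 1 ≤ cycleCount σ n j := Nat.one_le_iff_ne_zero.2 h3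
      have := Nat.mul_le_mul_left j this
      omega
    rw [h2, Nat.cast_zero, mul_zero]

end Cycles

/-! ### The law of large numbers for cycle counts -/

section LLN

variable {L : Measure (Equiv.Perm ℕ+)}

/-- The permutation after the first component. -/
def afterFirst (σ : Equiv.Perm ℕ+) : Equiv.Perm ℕ+ := residual (firstLength σ).toNat σ

theorem measurable_comp_firstLength {F : Type*} [MeasurableSpace F]
    {g : Equiv.Perm ℕ+ → ℕ → F} (hg : ∀ n, Measurable fun σ => g σ n) :
    Measurable fun σ => g σ (firstLength σ).toNat := by
  have h1 : Measurable fun q : Equiv.Perm ℕ+ × ℕ => g q.1 q.2 :=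
    measurable_from_prod_countable_left hg
  have h2 : Measurable fun a : ℕ∞ => a.toNat := measurable_of_countable _
  exact h1.comp (measurable_id.prodMk (h2.comp measurable_firstLength))

theorem measurable_afterFirst : Measurable afterFirst :=
  measurable_comp_firstLength (g := fun σ n => residual n σ) measurable_residual

/-- A functional of the first component: its value on `{Y₁ = n}` is determined by the first `n`
values of the permutation. -/
def IsFirstBlockFun {F : Type*} (h : Equiv.Perm ℕ+ → F) : Prop :=
  ∀ n : ℕ, ∀ σ τ : Equiv.Perm ℕ+, firstLength σ = n → firstLength τ = n →
    (∀ i : ℕ+, (i : ℕ) ≤ n → σ i = τ i) → h σ = h τ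

/-- The first component is independent of the permutation after it, which is again distributed
according to `L`. -/
theorem Regenerates.inter_afterFirst (hL : Regenerates L)
    (hY : ∀ᵐ σ ∂L, PShift.firstLength σ < ⊤) {F : Type*} [MeasurableSpace F]
    {h : Equiv.Perm ℕ+ → F} (hm : Measurable h) (hh : IsFirstBlockFun h) {C : Set F}
    (hC : MeasurableSet C) {B : Set (Equiv.Perm ℕ+)} (hB : MeasurableSet B) :
    L (h ⁻¹' C ∩ afterFirst ⁻¹' B) = L (h ⁻¹' C) * L B := by
  rw [measure_eq_tsum_firstLength L ((hm hC).inter (measurable_afterFirst hB)),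
    measure_eq_tsum_firstLength L (hm hC), ← ENNReal.tsum_mul_right]
  refine tsum_congr fun a => ?_
  induction a with
  | coe n =>
    have hD : IsPrefixEvent n ({σ | PShift.firstLength σ = n} ∩ h ⁻¹' C) := by
      intro σ τ hst
      have h1 := isPrefixEvent_firstLength_eq n σ τ hst
      constructor
      · rintro ⟨h2, h3⟩
        refine ⟨h1.1 h2, ?_⟩
        change h τ ∈ C
        rw [← hh n σ τ h2 (h1.1 h2) hst]
        exact h3
      · rintro ⟨h2, h3⟩
        refine ⟨h1.2 h2, ?_⟩
        change h σ ∈ C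
        rw [hh n σ τ (h1.2 h2) h2 hst]
        exact h3
    have h2 := hL.firstLength n hD hB
    rw [← Set.inter_assoc, Set.inter_self] at h2
    rw [← h2, ← Set.inter_assoc]
    congr 1
    ext σ
    refine and_congr_right fun h3 => ?_
    have h4 : afterFirst σ = residual n σ := by
      rw [afterFirst, h3.1, ENat.toNat_natCast]
    simp only [Set.mem_preimage, h4]
  | top =>
    have h1 : L {σ | PShift.firstLength σ = ⊤} = 0 := by
      rw [ae_iff] at hY
      simpa using hY
    rw [measure_mono_null Set.inter_subset_left h1, measure_mono_null Set.inter_subset_left h1,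
      zero_mul]

theorem Regenerates.measurePreserving_afterFirst [IsProbabilityMeasure L] (hL : Regenerates L)
    (hY : ∀ᵐ σ ∂L, PShift.firstLength σ < ⊤) : MeasurePreserving afterFirst L L := by
  refine ⟨measurable_afterFirst, ?_⟩
  ext B hB
  have h := hL.inter_afterFirst hY (h := fun _ => ()) measurable_const (fun _ _ _ _ _ _ => rfl)
    (C := Set.univ) MeasurableSet.univ hB
  rw [Set.preimage_univ, Set.univ_inter, measure_univ, one_mul] at h
  rw [Measure.map_apply measurable_afterFirst hB, h]

/-- The law of large numbers for a functional of the successive components. -/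
theorem Regenerates.ae_tendsto_average [IsProbabilityMeasure L] (hL : Regenerates L)
    (hY : ∀ᵐ σ ∂L, PShift.firstLength σ < ⊤) {h : Equiv.Perm ℕ+ → ℝ} (hm : Measurable h)
    (hh : IsFirstBlockFun h) (hi : Integrable h L) :
    ∀ᵐ σ ∂L, Tendsto (fun n : ℕ => (∑ i ∈ Finset.range n, h (afterFirst^[i] σ)) / n) atTop
      (𝓝 (∫ σ, h σ ∂L)) := by
  have hmp := hL.measurePreserving_afterFirst hY
  have hmi : ∀ i, MeasurePreserving afterFirst^[i] L L := fun i => hmp.iterate i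
  -- the functionals of distinct components are pairwise independent: move component `i` to the
  -- first place, where `inter_afterFirst` applies
  have key : ∀ i d, IndepFun (fun σ => h (afterFirst^[i] σ)) (fun σ => h (afterFirst^[i + (d + 1)] σ))
      L := by
    intro i d
    rw [indepFun_iff_measure_inter_preimage_eq_mul]
    intro s t hs ht
    have ht' : MeasurableSet ((fun σ => h (afterFirst^[d] σ)) ⁻¹' t) :=
      (hm.comp (hmi d).measurable) ht
    have e1 : (fun σ => h (afterFirst^[i] σ)) ⁻¹' s ∩ (fun σ => h (afterFirst^[i + (d + 1)] σ)) ⁻¹' t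
        = afterFirst^[i] ⁻¹' (h ⁻¹' s ∩ afterFirst ⁻¹' ((fun σ => h (afterFirst^[d] σ)) ⁻¹' t)) := by
      ext σ
      simp only [Set.mem_inter_iff, Set.mem_preimage]
      rw [show i + (d + 1) = d + 1 + i by omega, Function.iterate_add_apply,
        Function.iterate_succ_apply]
    have e2 : (fun σ => h (afterFirst^[i + (d + 1)] σ)) ⁻¹' t
        = afterFirst^[i + 1] ⁻¹' ((fun σ => h (afterFirst^[d] σ)) ⁻¹' t) := by
      ext σ
      simp only [Set.mem_preimage]
      rw [show i + (d + 1) = d + (i + 1) by omega, Function.iterate_add_apply]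
    rw [e1, e2, (hmi i).measure_preimage ((hm hs).inter (measurable_afterFirst ht')).nullMeasurableSet,
      hL.inter_afterFirst hY hm hh hs ht', (hmi (i + 1)).measure_preimage ht'.nullMeasurableSet]
    congr 1
    exact ((hmi i).measure_preimage (hm hs).nullMeasurableSet).symm
  have hlaw := strong_law_ae_real (μ := L) (fun i σ => h (afterFirst^[i] σ)) hi ?_ ?_
  · exact hlaw
  · intro i j hij
    rcases lt_or_gt_of_ne hij with h1 | h1
    · obtain ⟨d, rfl⟩ := Nat.exists_eq_add_of_lt h1
      exact key i d
    · obtain ⟨d, rfl⟩ := Nat.exists_eq_add_of_lt h1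
      exact (key j d).symm
  · intro i
    refine ⟨(hm.comp (hmi i).measurable).aemeasurable, hm.aemeasurable, ?_⟩
    change L.map (h ∘ afterFirst^[i]) = L.map h
    rw [← Measure.map_map hm (hmi i).measurable, (hmi i).map_eq]

/-- The end of the `k`-th component, when the first `k` components are finite. -/
def blockEnd (σ : Equiv.Perm ℕ+) (k : ℕ) : ℕ :=
  ∑ i ∈ Finset.range k, (firstLength (afterFirst^[i] σ)).toNat

theorem blockEnd_succ (σ : Equiv.Perm ℕ+) (k : ℕ) :
    blockEnd σ (k + 1) = (firstLength σ).toNat + blockEnd (afterFirst σ) k := by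
  rw [blockEnd, Finset.sum_range_succ', add_comm]
  rfl

theorem splitsAt_firstLength {σ : Equiv.Perm ℕ+} (h : firstLength σ < ⊤) :
    SplitsAt σ (firstLength σ).toNat :=
  ((firstLength_eq_coe_iff σ _).1 (ENat.natCast_toNat h.ne).symm).1

theorem splitsAt_blockEnd {σ : Equiv.Perm ℕ+} (h : ∀ i, firstLength (afterFirst^[i] σ) < ⊤) (k : ℕ) :
    SplitsAt σ (blockEnd σ k) := by
  induction k generalizing σ with
  | zero => exact splitsAt_zero σ
  | succ k ih =>
    have h0 : firstLength σ < ⊤ := h 0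
    rw [blockEnd_succ, splitsAt_add_iff (splitsAt_firstLength h0)]
    exact ih fun i => h (i + 1)

theorem cycleCount_blockEnd {σ : Equiv.Perm ℕ+} (h : ∀ i, firstLength (afterFirst^[i] σ) < ⊤)
    (k j : ℕ) : cycleCount σ (blockEnd σ k) j = ∑ i ∈ Finset.range k,
      cycleCount (afterFirst^[i] σ) (firstLength (afterFirst^[i] σ)).toNat j := by
  induction k generalizing σ with
  | zero =>
    have h2 : blockCycles σ 0 j = ∅ := by
      ext c
      simp only [Set.mem_empty_iff_false, iff_false]
      rintro ⟨⟨i, rfl⟩, _, h2⟩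
      have := h2 i (self_mem_orbit σ i)
      have := i.pos
      omega
    simp [blockEnd, cycleCount_eq, h2]
  | succ k ih =>
    have h0 : firstLength σ < ⊤ := h 0
    rw [blockEnd_succ, cycleCount_add (splitsAt_firstLength h0), Finset.sum_range_succ',
      add_comm]
    congr 1
    exact ih fun i => h (i + 1)

/-- If `T k ~ m k` and `u (T k) ~ l k` for a monotone sequence `u`, then `u n ~ (l / m) n`. -/
theorem tendsto_div_of_subseq {u : ℕ → ℝ} (hu : Monotone u) {T : ℕ → ℕ} {m l : ℝ} (hm : 0 < m)
    (hT : Tendsto (fun k : ℕ => (T k : ℝ) / k) atTop (𝓝 m))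
    (hl : Tendsto (fun k : ℕ => u (T k) / k) atTop (𝓝 l)) :
    Tendsto (fun n : ℕ => u n / n) atTop (𝓝 (l / m)) := by
  have hTpos : ∀ᶠ k in atTop, 0 < (T k : ℝ) := by
    filter_upwards [hT.eventually (lt_mem_nhds hm), eventually_gt_atTop 0] with k hk hk0
    have h0 : (0 : ℝ) < k := by exact_mod_cast hk0
    exact (div_pos_iff_of_pos_right h0).1 hk
  refine tendsto_div_of_monotone_of_exists_subseq_tendsto_div u _ hu fun a ha => ⟨T, ?_, ?_, ?_⟩
  · have h1 : Tendsto (fun k : ℕ => (T (k + 1) : ℝ) / T k) atTop (𝓝 1) := by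
      have h2 := (((tendsto_add_atTop_iff_nat 1).2 hT).div hT hm.ne').mul
        ((tendsto_natCast_div_add_atTop (1 : ℝ)).inv₀ one_ne_zero)
      rw [div_self hm.ne', inv_one, one_mul] at h2
      refine h2.congr' ?_
      filter_upwards [hTpos, eventually_gt_atTop 0] with k h3 h4
      have h5 : (0 : ℝ) < k := by exact_mod_cast h4
      simp only [Pi.div_apply]
      push_cast
      field_simp
    filter_upwards [h1.eventually (gt_mem_nhds ha), hTpos] with k h2 h3
    exact ((div_lt_iff₀ h3).1 h2).le
  · have h1 : Tendsto (fun k : ℕ => (T k : ℝ) / k * k) atTop atTop :=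
      hT.pos_mul_atTop hm tendsto_natCast_atTop_atTop
    refine tendsto_natCast_atTop_iff (R := ℝ).1 (h1.congr' ?_)
    filter_upwards [eventually_gt_atTop 0] with k hk
    have h0 : (k : ℝ) ≠ 0 := by exact_mod_cast hk.ne'
    exact div_mul_cancel₀ _ h0
  · refine (hl.div hT hm.ne').congr' ?_
    filter_upwards [eventually_gt_atTop 0] with k hk
    have h0 : (k : ℝ) ≠ 0 := by exact_mod_cast hk.ne'
    simp only [Pi.div_apply]
    rw [div_div_div_cancel_right₀ h0]

theorem isFirstBlockFun_toNat : IsFirstBlockFun fun σ => ((firstLength σ).toNat : ℝ) := by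
  intro n σ τ h1 h2 _
  simp only [h1, h2]

theorem isFirstBlockFun_cycleCount (j : ℕ) :
    IsFirstBlockFun fun σ => (cycleCount σ (firstLength σ).toNat j : ℝ) := by
  intro n σ τ h1 h2 h
  simp only [h1, h2, ENat.toNat_natCast, cycleCount_congr h]

theorem measurable_cycleCount_firstLength (j : ℕ) :
    Measurable fun σ => cycleCount σ (firstLength σ).toNat j :=
  measurable_comp_firstLength (g := fun σ n => cycleCount σ n j) fun n => measurable_cycleCount n j

theorem ae_firstLength_lt_top (hμ : ∫⁻ σ, (firstLength σ).toENNReal ∂L ≠ ∞) :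
    ∀ᵐ σ ∂L, firstLength σ < ⊤ := by
  have hm : Measurable fun σ => (firstLength σ).toENNReal :=
    (measurable_of_countable ENat.toENNReal).comp measurable_firstLength
  filter_upwards [ae_lt_top hm hμ] with σ hσ
  rw [lt_top_iff_ne_top] at hσ ⊢
  exact fun h => hσ (by rw [h, ENat.toENNReal_top])

theorem toENNReal_eq_toNat {a : ℕ∞} (h : a < ⊤) : a.toENNReal = (a.toNat : ℝ≥0∞) := by
  obtain ⟨n, rfl⟩ := ENat.ne_top_iff_exists.1 h.ne
  simp

/-- The mean length of a component in terms of the mean numbers of cycles. -/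
theorem lintegral_firstLength_eq_tsum (hμ : ∫⁻ σ, (firstLength σ).toENNReal ∂L ≠ ∞) :
    ∫⁻ σ, (firstLength σ).toENNReal ∂L = ∑' j : ℕ, (j : ℝ≥0∞) *
      ∫⁻ σ, (cycleCount σ (firstLength σ).toNat j : ℝ≥0∞) ∂L := by
  have hm : ∀ j, Measurable fun σ => (cycleCount σ (firstLength σ).toNat j : ℝ≥0∞) :=
    fun j => (measurable_of_countable _).comp (measurable_cycleCount_firstLength j)
  simp_rw [← lintegral_const_mul _ (hm _)]
  rw [← lintegral_tsum fun j => ((hm j).const_mul _).aemeasurable]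
  refine lintegral_congr_ae ?_
  filter_upwards [ae_firstLength_lt_top hμ] with σ hσ
  rw [tsum_mul_cycleCount (splitsAt_firstLength hσ), toENNReal_eq_toNat hσ]

/-- The law of large numbers for cycle counts. The two counts agree at the ends of the components,
where the law of large numbers over the i.i.d. components gives their growth, and both are monotone
in between. -/
theorem Regenerates.ae_tendsto_cycleCount [IsProbabilityMeasure L] (hL : Regenerates L)
    (hμ : ∫⁻ σ, (PShift.firstLength σ).toENNReal ∂L ≠ ∞) :
    ∀ᵐ σ ∂L, ∀ j : ℕ, 1 ≤ j →
      Tendsto (fun n : ℕ => (cycleCount σ n j : ℝ) / n) atTop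
        (𝓝 ((∫⁻ σ, (cycleCount σ (PShift.firstLength σ).toNat j : ℝ≥0∞) ∂L) /
          ∫⁻ σ, (PShift.firstLength σ).toENNReal ∂L).toReal) ∧
      Tendsto (fun n : ℕ => (cycleCountLeast σ n j : ℝ) / n) atTop
        (𝓝 ((∫⁻ σ, (cycleCount σ (PShift.firstLength σ).toNat j : ℝ≥0∞) ∂L) /
          ∫⁻ σ, (PShift.firstLength σ).toENNReal ∂L).toReal) := by
  have hY := ae_firstLength_lt_top hμ
  have hmY : Measurable fun σ => ((PShift.firstLength σ).toNat : ℝ) :=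
    (measurable_of_countable fun a : ℕ∞ => (a.toNat : ℝ)).comp measurable_firstLength
  have hlY : ∫⁻ σ, ENNReal.ofReal ((PShift.firstLength σ).toNat : ℝ) ∂L
      = ∫⁻ σ, (PShift.firstLength σ).toENNReal ∂L := by
    refine lintegral_congr_ae ?_
    filter_upwards [hY] with σ hσ
    rw [toENNReal_eq_toNat hσ, ENNReal.ofReal_natCast]
  have hintY : ∫ σ, ((PShift.firstLength σ).toNat : ℝ) ∂L
      = (∫⁻ σ, (PShift.firstLength σ).toENNReal ∂L).toReal := by
    rw [integral_eq_lintegral_of_nonneg_ae (Eventually.of_forall fun σ => Nat.cast_nonneg _)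
      hmY.aestronglyMeasurable, hlY]
  have hiY : Integrable (fun σ => ((PShift.firstLength σ).toNat : ℝ)) L := by
    refine ⟨hmY.aestronglyMeasurable, ?_⟩
    rw [hasFiniteIntegral_iff_ofReal (Eventually.of_forall fun σ => Nat.cast_nonneg _), hlY]
    exact lt_top_iff_ne_top.2 hμ
  have hpos : 0 < (∫⁻ σ, (PShift.firstLength σ).toENNReal ∂L).toReal := by
    refine ENNReal.toReal_pos ?_ hμ
    have h1 : (1 : ℝ≥0∞) ≤ ∫⁻ σ, (PShift.firstLength σ).toENNReal ∂L := by
      rw [← measure_univ (μ := L), ← lintegral_one]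
      refine lintegral_mono fun σ => ?_
      rw [← ENat.toENNReal_one, ENat.toENNReal_le, Order.one_le_iff_pos]
      exact (lt_firstLength_iff σ 0).2 fun m hm h => by omega
    exact (one_pos.trans_le h1).ne'
  have hall : ∀ᵐ σ ∂L, ∀ i, PShift.firstLength (afterFirst^[i] σ) < ⊤ := by
    rw [ae_all_iff]
    intro i
    exact ((hL.measurePreserving_afterFirst hY).iterate i).quasiMeasurePreserving.ae hY
  have hT := hL.ae_tendsto_average hY hmY isFirstBlockFun_toNat hiY
  rw [ae_all_iff]
  intro j
  -- for `j ≥ 1` the number of cycles in a component is at most its length, hence integrable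
  by_cases hj : 1 ≤ j
  swap
  · exact Eventually.of_forall fun σ h => absurd h hj
  have hmC : Measurable fun σ => (cycleCount σ (PShift.firstLength σ).toNat j : ℝ) :=
    (measurable_of_countable fun n : ℕ => (n : ℝ)).comp (measurable_cycleCount_firstLength j)
  have hiC : Integrable (fun σ => (cycleCount σ (PShift.firstLength σ).toNat j : ℝ)) L := by
    refine hiY.mono' hmC.aestronglyMeasurable ?_
    filter_upwards [hY] with σ hσ
    rw [Real.norm_of_nonneg (Nat.cast_nonneg _), Nat.cast_le]
    exact (Nat.le_mul_of_pos_left _ hj).trans (mul_cycleCount_le (splitsAt_firstLength hσ) j)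
  have hintC : ∫ σ, (cycleCount σ (PShift.firstLength σ).toNat j : ℝ) ∂L
      = (∫⁻ σ, (cycleCount σ (PShift.firstLength σ).toNat j : ℝ≥0∞) ∂L).toReal := by
    rw [integral_eq_lintegral_of_nonneg_ae (Eventually.of_forall fun σ => Nat.cast_nonneg _)
      hmC.aestronglyMeasurable]
    simp only [ENNReal.ofReal_natCast]
  have hC := hL.ae_tendsto_average hY hmC (isFirstBlockFun_cycleCount j) hiC
  filter_upwards [hall, hT, hC] with σ h1 h2 h3 _
  rw [hintY] at h2
  rw [hintC] at h3
  have h4 : Tendsto (fun k : ℕ => (blockEnd σ k : ℝ) / k) atTop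
      (𝓝 (∫⁻ σ, (PShift.firstLength σ).toENNReal ∂L).toReal) := by
    refine h2.congr fun k => ?_
    rw [blockEnd]
    push_cast
    rfl
  have h5 : Tendsto (fun k : ℕ => (cycleCount σ (blockEnd σ k) j : ℝ) / k) atTop
      (𝓝 (∫⁻ σ, (cycleCount σ (PShift.firstLength σ).toNat j : ℝ≥0∞) ∂L).toReal) := by
    refine h3.congr fun k => ?_
    rw [cycleCount_blockEnd h1]
    push_cast
    rfl
  rw [ENNReal.toReal_div]
  constructor
  · exact tendsto_div_of_subseq (u := fun n => (cycleCount σ n j : ℝ))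
      (fun _ _ h => Nat.cast_le.2 (monotone_cycleCount σ j h)) hpos h4 h5
  · refine tendsto_div_of_subseq (u := fun n => (cycleCountLeast σ n j : ℝ))
      (fun _ _ h => Nat.cast_le.2 (monotone_cycleCountLeast σ j h)) hpos h4 (h5.congr fun k => ?_)
    rw [cycleCountLeast_eq_of_splitsAt (splitsAt_blockEnd h1 k)]

end LLN

/-! ### The two-sided construction -/

section TwoSided

/-- The terms of a two-sided sequence after `a`. -/
def future (a : ℤ) (x : ℤ → ℕ+) : ℕ+ → ℕ+ := fun i => x (a + (i : ℕ))

/-- The two-sided analogue of `Fits`: the steps up to time `a` never leave `(-∞, a]`. -/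
def FitsInt (x : ℤ → ℕ+) (a : ℤ) : Prop := ∀ i ≤ a, ((x i : ℕ) : ℤ) + i ≤ a + 1

theorem exists_eq_add {b z : ℤ} (h : b < z) : ∃ i : ℕ+, z = b + (i : ℕ) := by
  obtain ⟨n, hn⟩ := Int.eq_ofNat_of_zero_le (by omega : 0 ≤ z - b - 1)
  refine ⟨n.succPNat, ?_⟩
  rw [Nat.succPNat_coe, Nat.succ_eq_add_one]
  push_cast
  omega

theorem fitsInt_add_iff {x : ℤ → ℕ+} {a : ℤ} (h : FitsInt x a) (n : ℕ) :
    FitsInt x (a + n) ↔ Fits (future a x) n := by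
  constructor
  · intro h1 i hi
    have := h1 (a + (i : ℕ)) (by omega)
    simp only [future]
    omega
  · intro h1 i hi
    rcases le_or_gt i a with h2 | h2
    · have := h i h2
      omega
    · obtain ⟨l, rfl⟩ := exists_eq_add h2
      have := h1 l (by omega)
      simp only [future] at this
      omega

theorem fitsInt_add_of_fits {x : ℤ → ℕ+} {a : ℤ} (h : FitsInt x a) {n : ℕ}
    (hn : Fits (future a x) n) : FitsInt x (a + n) := (fitsInt_add_iff h n).2 hn

theorem fitsInt_congr {x y : ℤ → ℕ+} {a : ℤ} (h : ∀ i ≤ a, x i = y i) :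
    FitsInt x a ↔ FitsInt y a :=
  forall_congr' fun i => forall_congr' fun hi => by rw [h i hi]

theorem tail_future (a : ℤ) (n : ℕ) (x : ℤ → ℕ+) : tail n (future a x) = future (a + n) x := by
  funext i
  simp only [tail, future, coe_addNat]
  congr 1
  push_cast
  ring

/-- The number of steps from the last splitting time before `z` to `z - 1` (`0` if there is none). -/
def splitIdx (x : ℤ → ℕ+) (z : ℤ) : ℕ := sInf {k : ℕ | FitsInt x (z - 1 - k)}

/-- The two-sided permutation driven by `x`: after a splitting time it follows the one-sided
construction. -/
def star (x : ℤ → ℕ+) (z : ℤ) : ℤ :=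
  z - 1 - splitIdx x z + (shiftMap (future (z - 1 - splitIdx x z) x) (splitIdx x z).succPNat : ℕ)

/-- The two-sided construction may be started at any splitting time. -/
theorem star_add {x : ℤ → ℕ+} {b : ℤ} (h : FitsInt x b) (i : ℕ+) :
    star x (b + (i : ℕ)) = b + (shiftMap (future b x) i : ℕ) := by
  have hi := i.pos
  have hmem : (i : ℕ) - 1 ∈ {k : ℕ | FitsInt x (b + (i : ℕ) - 1 - k)} := by
    have : b + ((i : ℕ) : ℤ) - 1 - (((i : ℕ) - 1 : ℕ) : ℤ) = b := by omega
    simp only [Set.mem_ofPred_eq, this]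
    exact h
  have h1 : splitIdx x (b + (i : ℕ)) ≤ (i : ℕ) - 1 := Nat.sInf_le hmem
  have h2 : FitsInt x (b + (i : ℕ) - 1 - splitIdx x (b + (i : ℕ))) := Nat.sInf_mem ⟨_, hmem⟩
  rw [star]
  set k := splitIdx x (b + (i : ℕ))
  obtain ⟨n, hn⟩ : ∃ n : ℕ, (i : ℕ) = n + (k + 1) := ⟨(i : ℕ) - 1 - k, by omega⟩
  have h3 : b + ((i : ℕ) : ℤ) - 1 - k = b + n := by omega
  have h4 : i = addNat n k.succPNat := PNat.eq hn
  rw [h3] at h2 ⊢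
  conv_rhs => rw [h4]
  rw [shiftMap_addNat ((fitsInt_add_iff h n).1 h2), tail_future, coe_addNat]
  push_cast
  ring

/-- The sequences for which the two-sided construction gives a permutation. -/
def IsGood (x : ℤ → ℕ+) : Prop :=
  (∀ a, ∃ b ≤ a, FitsInt x b) ∧ ∀ a, Function.Bijective (shiftMap (future a x))

theorem IsGood.exists_lt {x : ℤ → ℕ+} (h : IsGood x) (z : ℤ) :
    ∃ b, FitsInt x b ∧ ∃ i : ℕ+, z = b + (i : ℕ) := by
  obtain ⟨b, hb, hbx⟩ := h.1 (z - 1)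
  exact ⟨b, hbx, exists_eq_add (by omega)⟩

theorem IsGood.bijective_star {x : ℤ → ℕ+} (h : IsGood x) : Function.Bijective (star x) := by
  constructor
  · intro z z' hz
    obtain ⟨b, hb, hbx⟩ := h.1 (min z z' - 1)
    obtain ⟨i, rfl⟩ := exists_eq_add (show b < z by omega)
    obtain ⟨i', rfl⟩ := exists_eq_add (show b < z' by omega)
    rw [star_add hbx, star_add hbx] at hz
    have h1 : shiftMap (future b x) i = shiftMap (future b x) i' := PNat.eq (by omega)
    rw [shiftMap_injective _ h1]
  · intro w
    obtain ⟨b, hbx, i, rfl⟩ := h.exists_lt w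
    obtain ⟨j, rfl⟩ := (h.2 b).2 i
    exact ⟨b + (j : ℕ), star_add hbx j⟩

/-- The permutation of `ℤ` driven by `x`. -/
def starPerm (x : ℤ → ℕ+) : Equiv.Perm ℤ := permOf (star x)

theorem IsGood.starPerm_apply {x : ℤ → ℕ+} (h : IsGood x) (z : ℤ) : starPerm x z = star x z :=
  permOf_apply h.bijective_star z

theorem splitsAtInt_iff {σ : Equiv.Perm ℤ} {z : ℤ} : SplitsAtInt σ z ↔ ∀ i, σ i ≤ z ↔ i ≤ z := by
  constructor
  · intro h i
    have h1 : σ i ∈ σ '' Set.Iic z ↔ i ∈ Set.Iic z := σ.injective.mem_set_image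
    rwa [h] at h1
  · intro h
    ext w
    constructor
    · rintro ⟨i, hi, rfl⟩
      exact (h i).2 hi
    · intro hw
      refine ⟨σ.symm w, ?_, σ.apply_symm_apply w⟩
      rw [Set.mem_Iic, ← h, σ.apply_symm_apply]
      exact hw

/-- The splitting times of the two-sided permutation are the times at which the steps fit. -/
theorem IsGood.splitsAtInt_iff {x : ℤ → ℕ+} (h : IsGood x) (z : ℤ) :
    SplitsAtInt (starPerm x) z ↔ FitsInt x z := by
  rw [PShift.splitsAtInt_iff]
  simp only [h.starPerm_apply]
  constructor
  · intro h1
    obtain ⟨b, hb, hbx⟩ := h.1 z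
    obtain ⟨n, hn⟩ := Int.eq_ofNat_of_zero_le (by omega : 0 ≤ z - b)
    obtain rfl : z = b + n := by omega
    refine fitsInt_add_of_fits hbx ((forall_shiftMap_le_iff _ _).1 fun i hi => ?_)
    have h2 := (h1 (b + (i : ℕ))).2 (by omega)
    rw [star_add hbx] at h2
    omega
  · intro h1 i
    constructor
    · intro h2
      by_contra h3
      obtain ⟨l, rfl⟩ := exists_eq_add (not_le.1 h3)
      rw [star_add h1] at h2
      have := (shiftMap (future z x) l).pos
      omega
    · intro h2
      obtain ⟨b, hbx, l, rfl⟩ := h.exists_lt i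
      obtain ⟨n, hn⟩ := Int.eq_ofNat_of_zero_le (by omega : 0 ≤ z - b)
      obtain rfl : z = b + n := by omega
      have h3 := (forall_shiftMap_le_iff _ _).2 ((fitsInt_add_iff hbx n).1 h1) l (by omega)
      rw [star_add hbx]
      omega

/-- The translate of a two-sided sequence: the term at `i` is the term of `x` at `a + i`. -/
def translate (a : ℤ) (x : ℤ → ℕ+) : ℤ → ℕ+ := fun i => x (a + i)

/-- The two-sided construction commutes with translations, whence the stationarity of the
displacements. -/
theorem star_translate (a : ℤ) (x : ℤ → ℕ+) (z : ℤ) : star (translate a x) z = star x (a + z) - a := by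
  have h1 : ∀ b, FitsInt (translate a x) b ↔ FitsInt x (a + b) := by
    intro b
    constructor
    · intro h i hi
      have := h (i - a) (by omega)
      simp only [translate, add_sub_cancel] at this
      omega
    · intro h i hi
      have := h (a + i) (by omega)
      simp only [translate]
      omega
  have h2 : splitIdx (translate a x) z = splitIdx x (a + z) := by
    simp only [splitIdx, h1]
    congr 1
    ext k
    simp only [Set.mem_ofPred_eq]
    rw [show a + (z - 1 - (k : ℤ)) = a + z - 1 - k by ring]
  have h3 : ∀ b, future b (translate a x) = future (a + b) x := by
    intro b
    funext i
    simp only [future, translate]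
    congr 1
    ring
  rw [star, star, h2, h3, show a + (z - 1 - (splitIdx x (a + z) : ℤ)) = a + z - 1 - splitIdx x (a + z)
    by ring]
  ring

/-! ### Measurability of the two-sided construction -/

theorem measurableSet_fitsInt (a : ℤ) : MeasurableSet {x : ℤ → ℕ+ | FitsInt x a} := by
  have : {x : ℤ → ℕ+ | FitsInt x a}
      = ⋂ i : ℤ, {x | i ≤ a → ((x i : ℕ) : ℤ) + i ≤ a + 1} := by
    ext x
    simp [FitsInt]
  rw [this]
  refine MeasurableSet.iInter fun i => ?_
  exact (measurable_pi_apply (X := fun _ : ℤ => ℕ+) i) (MeasurableSet.of_discrete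
    (s := {k : ℕ+ | i ≤ a → ((k : ℕ) : ℤ) + i ≤ a + 1}))

theorem measurable_sInf_nat {X : Type*} [MeasurableSpace X] {A : ℕ → Set X}
    (hA : ∀ k, MeasurableSet (A k)) : Measurable fun x => sInf {k | x ∈ A k} := by
  have h1 : ∀ k, {x | sInf {k | x ∈ A k} = k + 1} = A (k + 1) ∩ ⋂ m ∈ Finset.range (k + 1), (A m)ᶜ := by
    intro k
    ext x
    simp only [Set.mem_ofPred_eq, Set.mem_inter_iff, Set.mem_iInter, Finset.mem_range,
      Set.mem_compl_iff]
    constructor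
    · intro h
      have hne : {k | x ∈ A k}.Nonempty := by
        by_contra h2
        rw [Set.not_nonempty_iff_eq_empty.1 h2, Nat.sInf_empty] at h
        omega
      have h3 := Nat.sInf_mem hne
      rw [h] at h3
      exact ⟨h3, fun m hm => Nat.notMem_of_lt_sInf (s := {k | x ∈ A k}) (by rw [h]; exact hm)⟩
    · rintro ⟨h2, h3⟩
      refine le_antisymm (Nat.sInf_le h2) ?_
      by_contra h4
      exact h3 _ (not_le.1 h4) (Nat.sInf_mem (s := {k | x ∈ A k}) ⟨_, h2⟩)
  have h2 : ∀ k, MeasurableSet {x | sInf {k | x ∈ A k} = k + 1} := by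
    intro k
    rw [h1]
    exact (hA _).inter (Finset.measurableSet_biInter _ fun m _ => (hA m).compl)
  refine measurable_to_countable' fun k => ?_
  cases k with
  | succ k => exact h2 k
  | zero =>
    have : (fun x => sInf {k | x ∈ A k}) ⁻¹' {0} = (⋃ k, {x | sInf {k | x ∈ A k} = k + 1})ᶜ := by
      ext x
      simp only [Set.mem_preimage, Set.mem_singleton_iff, Set.mem_compl_iff, Set.mem_iUnion,
        Set.mem_ofPred_eq, not_exists]
      constructor
      · intro h k
        omega
      · intro h
        by_contra h3
        obtain ⟨k, hk⟩ := Nat.exists_eq_succ_of_ne_zero h3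
        exact h k hk
    rw [this]
    exact (MeasurableSet.iUnion h2).compl

theorem measurable_future (a : ℤ) : Measurable (future a) := by
  unfold future
  fun_prop

theorem measurable_star : Measurable star := by
  refine measurable_pi_lambda _ fun z => ?_
  have h1 : Measurable fun x => splitIdx x z :=
    measurable_sInf_nat fun k => measurableSet_fitsInt (z - 1 - (k : ℤ))
  have h2 : Measurable fun q : (ℤ → ℕ+) × ℕ =>
      z - 1 - (q.2 : ℤ) + ((shiftMap (future (z - 1 - q.2) q.1) q.2.succPNat : ℕ) : ℤ) := by
    refine measurable_from_prod_countable_left fun k => ?_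
    have h3 : Measurable fun l : ℕ+ => z - 1 - (k : ℤ) + ((l : ℕ) : ℤ) := measurable_of_countable _
    exact h3.comp ((measurable_pi_apply k.succPNat).comp
      (measurable_shiftMap.comp (measurable_future (z - 1 - (k : ℤ)))))
  exact h2.comp (measurable_id.prodMk h1)

theorem measurable_starPerm : Measurable starPerm := measurable_permOf.comp measurable_star

theorem measurableSet_splitsAtInt (z : ℤ) : MeasurableSet {σ : Equiv.Perm ℤ | SplitsAtInt σ z} := by
  have : {σ : Equiv.Perm ℤ | SplitsAtInt σ z} = ⋂ i : ℤ, {σ | σ i ≤ z ↔ i ≤ z} := by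
    ext σ
    simp only [Set.mem_ofPred_eq, Set.mem_iInter, splitsAtInt_iff]
  rw [this]
  exact MeasurableSet.iInter fun i =>
    measurable_perm_apply i (MeasurableSet.of_discrete (s := {k : ℤ | k ≤ z ↔ i ≤ z}))

/-! ### The stationary permutation of the integers -/

/-- The law of a two-sided i.i.d. sample from `p`. -/
def twoSidedLaw (p : PMF ℕ+) : Measure (ℤ → ℕ+) := Measure.infinitePi fun _ : ℤ => p.toMeasure

instance (p : PMF ℕ+) : IsProbabilityMeasure (twoSidedLaw p) := by
  unfold twoSidedLaw
  infer_instance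

theorem future_injective (a : ℤ) : Function.Injective fun i : ℕ+ => a + ((i : ℕ) : ℤ) :=
  fun i j h => PNat.eq (by simp only at h; omega)

theorem twoSidedLaw_map_future (p : PMF ℕ+) (a : ℤ) :
    (twoSidedLaw p).map (future a) = sampleLaw p :=
  infinitePi_map_comp_injective p.toMeasure (future_injective a)

theorem twoSidedLaw_map_translate (p : PMF ℕ+) (a : ℤ) :
    (twoSidedLaw p).map (translate a) = twoSidedLaw p :=
  infinitePi_map_comp_injective p.toMeasure (add_right_injective a)

/-- The probability of a split at `z` is the infinite product over the past of `z`, hence the inverse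
mean. -/
theorem twoSidedLaw_fitsInt (p : PMF ℕ+) (hp : 0 < p 1) (z : ℤ) :
    twoSidedLaw p {x | FitsInt x z} = (∫⁻ σ, (firstLength σ).toENNReal ∂(permLaw p))⁻¹ := by
  rw [← iInf_prod_eq_inv_mean p hp]
  -- reversing time at `z`, the condition at `z` becomes `y j ≤ j` for all `j ≥ 1`
  have hinj : Function.Injective fun j : ℕ+ => z + 1 - ((j : ℕ) : ℤ) :=
    fun i j h => PNat.eq (by simp only at h; omega)
  have hm : Measurable fun (x : ℤ → ℕ+) (j : ℕ+) => x (z + 1 - ((j : ℕ) : ℤ)) := by fun_prop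
  have hbox : ∀ n : ℕ, MeasurableSet {y : ℕ+ → ℕ+ | ∀ j : ℕ+, (j : ℕ) ≤ n → y j ∈ {k | k ≤ j}} := by
    intro n
    have : {y : ℕ+ → ℕ+ | ∀ j : ℕ+, (j : ℕ) ≤ n → y j ∈ {k | k ≤ j}}
        = ⋂ j ∈ box n, (fun y : ℕ+ → ℕ+ => y j) ⁻¹' {k | k ≤ j} := by
      ext y
      simp
    rw [this]
    exact Finset.measurableSet_biInter _ fun j _ => measurable_pi_apply j MeasurableSet.of_discrete
  have h1 : {x | FitsInt x z} = (fun (x : ℤ → ℕ+) (j : ℕ+) => x (z + 1 - ((j : ℕ) : ℤ))) ⁻¹'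
      ⋂ n : ℕ, {y : ℕ+ → ℕ+ | ∀ j : ℕ+, (j : ℕ) ≤ n → y j ∈ {k | k ≤ j}} := by
    ext x
    simp only [Set.mem_ofPred_eq, Set.mem_preimage, Set.mem_iInter]
    constructor
    · intro h n j _
      have h2 := h (z + 1 - ((j : ℕ) : ℤ)) (by have := j.pos; omega)
      exact (PNat.coe_le_coe _ _).1 (by omega)
    · intro h i hi
      obtain ⟨j, hj⟩ := exists_eq_add (show i < z + 1 by omega)
      have h2 := h j j le_rfl
      have h3 : z + 1 - ((j : ℕ) : ℤ) = i := by omega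
      rw [h3] at h2
      have h4 : (x i : ℕ) ≤ j := h2
      omega
  rw [h1, ← Measure.map_apply hm (MeasurableSet.iInter hbox), twoSidedLaw,
    infinitePi_map_comp_injective p.toMeasure hinj]
  change sampleLaw p _ = _
  have hanti : Antitone fun n : ℕ =>
      {y : ℕ+ → ℕ+ | ∀ j : ℕ+, (j : ℕ) ≤ n → y j ∈ {k | k ≤ j}} :=
    fun m n h y hy j hj => hy j (hj.trans h)
  rw [hanti.measure_iInter (fun n => (hbox n).nullMeasurableSet) ⟨0, measure_ne_top _ _⟩]
  refine iInf_congr fun n => ?_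
  rw [sampleLaw_box p n fun j => {k | k ≤ j}]
  refine Finset.prod_congr rfl fun j _ => ?_
  rw [one_sub_toMeasure_Ioi, ← toMeasure_setOf_le]
  rfl

/-- If the mean length of the components is finite, almost surely there are splitting times
arbitrarily far to the left. This event has positive probability and belongs to the remote past of
an i.i.d. sequence, so that it has probability one. -/
theorem ae_exists_fitsInt (p : PMF ℕ+) (hp : 0 < p 1)
    (hμ : ∫⁻ σ, (firstLength σ).toENNReal ∂(permLaw p) ≠ ∞) :
    ∀ᵐ x ∂(twoSidedLaw p), ∀ a, ∃ b ≤ a, FitsInt x b := by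
  set E : Set (ℤ → ℕ+) := {x | ∀ a, ∃ b ≤ a, FitsInt x b} with hE
  have hDm : ∀ a : ℤ, MeasurableSet {x : ℤ → ℕ+ | ∃ b ≤ a, FitsInt x b} := by
    intro a
    have : {x : ℤ → ℕ+ | ∃ b ≤ a, FitsInt x b} = ⋃ b ∈ Set.Iic a, {x | FitsInt x b} := by
      ext x
      simp
    rw [this]
    exact MeasurableSet.biUnion (Set.to_countable _) fun b _ => measurableSet_fitsInt b
  have hE1 : E = ⋂ n : ℕ, {x : ℤ → ℕ+ | ∃ b ≤ -(n : ℤ), FitsInt x b} := by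
    ext x
    simp only [hE, Set.mem_ofPred_eq, Set.mem_iInter]
    refine ⟨fun h n => h _, fun h a => ?_⟩
    obtain ⟨b, hb, hbx⟩ := h a.natAbs
    exact ⟨b, by omega, hbx⟩
  have hEm : MeasurableSet E := by
    rw [hE1]
    exact MeasurableSet.iInter fun n => hDm _
  have hE0 : twoSidedLaw p E ≠ 0 := by
    have h1 : (∫⁻ σ, (firstLength σ).toENNReal ∂(permLaw p))⁻¹ ≤ twoSidedLaw p E := by
      rw [hE1, Antitone.measure_iInter _ (fun n => (hDm _).nullMeasurableSet)
        ⟨0, measure_ne_top _ _⟩]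
      · refine le_iInf fun n => ?_
        rw [← twoSidedLaw_fitsInt p hp (-(n : ℤ))]
        exact measure_mono fun x hx => ⟨_, le_rfl, hx⟩
      · rintro m n h x ⟨b, hb, hbx⟩
        exact ⟨b, by omega, hbx⟩
    exact ((pos_iff_ne_zero.2 (ENNReal.inv_ne_zero.2 hμ)).trans_le h1).ne'
  -- conditioning on `E` does not change the law, as `E` is independent of each finite window
  have hcond : cond (twoSidedLaw p) E = twoSidedLaw p := by
    refine Measure.eq_infinitePi _ fun s t ht => ?_
    obtain ⟨N, hN⟩ : ∃ N : ℤ, ∀ i ∈ s, N < i := by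
      obtain ⟨M, hM⟩ := s.bddBelow
      exact ⟨M - 1, fun i hi => by have := hM hi; omega⟩
    set B : Set (ℕ+ → ℕ+) := ⋂ j : ℕ+, {y | N + ((j : ℕ) : ℤ) ∈ s → y j ∈ t (N + ((j : ℕ) : ℤ))}
      with hB
    have hBm : MeasurableSet B := by
      refine MeasurableSet.iInter fun j => ?_
      exact (measurable_pi_apply (X := fun _ : ℕ+ => ℕ+) j) (MeasurableSet.of_discrete
        (s := {k | N + ((j : ℕ) : ℤ) ∈ s → k ∈ t (N + ((j : ℕ) : ℤ))}))
    have hst : Set.pi (s : Set ℤ) t = {x | (fun j : ℕ+ => x (N + ((j : ℕ) : ℤ))) ∈ B} := by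
      ext x
      simp only [Set.mem_pi, hB, Set.mem_iInter, Set.mem_ofPred_eq, Finset.mem_coe]
      constructor
      · exact fun h j hj => h _ hj
      · intro h i hi
        obtain ⟨j, rfl⟩ := exists_eq_add (hN i hi)
        exact h j hi
    have hind := infinitePi_inter_preimage p.toMeasure (future_injective N) (good := fun _ => True)
      (Eventually.of_forall fun _ => trivial) hEm hBm ?_
    · have h2 : twoSidedLaw p (Set.pi (s : Set ℤ) t) = sampleLaw p B := by
        rw [hst, ← twoSidedLaw_map_future p N, Measure.map_apply (measurable_future N) hBm]
        rfl
      rw [cond_apply hEm, ← Measure.infinitePi_pi (fun _ : ℤ => p.toMeasure) fun i _ => ht i]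
      change _ = twoSidedLaw p (Set.pi (s : Set ℤ) t)
      rw [h2, hst]
      rw [twoSidedLaw, hind, ← mul_assoc]
      change (twoSidedLaw p E)⁻¹ * twoSidedLaw p E * sampleLaw p B = _
      rw [ENNReal.inv_mul_cancel hE0 (measure_ne_top _ _), one_mul]
    · have key : ∀ x y : ℤ → ℕ+, (∀ i ∉ Set.range fun i : ℕ+ => N + ((i : ℕ) : ℤ), x i = y i) →
          x ∈ E → y ∈ E := by
        intro x y hxy hx a
        obtain ⟨b, hb, hbx⟩ := hx (min a N)
        refine ⟨b, by omega, (fitsInt_congr fun i hi => hxy i ?_).1 hbx⟩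
        rintro ⟨j, rfl⟩
        have := j.pos
        simp only at hi
        omega
      exact fun x y _ _ hxy => ⟨key x y hxy, key y x fun i hi => (hxy i hi).symm⟩
  rw [ae_iff]
  change twoSidedLaw p Eᶜ = 0
  rw [← hcond, cond_apply hEm]
  simp

theorem ae_isGood (p : PMF ℕ+) (hp : 0 < p 1)
    (hμ : ∫⁻ σ, (firstLength σ).toENNReal ∂(permLaw p) ≠ ∞) :
    ∀ᵐ x ∂(twoSidedLaw p), IsGood x := by
  have h1 : ∀ᵐ x ∂(twoSidedLaw p), ∀ a, Function.Bijective (shiftMap (future a x)) := by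
    rw [ae_all_iff]
    intro a
    have h := ae_shiftMap_bijective p hp
    rw [← twoSidedLaw_map_future p a] at h
    exact ae_of_ae_map (measurable_future a).aemeasurable h
  filter_upwards [ae_exists_fitsInt p hp hμ, h1] with x h2 h3
  exact ⟨h2, h3⟩

/-- The law of the stationary version. -/
def starLaw (p : PMF ℕ+) : Measure (Equiv.Perm ℤ) := (twoSidedLaw p).map starPerm

instance (p : PMF ℕ+) : IsProbabilityMeasure (starLaw p) :=
  Measure.isProbabilityMeasure_map measurable_starPerm.aemeasurable

theorem isStationaryLaw_starLaw (p : PMF ℕ+) (hp : 0 < p 1)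
    (hμ : ∫⁻ σ, (firstLength σ).toENNReal ∂(permLaw p) ≠ ∞) : IsStationaryLaw (starLaw p) := by
  have hdm : ∀ a : ℤ, Measurable fun (σ : Equiv.Perm ℤ) (z : ℤ) => σ (a + z) - (a + z) := by
    intro a
    refine measurable_pi_lambda _ fun z => ?_
    exact (measurable_of_countable fun k : ℤ => k - (a + z)).comp (measurable_perm_apply (a + z))
  have hsm : Measurable fun (x : ℤ → ℕ+) (z : ℤ) => star x z - z := by
    refine measurable_pi_lambda _ fun z => ?_
    exact (measurable_of_countable fun k : ℤ => k - z).comp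
      ((measurable_pi_apply z).comp measurable_star)
  have key : ∀ a : ℤ, (starLaw p).map (fun (σ : Equiv.Perm ℤ) (z : ℤ) => σ (a + z) - (a + z))
      = (twoSidedLaw p).map fun x z => star x z - z := by
    intro a
    rw [starLaw, Measure.map_map (hdm a) measurable_starPerm]
    have h1 : ((fun (σ : Equiv.Perm ℤ) (z : ℤ) => σ (a + z) - (a + z)) ∘ starPerm)
        =ᵐ[twoSidedLaw p] (fun x z => star x z - z) ∘ translate a := by
      filter_upwards [ae_isGood p hp hμ] with x hx
      funext z
      simp only [Function.comp_apply, hx.starPerm_apply, star_translate]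
      ring
    have htm : Measurable (translate a) := by
      unfold translate
      fun_prop
    rw [Measure.map_congr h1, ← Measure.map_map hsm htm, twoSidedLaw_map_translate]
  intro a
  have h0 := key 0
  simp only [zero_add] at h0
  rw [key a, h0]

theorem starLaw_splitsAtInt (p : PMF ℕ+) (hp : 0 < p 1)
    (hμ : ∫⁻ σ, (firstLength σ).toENNReal ∂(permLaw p) ≠ ∞) (z : ℤ) :
    starLaw p {σ | SplitsAtInt σ z} = (∫⁻ σ, (firstLength σ).toENNReal ∂(permLaw p))⁻¹ := by
  rw [starLaw, Measure.map_apply measurable_starPerm (measurableSet_splitsAtInt z),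
    ← twoSidedLaw_fitsInt p hp z]
  refine measure_congr ?_
  filter_upwards [ae_isGood p hp hμ] with x hx
  exact propext (hx.splitsAtInt_iff z)

theorem measurable_after (z : ℤ) :
    Measurable fun (σ : Equiv.Perm ℤ) (i : ℕ+) => σ (z + ((i : ℕ) : ℤ)) - z := by
  refine measurable_pi_lambda _ fun i => ?_
  exact (measurable_of_countable fun k : ℤ => k - z).comp (measurable_perm_apply _)

theorem measurable_coe_shiftMap :
    Measurable fun (y : ℕ+ → ℕ+) (i : ℕ+) => ((shiftMap y i : ℕ) : ℤ) := by
  refine measurable_pi_lambda _ fun i => ?_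
  exact (measurable_of_countable fun k : ℕ+ => ((k : ℕ) : ℤ)).comp
    ((measurable_pi_apply i).comp measurable_shiftMap)

/-- The regeneration property of the stationary version: an event `A` that only depends on the steps
up to `z` is independent, on the event of a split at `z`, of the permutation after `z`. -/
theorem starLaw_inter (p : PMF ℕ+) (hp : 0 < p 1)
    (hμ : ∫⁻ σ, (firstLength σ).toENNReal ∂(permLaw p) ≠ ∞) (z : ℤ) {A : Set (Equiv.Perm ℤ)}
    (hA : MeasurableSet A)
    (hdet : ∀ x y, IsGood x → IsGood y → (∀ i ≤ z, x i = y i) → (starPerm x ∈ A ↔ starPerm y ∈ A))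
    {B : Set (ℕ+ → ℤ)} (hB : MeasurableSet B) :
    starLaw p ({σ | SplitsAtInt σ z} ∩ A ∩
        (fun (σ : Equiv.Perm ℤ) (i : ℕ+) => σ (z + ((i : ℕ) : ℤ)) - z) ⁻¹' B)
      = starLaw p ({σ | SplitsAtInt σ z} ∩ A) *
        (sampleLaw p).map (fun (y : ℕ+ → ℕ+) (i : ℕ+) => ((shiftMap y i : ℕ) : ℤ)) B := by
  have hSA := (measurableSet_splitsAtInt z).inter hA
  rw [starLaw, Measure.map_apply measurable_starPerm (hSA.inter (measurable_after z hB)),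
    Measure.map_apply measurable_starPerm hSA, Measure.map_apply measurable_coe_shiftMap hB]
  have h := infinitePi_inter_preimage p.toMeasure (future_injective z) (ae_isGood p hp hμ)
    (measurable_starPerm hSA) (measurable_coe_shiftMap hB) ?_
  · rw [twoSidedLaw, sampleLaw, ← h]
    refine measure_congr ?_
    filter_upwards [ae_isGood p hp hμ] with x hx
    refine propext (and_congr_right fun h1 => ?_)
    have h2 : FitsInt x z := (hx.splitsAtInt_iff z).1 h1.1
    have h3 : (fun i : ℕ+ => starPerm x (z + ((i : ℕ) : ℤ)) - z)
        = fun i : ℕ+ => ((shiftMap (future z x) i : ℕ) : ℤ) := by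
      funext i
      rw [hx.starPerm_apply, star_add h2]
      ring
    change (fun i : ℕ+ => starPerm x (z + ((i : ℕ) : ℤ)) - z) ∈ B ↔
      (fun i : ℕ+ => ((shiftMap (future z x) i : ℕ) : ℤ)) ∈ B
    rw [h3]
  · intro x y hx hy hxy
    have h1 : ∀ i ≤ z, x i = y i := by
      intro i hi
      refine hxy i ?_
      rintro ⟨j, rfl⟩
      have := j.pos
      simp only at hi
      omega
    refine and_congr ?_ (hdet x y hx hy h1)
    change SplitsAtInt (starPerm x) z ↔ SplitsAtInt (starPerm y) z
    rw [hx.splitsAtInt_iff, hy.splitsAtInt_iff, fitsInt_congr h1]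

theorem starLaw_cond_after (p : PMF ℕ+) (hp : 0 < p 1)
    (hμ : ∫⁻ σ, (firstLength σ).toENNReal ∂(permLaw p) ≠ ∞) (z : ℤ) :
    (cond (starLaw p) {σ | SplitsAtInt σ z}).map
        (fun (σ : Equiv.Perm ℤ) (i : ℕ+) => σ (z + ((i : ℕ) : ℤ)) - z)
      = (sampleLaw p).map fun (y : ℕ+ → ℕ+) (i : ℕ+) => ((shiftMap y i : ℕ) : ℤ) := by
  ext B hB
  have h := starLaw_inter p hp hμ z MeasurableSet.univ (fun _ _ _ _ _ => Iff.rfl) hB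
  rw [Set.inter_univ] at h
  rw [Measure.map_apply (measurable_after z) hB, cond_apply (measurableSet_splitsAtInt z), h,
    ← mul_assoc, ENNReal.inv_mul_cancel _ (measure_ne_top _ _), one_mul]
  rw [starLaw_splitsAtInt p hp hμ]
  exact ENNReal.inv_ne_zero.2 hμ

theorem isRegenerativeInt_starLaw (p : PMF ℕ+) (hp : 0 < p 1)
    (hμ : ∫⁻ σ, (firstLength σ).toENNReal ∂(permLaw p) ≠ ∞) : IsRegenerativeInt (starLaw p) := by
  intro z _
  rw [indepFun_iff_measure_inter_preimage_eq_mul]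
  intro s t hs ht
  have hm : Measurable fun (σ : Equiv.Perm ℤ) (k : ℕ) => SplitsAtInt σ (z - k) :=
    measurable_pi_lambda _ fun k => measurableSet_setOfPred.1 (measurableSet_splitsAtInt _)
  have h := starLaw_inter p hp hμ z (hm hs) ?_ ht
  · rw [cond_apply (measurableSet_splitsAtInt z), ← Set.inter_assoc, h, ← mul_assoc,
      ← cond_apply (measurableSet_splitsAtInt z), ← starLaw_cond_after p hp hμ z,
      Measure.map_apply (measurable_after z) ht]
  · intro x y hx hy hxy
    have h1 : (fun k : ℕ => SplitsAtInt (starPerm x) (z - k))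
        = fun k : ℕ => SplitsAtInt (starPerm y) (z - k) := by
      funext k
      rw [hx.splitsAtInt_iff, hy.splitsAtInt_iff]
      exact propext (fitsInt_congr fun i hi => hxy i (by omega))
    simp only [Set.mem_preimage, h1]

end TwoSided

/-! ### Infinite mean excludes a stationary version -/

/-- A Bonferroni inequality: many events of probability at least `q` with small pairwise
intersections have a union of probability close to the sum. -/
theorem natCast_mul_le_measure_biUnion {α : Type*} [MeasurableSpace α] {ρ : Measure α}
    {B : ℕ → Set α} (hB : ∀ k, MeasurableSet (B k)) {q e : ℝ≥0∞} (hq : ∀ k, q ≤ ρ (B k))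
    (he : ∀ j k, j < k → ρ (B j ∩ B k) ≤ e) (n : ℕ) :
    (n : ℝ≥0∞) * q ≤ ρ (⋃ k ∈ Finset.range n, B k) + (n : ℝ≥0∞) ^ 2 * e := by
  induction n with
  | zero => simp
  | succ n ih =>
    have h1 := measure_union_add_inter (μ := ρ) (⋃ k ∈ Finset.range n, B k) (hB n)
    have h2 : (⋃ k ∈ Finset.range n, B k) ∪ B n = ⋃ k ∈ Finset.range (n + 1), B k := by
      rw [Finset.range_add_one, Finset.set_biUnion_insert, Set.union_comm]
    have h3 : ρ ((⋃ k ∈ Finset.range n, B k) ∩ B n) ≤ n * e := by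
      rw [Set.iUnion₂_inter]
      refine (measure_biUnion_finset_le _ _).trans ?_
      refine (Finset.sum_le_card_nsmul _ _ e fun k hk => he k n (Finset.mem_range.1 hk)).trans ?_
      simp
    rw [h2] at h1
    calc ((n + 1 : ℕ) : ℝ≥0∞) * q = n * q + q := by push_cast; ring
      _ ≤ (ρ (⋃ k ∈ Finset.range n, B k) + (n : ℝ≥0∞) ^ 2 * e) + ρ (B n) := add_le_add ih (hq n)
      _ = (ρ (⋃ k ∈ Finset.range (n + 1), B k) + ρ ((⋃ k ∈ Finset.range n, B k) ∩ B n))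
          + (n : ℝ≥0∞) ^ 2 * e := by rw [h1]; ring
      _ ≤ (ρ (⋃ k ∈ Finset.range (n + 1), B k) + n * e) + (n : ℝ≥0∞) ^ 2 * e := by gcongr
      _ ≤ (ρ (⋃ k ∈ Finset.range (n + 1), B k) + n * e) + (n : ℝ≥0∞) ^ 2 * e + (n + 1) * e :=
          le_self_add
      _ = ρ (⋃ k ∈ Finset.range (n + 1), B k) + ((n + 1 : ℕ) : ℝ≥0∞) ^ 2 * e := by
          push_cast; ring

/-- Under a stationary law all times are splitting times with the same probability, since
splitting is a property of the displacements. -/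
theorem IsStationaryLaw.splitsAtInt_eq {ρ : Measure (Equiv.Perm ℤ)} (hρ : IsStationaryLaw ρ)
    (z : ℤ) : ρ {σ | SplitsAtInt σ z} = ρ {σ | SplitsAtInt σ 0} := by
  have hm : ∀ a : ℤ, Measurable fun (σ : Equiv.Perm ℤ) (w : ℤ) => σ (a + w) - (a + w) :=
    fun a => measurable_pi_lambda _ fun w =>
      (measurable_of_countable fun k : ℤ => k - (a + w)).comp (measurable_perm_apply (a + w))
  set S : Set (ℤ → ℤ) := ⋂ i : ℤ, {d | d i + i ≤ 0 ↔ i ≤ 0} with hS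
  have hSm : MeasurableSet S := MeasurableSet.iInter fun i =>
    (measurable_pi_apply (X := fun _ : ℤ => ℤ) i)
      (MeasurableSet.of_discrete (s := {k : ℤ | k + i ≤ 0 ↔ i ≤ 0}))
  have key : ∀ a : ℤ, {σ : Equiv.Perm ℤ | SplitsAtInt σ a}
      = (fun (σ : Equiv.Perm ℤ) (w : ℤ) => σ (a + w) - (a + w)) ⁻¹' S := by
    intro a
    ext σ
    simp only [hS, Set.mem_ofPred_eq, Set.mem_preimage, Set.mem_iInter, splitsAtInt_iff]
    constructor
    · intro h i
      have := h (a + i)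
      constructor <;> intro h' <;> omega
    · intro h i
      have := h (i - a)
      rw [add_sub_cancel] at this
      constructor <;> intro h' <;> omega
  have h1 : ∀ a : ℤ, ρ {σ | SplitsAtInt σ a} = ρ.map (fun (σ : Equiv.Perm ℤ) (w : ℤ) => σ w - w) S := by
    intro a
    rw [key a, ← Measure.map_apply (hm a) hSm, hρ a]
  rw [h1 z, h1 0]

/-- Given a split at `z`, a split at `z + n` corresponds to a split at `n` of the one-sided
permutation. -/
theorem IsStationaryVersion.splitsAtInt_inter_le {Ω : Type*} [MeasurableSpace Ω] {P : Measure Ω}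
    {Perm : Ω → Equiv.Perm ℕ+} {ρ : Measure (Equiv.Perm ℤ)} (h : IsStationaryVersion P Perm ρ)
    (hP : Measurable Perm) (z : ℤ) (n : ℕ) :
    ρ ({σ | SplitsAtInt σ z} ∩ {σ | SplitsAtInt σ (z + n)})
      ≤ P.map Perm {σ | SplitsAt σ n} := by
  have := h.isProbabilityMeasure
  set S : Set (ℕ+ → ℤ) := ⋂ i : ℕ+, {d | (i : ℕ) ≤ n → d i ≤ n} with hS
  have hSm : MeasurableSet S := MeasurableSet.iInter fun i =>
    (measurable_pi_apply (X := fun _ : ℕ+ => ℤ) i)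
      (MeasurableSet.of_discrete (s := {k : ℤ | (i : ℕ) ≤ n → k ≤ n}))
  have hcm : Measurable fun ω (i : ℕ+) => ((Perm ω i : ℕ) : ℤ) := measurable_pi_lambda _ fun i =>
    (measurable_of_countable fun k : ℕ+ => ((k : ℕ) : ℤ)).comp ((measurable_perm_apply i).comp hP)
  have h1 := congrArg (fun m => m S) (h.palm z)
  simp only [Measure.map_apply (measurable_after z) hSm, Measure.map_apply hcm hSm] at h1
  have h2 : (fun ω (i : ℕ+) => ((Perm ω i : ℕ) : ℤ)) ⁻¹' S = Perm ⁻¹' {σ | SplitsAt σ n} := by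
    ext ω
    simp only [hS, Set.mem_preimage, Set.mem_iInter, Set.mem_ofPred_eq, splitsAt_iff_forall_le,
      Nat.cast_le]
  rw [h2, ← Measure.map_apply hP (measurableSet_splitsAt n)] at h1
  rw [← h1, ← cond_mul_eq_inter (measurableSet_splitsAtInt z) _ ρ]
  refine (mul_le_of_le_one_right' prob_le_one).trans (measure_mono fun σ hσ => ?_)
  simp only [hS, Set.mem_preimage, Set.mem_iInter, Set.mem_ofPred_eq]
  intro i hi
  have := (splitsAtInt_iff.1 hσ (z + ((i : ℕ) : ℤ))).2 (by omega)
  omega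

/-- A permutation whose splitting probabilities tend to `0` has no stationary version: the
stationary version would split with a constant positive probability `q` at each of `n` times far
apart from each other, these events being almost disjoint, although `n q > 1`. -/
theorem not_isStationaryVersion {Ω : Type*} [MeasurableSpace Ω] {P : Measure Ω}
    {Perm : Ω → Equiv.Perm ℕ+} (hP : Measurable Perm)
    (h0 : Tendsto (fun n => P.map Perm {σ | SplitsAt σ n}) atTop (𝓝 0))
    (ρ : Measure (Equiv.Perm ℤ)) : ¬ IsStationaryVersion P Perm ρ := by
  intro h
  have := h.isProbabilityMeasure
  -- `n` times with `2 < n q`, at distances for which all pairwise probabilities are below `1 / n²`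
  obtain ⟨n, hn⟩ := ENNReal.exists_nat_mul_gt (h.splits_ne_zero 0) (ENNReal.natCast_ne_top 2)
  have hn0 : n ≠ 0 := by
    rintro rfl
    simp at hn
  have hn2 : ((n : ℝ≥0∞) ^ 2) ≠ 0 := pow_ne_zero 2 (Nat.cast_ne_zero.2 hn0)
  have hn3 : ((n : ℝ≥0∞) ^ 2) ≠ ∞ := ENNReal.pow_ne_top (ENNReal.natCast_ne_top n)
  obtain ⟨d, hd⟩ := eventually_atTop.1
    (h0.eventually (gt_mem_nhds (ENNReal.inv_pos.2 hn3)))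
  have hle := natCast_mul_le_measure_biUnion (ρ := ρ)
    (B := fun k : ℕ => {σ | SplitsAtInt σ (((d + 1) * k : ℕ) : ℤ)})
    (fun k => measurableSet_splitsAtInt _) (fun k => (h.stationary.splitsAtInt_eq _).ge)
    (e := ((n : ℝ≥0∞) ^ 2)⁻¹) ?_ n
  · rw [ENNReal.mul_inv_cancel hn2 hn3] at hle
    refine absurd hn (not_lt.2 (hle.trans ?_))
    calc _ ≤ (1 : ℝ≥0∞) + 1 := by gcongr; exact prob_le_one
      _ = ((2 : ℕ) : ℝ≥0∞) := by norm_num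
  · intro j k hjk
    obtain ⟨m, rfl⟩ := Nat.exists_eq_add_of_lt hjk
    have h1 : (((d + 1) * (j + m + 1) : ℕ) : ℤ)
        = (((d + 1) * j : ℕ) : ℤ) + (((d + 1) * (m + 1) : ℕ) : ℤ) := by
      push_cast; ring
    rw [h1]
    refine (h.splitsAtInt_inter_le hP _ _).trans (hd _ ?_).le
    nlinarith

/-! ### From the law to a random permutation -/

theorem permLaw_splitsAt_ne_zero (p : PMF ℕ+) (hp : 0 < p 1) (n : ℕ) :
    permLaw p {σ | SplitsAt σ n} ≠ 0 := by
  rw [permLaw_splitsAt p hp, Finset.prod_ne_zero_iff]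
  intro j hj h
  have h1 := Finset.sum_eq_zero_iff.1 h 1 (Finset.mem_Icc.2 ⟨le_rfl, (Finset.mem_Icc.1 hj).1⟩)
  rw [weight, dif_pos Nat.one_pos] at h1
  exact hp.ne' h1

section Transfer

variable {Ω : Type*} [MeasurableSpace Ω] {P : Measure Ω} {Perm : Ω → Equiv.Perm ℕ+}

theorem splitProb_eq (hm : Measurable Perm) (n : ℕ) :
    splitProb P Perm n = P.map Perm {σ | SplitsAt σ n} :=
  (Measure.map_apply hm (measurableSet_splitsAt n)).symm

theorem firstLengthProb_eq (hm : Measurable Perm) (n : ℕ) :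
    firstLengthProb P Perm n = P.map Perm {σ | firstLength σ = n} :=
  (Measure.map_apply hm (measurableSet_firstLength_eq n)).symm

theorem meanLength_eq (hm : Measurable Perm) :
    meanLength P Perm = ∫⁻ σ, (firstLength σ).toENNReal ∂(P.map Perm) :=
  (lintegral_map ((measurable_of_countable _).comp measurable_firstLength) hm).symm

theorem meanCycles_eq (hm : Measurable Perm) (j : ℕ) :
    meanCycles P Perm j
      = ∫⁻ σ, (cycleCount σ (firstLength σ).toNat j : ℝ≥0∞) ∂(P.map Perm) :=
  (lintegral_map (f := fun σ => (cycleCount σ (firstLength σ).toNat j : ℝ≥0∞))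
    ((measurable_of_countable _).comp (measurable_cycleCount_firstLength j)) hm).symm

theorem measure_firstLength_lt_top_eq (hm : Measurable Perm) :
    P {ω | firstLength (Perm ω) < ⊤} = P.map Perm {σ | firstLength σ < ⊤} :=
  (Measure.map_apply hm (measurable_firstLength (MeasurableSet.of_discrete (s := Set.Iio ⊤)))).symm

theorem genUOne_eq (hm : Measurable Perm) (h0 : P.map Perm {σ | SplitsAt σ 0} = 1) :
    genUOne P Perm = ∑' n : ℕ, P.map Perm {σ | SplitsAt σ n} := by
  rw [tsum_eq_zero_add' ENNReal.summable, h0, genUOne]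
  simp_rw [splitProb_eq hm]

/-- By the renewal equation at `1`, a component is infinite with positive probability iff the expected
number of splitting times is finite. -/
theorem isTransient_iff [IsProbabilityMeasure P] (hm : Measurable Perm)
    (hL : Regenerates (P.map Perm)) (h0 : P.map Perm {σ | SplitsAt σ 0} = 1) :
    IsTransient P Perm ↔ genUOne P Perm < ∞ := by
  have := Measure.isProbabilityMeasure_map hm.aemeasurable (μ := P)
  rw [IsTransient, measure_firstLength_lt_top_eq hm, hL.tsum_firstLength, ← genUOne_eq hm h0,
    lt_top_iff_ne_top]
  constructor
  · rintro h h1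
    simp [h1] at h
  · intro h
    exact ENNReal.sub_lt_self ENNReal.one_ne_top one_ne_zero (ENNReal.inv_ne_zero.2 h)

theorem ae_firstLength_lt_top_iff [IsProbabilityMeasure P] (hm : Measurable Perm) :
    (∀ᵐ ω ∂P, firstLength (Perm ω) < ⊤) ↔ ¬ IsTransient P Perm := by
  have h : MeasurableSet {ω | firstLength (Perm ω) < ⊤} :=
    (measurable_firstLength.comp hm) (MeasurableSet.of_discrete (s := Set.Iio ⊤))
  rw [IsTransient, not_lt, ← prob_compl_eq_zero_iff h |>.trans
    ⟨fun h => h.ge, fun h => le_antisymm prob_le_one h⟩]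
  rfl

end Transfer

end PShift
end
open PShift in
theorem mainTheorem2 (p : PMF ℕ+) (hp : 0 < p 1) :
    -- the construction almost surely yields a permutation
    (∀ᵐ x ∂(sampleLaw p), Function.Bijective (shiftMap x)) ∧
    ∀ {Ω : Type*} [MeasurableSpace Ω] (P : Measure Ω) [IsProbabilityMeasure P]
      (Perm : Ω → Equiv.Perm ℕ+), IsPShifted P Perm p →
    -- (i) finite-dimensional distributions
    (∀ (n : ℕ) (π : ℕ+ → ℕ+), Set.InjOn π {i | (i : ℕ) ≤ n} →
      P {ω | ∀ i : ℕ+, (i : ℕ) ≤ n → Perm ω i = π i} =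
        ∏ j : Fin n, weight p
          ((π (j : ℕ).succPNat : ℕ) -
            ((Finset.Iio (j : ℕ).succPNat).filter fun i => π i < π (j : ℕ).succPNat).card)) ∧
    -- (ii) splitting probabilities
    (∀ n : ℕ, splitProb P Perm n =
      ∏ j ∈ Finset.Icc 1 n, ∑ i ∈ Finset.Icc 1 j, weight p i) ∧
    -- (iii) strict regeneration
    (IsStrictlyRegenerative P Perm ∧
      (∀ ω n, renewals (splitTime (Perm ω)) n ↔ SplitsAt (Perm ω) n) ∧
      (∀ n : ℕ, P {ω | renewals (splitTime (Perm ω)) n} =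
        ∏ j ∈ Finset.Icc 1 n, ∑ i ∈ Finset.Icc 1 j, weight p i) ∧
      (∀ n : ℕ, (cond P {ω | SplitsAt (Perm ω) n}).map (fun ω => residual n (Perm ω))
        = P.map Perm)) ∧
    -- (iv) generating function of the length of the first component
    ((∀ z : ℂ, ‖z‖ < 1 →
        Summable (fun n : ℕ => ((splitProb P Perm (n + 1)).toReal : ℂ) * z ^ (n + 1)) ∧
        genU P Perm z ≠ 0 ∧
        ∫ ω, powTop z (firstLength (Perm ω)) ∂P = 1 - 1 / genU P Perm z ∧
        HasSum (fun n : ℕ => ((firstLengthProb P Perm (n + 1)).toReal : ℂ) * z ^ (n + 1))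
          (1 - 1 / genU P Perm z)) ∧
      ∑' n : ℕ, firstLengthProb P Perm (n + 1) = 1 - (genUOne P Perm)⁻¹) ∧
    -- (v) finite mean
    (∑' i : ℕ+, ((i : ℕ) : ℝ≥0∞) * p i < ∞ →
      IsPositiveRecurrent P Perm ∧
      Tendsto (splitProb P Perm) atTop (𝓝 (meanLength P Perm)⁻¹) ∧
      HasProd (fun j : ℕ+ => 1 - p.toMeasure (Set.Ioi j)) (meanLength P Perm)⁻¹ ∧
      meanLength P Perm = ∑' j : ℕ, (j : ℝ≥0∞) * meanCycles P Perm j ∧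
      (∀ᵐ ω ∂P, ∀ j : ℕ, 1 ≤ j →
        Tendsto (fun n : ℕ => (cycleCount (Perm ω) n j : ℝ) / n) atTop
          (𝓝 (meanCycles P Perm j / meanLength P Perm).toReal) ∧
        Tendsto (fun n : ℕ => (cycleCountLeast (Perm ω) n j : ℝ) / n) atTop
          (𝓝 (meanCycles P Perm j / meanLength P Perm).toReal)) ∧
      ∃ ρ : Measure (Equiv.Perm ℤ), IsStationaryVersion P Perm ρ ∧ IsRegenerativeInt ρ ∧
        ∀ z : ℤ, ρ {σ | SplitsAtInt σ z} = (meanLength P Perm)⁻¹) ∧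
    -- (vi) infinite mean
    (∑' i : ℕ+, ((i : ℕ) : ℝ≥0∞) * p i = ∞ →
      (IsNullRecurrent P Perm ∨ IsTransient P Perm) ∧
      (IsNullRecurrent P Perm ↔ genUOne P Perm = ∞) ∧
      (IsTransient P Perm ↔ genUOne P Perm < ∞) ∧
      ¬ ∃ ρ : Measure (Equiv.Perm ℤ), IsStationaryVersion P Perm ρ) := by
  refine ⟨ae_shiftMap_bijective p hp, ?_⟩
  intro Ω _ P _ Perm h
  have hm : Measurable Perm := h.1
  have hP : P.map Perm = permLaw p := h.map_eq hp
  have hL : Regenerates (P.map Perm) := hP ▸ regenerates_permLaw p hp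
  have : IsProbabilityMeasure (P.map Perm) := Measure.isProbabilityMeasure_map hm.aemeasurable
  have h0 : P.map Perm {σ | SplitsAt σ 0} = 1 := measure_splitsAt_zero
  have hu : ∀ n : ℕ, splitProb P Perm n
      = ∏ j ∈ Finset.Icc 1 n, ∑ i ∈ Finset.Icc 1 j, weight p i := fun n => by
    rw [splitProb_eq hm, hP, permLaw_splitsAt p hp]
  have hR : ∀ ω n, renewals (splitTime (Perm ω)) n ↔ SplitsAt (Perm ω) n :=
    fun ω n => renewals_splitTime_iff (Perm ω) n
  have hmean : meanLength P Perm = ∫⁻ σ, (firstLength σ).toENNReal ∂(permLaw p) := by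
    rw [meanLength_eq hm, hP]
  have htend : Tendsto (splitProb P Perm) atTop (𝓝 (meanLength P Perm)⁻¹) := by
    have h1 := tendsto_permLaw_splitsAt p hp
    rw [iInf_prod_eq_inv_mean p hp, ← hmean, ← hP] at h1
    exact h1.congr fun n => (splitProb_eq hm n).symm
  refine ⟨fun n π hπ => ?_, hu, ⟨hL.isStrictlyRegenerative hm rfl, hR, fun n => ?_, fun n => ?_⟩,
    ⟨fun z hz => ?_, ?_⟩, fun hfin => ?_, fun hinf => ?_⟩
  · rw [← permLaw_eq_on p hp n π hπ, ← hP, Measure.map_apply hm]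
    · rfl
    · exact measurableSet_of_determined_perm n fun σ τ hst =>
        forall₂_congr fun i hi => by rw [hst i hi]
  · simp_rw [hR]
    exact hu n
  · have h1 := map_cond_preimage (P := P) hm (measurableSet_splitsAt n)
    have h2 := hL.map_residual_cond (n := n) (by rw [hP]; exact permLaw_splitsAt_ne_zero p hp n)
    rw [← h1, Measure.map_map (measurable_residual n) hm] at h2
    exact h2
  · have hsu : Summable fun n : ℕ => ((P.map Perm {σ | SplitsAt σ n}).toReal : ℂ) * z ^ n :=
      (summable_prob_mul_pow (fun _ => prob_le_one) hz).of_norm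
    have hsf : Summable fun n : ℕ => ((P.map Perm {σ | firstLength σ = n}).toReal : ℂ) * z ^ n :=
      (summable_prob_mul_pow (a := fun n : ℕ => P.map Perm {σ | firstLength σ = n})
        (fun _ => prob_le_one) hz).of_norm
    have hU : genU P Perm z = ∑' n : ℕ, ((P.map Perm {σ | SplitsAt σ n}).toReal : ℂ) * z ^ n := by
      rw [hsu.tsum_eq_zero_add, h0, genU]
      simp_rw [splitProb_eq hm]
      simp
    have hprod := hL.tsum_mul_one_sub hz
    rw [← hU] at hprod
    have hU0 : genU P Perm z ≠ 0 := left_ne_zero_of_mul_eq_one hprod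
    have hF : ∑' n : ℕ, ((P.map Perm {σ | firstLength σ = n}).toReal : ℂ) * z ^ n
        = 1 - 1 / genU P Perm z := by
      rw [← eq_one_div_of_mul_eq_one_right hprod]
      ring
    refine ⟨?_, hU0, ?_, ?_⟩
    · simp_rw [splitProb_eq hm]
      exact (summable_nat_add_iff 1).2 hsu
    · rw [← hF, ← integral_powTop_firstLength _ hz, integral_map hm.aemeasurable]
      exact ((measurable_of_countable (powTop z)).comp measurable_firstLength).aestronglyMeasurable
    · simp_rw [firstLengthProb_eq hm]
      rw [← hF, hsf.tsum_eq_zero_add, measure_firstLength_zero]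
      simpa using ((summable_nat_add_iff 1).2 hsf).hasSum
  · simp_rw [firstLengthProb_eq hm]
    rw [tsum_firstLength_succ, hL.tsum_firstLength, genUOne_eq hm h0]
  · have hμ : meanLength P Perm < ∞ := by
      rw [hmean]
      exact (mean_firstLength_lt_top_iff p hp).2 hfin
    have hμL : ∫⁻ σ, (firstLength σ).toENNReal ∂(permLaw p) ≠ ∞ := hmean ▸ hμ.ne
    refine ⟨hμ, htend, ?_, ?_, ?_, starLaw p, ⟨inferInstance, isStationaryLaw_starLaw p hp hμL,
      fun z => ?_, fun z => ?_⟩, isRegenerativeInt_starLaw p hp hμL, fun z => ?_⟩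
    · rw [hmean, ← iInf_prod_eq_inv_mean p hp]
      exact hasProd_one_sub _
    · simp_rw [meanCycles_eq hm]
      rw [meanLength_eq hm]
      exact lintegral_firstLength_eq_tsum (by rwa [hP])
    · have h1 := hL.ae_tendsto_cycleCount (by rwa [hP])
      simp_rw [← meanCycles_eq hm, ← meanLength_eq hm] at h1
      exact ae_of_ae_map hm.aemeasurable h1
    · rw [starLaw_splitsAtInt p hp hμL]
      exact ENNReal.inv_ne_zero.2 hμL
    · have hc : Measurable fun (d : ℕ+ → ℕ+) (i : ℕ+) => ((d i : ℕ) : ℤ) :=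
        measurable_pi_lambda _ fun i =>
          (measurable_of_countable fun k : ℕ+ => ((k : ℕ) : ℤ)).comp (measurable_pi_apply i)
      have h1 := congrArg (Measure.map fun (d : ℕ+ → ℕ+) (i : ℕ+) => ((d i : ℕ) : ℤ)) h.2
      have hpc : Measurable fun ω (i : ℕ+) => Perm ω i := measurable_perm_coe.comp hm
      rw [Measure.map_map hc measurable_shiftMap, Measure.map_map hc hpc] at h1
      exact (starLaw_cond_after p hp hμL z).trans h1.symm
    · rw [starLaw_splitsAtInt p hp hμL, hmean]
  · have hμ : meanLength P Perm = ∞ := by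
      by_contra h1
      rw [← ne_eq, ← lt_top_iff_ne_top, hmean, mean_firstLength_lt_top_iff p hp] at h1
      exact h1.ne hinf
    have hT := isTransient_iff hm hL h0
    have hN : IsNullRecurrent P Perm ↔ ¬ IsTransient P Perm := by
      rw [IsNullRecurrent, ae_firstLength_lt_top_iff hm, and_iff_left hμ]
    refine ⟨?_, ?_, hT, ?_⟩
    · rw [hN]
      exact (em _).symm
    · rw [hN, hT, not_lt, top_le_iff]
    · rintro ⟨ρ, hρ⟩
      refine not_isStationaryVersion hm ?_ ρ hρ
      rw [hμ, ENNReal.inv_top] at htend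
      exact htend.congr (splitProb_eq hm)
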